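/- Let $d\in\{2,3\}$, $\Omega=(0,1)^d$, $T>0$, $0<\chi\le 1$. Let $(\mathsf u,\mathsf p)$ solve the Stokes system $\mathsf u_t-\Delta \mathsf u+\nabla \mathsf p=f$, $\nabla\cdot \mathsf u=0$ in $\Omega\times(0,T]$, $\mathsf u|_{\partial\Omega}=0$, where $\mathsf p(t)$ has zero mean and the source is smooth in time, $f\in W^{2,\infty}((0,T);L^2(\Omega)^d)$. Assume that $\mathsf u\in W^{2,\infty}((0,T);H^2(\Omega)^d)$; that $\mathsf u(t)\in H^1_0(\Omega)^d$; that $\partial_{xxyy}\mathsf u\in W^{1,\infty}((0,T);L^2)$ if $d=2$, and $\partial_{xxyy}\mathsf u,\partial_{yyzz}\mathsf u,\partial_{zzxx}\mathsf u,\partial_{xxyyzz}\mathsf u\in W^{1,\infty}((0,T);L^2)$ if $d=3$; and that $\mathsf p$ and all its spatial derivatives containing each variable at most once ($\partial_x,\partial_y,\partial_{xy}$ for $d=2$; likewise up to $\partial_{xyz}$ for $d=3$) are in $W^{2,\infty}((0,T);L^2(\Omega))$. For $0<\tau\le T$ let $t_s=s\tau$ and $K=\lfloor T/\tau\rfloor$,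 and write $\psi^{s}=\psi(t_s)$ for functions of time. Consider the following scheme, whose equations hold in $L^2(\Omega)$ and whose boundary conditions hold in the sense of traces. Set $u^0=\mathsf u(0)$, $p^{-1/2}=\mathsf p(0)$, $\phi^{-1/2}=\phi^\star$ (given, possibly depending on $\tau$). For $0\le k<K$: 1. $p^{\star,k+1/2}=p^{k-1/2}+\phi^{k-1/2}$. 2. If $d=2$, find $u^{k+1/2},u^{k+1}$ with $\frac{u^{k+1/2}-u^k}{\tau/2}-\partial_{xx}u^{k+1/2}-\partial_{yy}u^k+\nabla p^{\star,k+1/2}=f^{k+1/2}$, $u^{k+1/2}|_{x=0,1}=0$, and $\frac{u^{k+1}-u^{k+1/2}}{\tau/2}-\partial_{xx}u^{k+1/2}-\partial_{yy}u^{k+1}+\nabla p^{\star,k+1/2}=f^{k+1/2}$, $u^{k+1}|_{y=0,1}=0$. If $d=3$, find $\xi,\eta,\zeta,u^{k+1}$ with $\frac{\xi-u^k}{\tau}-\Delta u^k+\nabla p^{\star,k+1/2}=f^{k+1/2}$; $\frac{\eta-\xi}{\tau}-\frac12\partial_{xx}(\eta-u^k)=0$, $\eta|_{x=0,1}=0$;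 $\frac{\zeta-\eta}{\tau}-\frac12\partial_{yy}(\zeta-u^k)=0$, $\zeta|_{y=0,1}=0$; $\frac{u^{k+1}-\zeta}{\tau}-\frac12\partial_{zz}(u^{k+1}-u^k)=0$, $u^{k+1}|_{z=0,1}=0$. 3. Find $\phi^{k+1/2}$ of zero mean with $A\phi^{k+1/2}=-\frac1\tau\nabla\cdot u^{k+1}$, where $A=(1-\partial_{xx})(1-\partial_{yy})$ if $d=2$, with $\partial_y\phi|_{y=0,1}=0$ and $\partial_x(1-\partial_{yy})\phi|_{x=0,1}=0$; and $A=(1-\partial_{xx})(1-\partial_{yy})(1-\partial_{zz})$ if $d=3$, with $\partial_z\phi|_{z=0,1}=0$, $\partial_y(1-\partial_{zz})\phi|_{y=0,1}=0$ and $\partial_x(1-\partial_{yy})(1-\partial_{zz})\phi|_{x=0,1}=0$. 4. $p^{k+1/2}=p^{k-1/2}+\phi^{k+1/2}-\chi\,\nabla\cdot\frac{u^{k+1}+u^k}{2}$. Put $e^k=\mathsf u(t_k)-u^k$, $\delta\psi^k=\psi^k-\psi^{k-1}$ and $\bar e^{k+1/2}=\frac12(e^{k+1}+e^k)$. Then for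 every $c_0$ there is a constant $c$, depending only on $d,T,\chi,f,\mathsf u,\mathsf p,c_0$ (not on $\tau$, $\phi^\star$ or the discrete solution), such that for every $0<\tau\le T$ and every solution of the scheme with $\|\mathsf p(\tau/2)-p^{\star,1/2}\|_{H^1(\Omega)}\le c_0\tau$, every $e^k$, $0\le k\le K$, is in $H^1(\Omega)^d$ and $$\max_{1\le k\le K}\|\delta e^k\|_{L^2}^2+\tau\max_{1\le k\le K}\|\nabla\times\delta e^k\|_{L^2}^2+\tau\sum_{k=1}^{K-1}\|\nabla\times\delta\bar e^{k+1/2}\|_{L^2}^2+\tau\max_{0\le k\le K}\|\nabla\cdot e^k\|_{L^2}^2\le c\,\tau^4 .$$ -/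

import Mathlib

noncomputable section

namespace DirectionSplitting

open MeasureTheory

/-! ### The cube, `L²`, and weak derivatives -/

/-- The open unit cube `Ω = (0,1)^d`. -/
def cube (d : ℕ) : Set (Fin d → ℝ) := Set.univ.pi fun _ => Set.Ioo (0 : ℝ) 1

/-- The space `L²(Ω)`. -/
abbrev L2 (d : ℕ) : Type := Lp ℝ 2 (volume.restrict (cube d))

/-- Vector fields in `L²(Ω)^d`. -/
abbrev Field (d : ℕ) : Type := Fin d → L2 d

/-- The classical partial derivative `∂ᵢψ`. -/
def pd {d : ℕ} (i : Fin d) (ψ : (Fin d → ℝ) → ℝ) : (Fin d → ℝ) → ℝ :=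
  fun x => fderiv ℝ ψ x (Pi.single i 1)

/-- The classical iterated partial derivative along a list of directions. -/
def pdList {d : ℕ} (l : List (Fin d)) (ψ : (Fin d → ℝ) → ℝ) : (Fin d → ℝ) → ℝ :=
  l.foldr pd ψ

/-- A function that is `C^∞` on the whole space. -/
def IsSmooth {d : ℕ} (ψ : (Fin d → ℝ) → ℝ) : Prop := ContDiff ℝ ((⊤ : ℕ∞) : WithTop ℕ∞) ψ

/-- `g ∈ L²(Ω)` is the distributional derivative of `v` along the directions in `l`
(for `l = [i, j, …]` this says `∂ᵢ∂ⱼ… v = g`). -/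
def HasWeakDeriv {d : ℕ} (l : List (Fin d)) (v g : L2 d) : Prop :=
  ∀ ψ : (Fin d → ℝ) → ℝ, IsSmooth ψ → HasCompactSupport ψ → tsupport ψ ⊆ cube d →
    ∫ x in cube d, v x * pdList l ψ x = (-1 : ℝ) ^ l.length * ∫ x in cube d, g x * ψ x

/-- `∂ᵢ v = g` and `v` vanishes on the two faces `xᵢ = 0` and `xᵢ = 1`, in the sense of traces:
Green's formula in direction `i` has no boundary term, for test functions that are
smooth up to the boundary and need not vanish there. -/
def HasWeakDerivZeroTrace {d : ℕ} (i : Fin d) (v g : L2 d) : Prop :=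
  ∀ ψ : (Fin d → ℝ) → ℝ, IsSmooth ψ →
    ∫ x in cube d, v x * pd i ψ x = - ∫ x in cube d, g x * ψ x

/-- `∂ᵢᵢ v = g` with the Dirichlet condition `v = 0` at `xᵢ = 0, 1`. -/
def HasDirichletDeriv2 {d : ℕ} (i : Fin d) (v g : L2 d) : Prop :=
  ∃ v' : L2 d, HasWeakDerivZeroTrace i v v' ∧ HasWeakDeriv [i] v' g

/-- `∂ᵢᵢ v = g` with the Neumann condition `∂ᵢ v = 0` at `xᵢ = 0, 1`. -/
def HasNeumannDeriv2 {d : ℕ} (i : Fin d) (v g : L2 d) : Prop :=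
  ∃ v' : L2 d, HasWeakDeriv [i] v v' ∧ HasWeakDerivZeroTrace i v' g

/-- `v ∈ H¹₀(Ω)`: all first derivatives are in `L²(Ω)` and `v` vanishes on all faces. -/
def MemH10 {d : ℕ} (v : L2 d) : Prop :=
  ∀ i, ∃ g : L2 d, HasWeakDerivZeroTrace i v g

/-- `v ∈ H¹(Ω)`. -/
def MemH1 {d : ℕ} (v : L2 d) : Prop :=
  ∀ i, ∃ g : L2 d, HasWeakDeriv [i] v g

open Classical in
/-- The weak derivative `∂ᵢ v` as an element of `L²(Ω)`; the value is `0` if it does not exist. -/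
def wd {d : ℕ} (i : Fin d) (v : L2 d) : L2 d :=
  if h : ∃ g : L2 d, HasWeakDeriv [i] v g then h.choose else 0

/-- `g = div v`, all derivatives `∂ᵢ vᵢ` being in `L²(Ω)`. -/
def HasDiv {d : ℕ} (v : Field d) (g : L2 d) : Prop :=
  ∃ D : Fin d → L2 d, (∀ i, HasWeakDeriv [i] (v i) (D i)) ∧ g = ∑ i, D i

/-- `G = Δ v` componentwise, all second derivatives `∂ⱼⱼ vᵢ` being in `L²(Ω)`. -/
def HasLaplacian {d : ℕ} (v G : Field d) : Prop :=
  ∃ D : Fin d → Fin d → L2 d,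
    (∀ i j, HasWeakDeriv [j, j] (v i) (D i j)) ∧ ∀ i, G i = ∑ j, D i j

/-- `G = ∇ q`. -/
def HasGrad {d : ℕ} (q : L2 d) (G : Field d) : Prop :=
  ∀ i, HasWeakDeriv [i] q (G i)

/-- Functions of zero mean. -/
def ZeroMean {d : ℕ} (q : L2 d) : Prop := ∫ x in cube d, q x = 0

/-! ### Norms -/

/-- The `L²` norm of a vector field. -/
def l2Norm {d : ℕ} (v : Field d) : ℝ := Real.sqrt (∑ i, ‖v i‖ ^ 2)

/-- `‖div v‖_{L²}`. -/
def divNorm {d : ℕ} (v : Field d) : ℝ := ‖∑ i, wd i (v i)‖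

/-- `‖curl v‖_{L²}`. The numbers `∂ᵢ vⱼ - ∂ⱼ vᵢ`, `i < j`, are up to sign the components of the
curl: one scalar for `d = 2` and three components for `d = 3`. -/
def curlNorm {d : ℕ} (v : Field d) : ℝ :=
  Real.sqrt (∑ i, ∑ j ∈ Finset.univ.filter (fun j => i < j), ‖wd i (v j) - wd j (v i)‖ ^ 2)

/-- The maximum over a finite set of (nonnegative) norms. -/
def lInfSeq (s : Finset ℕ) (a : ℕ → ℝ) : ℝ := ((s.sup fun k => (a k).toNNReal : NNReal) : ℝ)

/-- The discrete `ℓ²` norm with time step `τ`. -/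
def lTwoSeq (τ : ℝ) (s : Finset ℕ) (a : ℕ → ℝ) : ℝ := Real.sqrt (τ * ∑ k ∈ s, a k ^ 2)

/-! ### Time regularity -/

/-- `g ∈ W^{m,∞}((0,T); E)`. For `m ≥ 1`, `g` is moreover the continuous representative,
so that its values on `[0,T]` are meaningful. -/
def MemWInf {E : Type*} [NormedAddCommGroup E] [NormedSpace ℝ E] (T : ℝ) :
    ℕ → (ℝ → E) → Prop
  | 0, g => MemLp g ⊤ (volume.restrict (Set.Ioc 0 T))
  | m + 1, g => ∃ g' : ℝ → E, MemWInf T m g' ∧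
      ∀ t ∈ Set.Icc (0 : ℝ) T, g t = g 0 + ∫ s in (0 : ℝ)..t, g' s

/-- The spatial derivative of `v` along `l` exists at all times and is in `W^{m,∞}((0,T); L²)`. -/
def DerivMemWInf {d : ℕ} (T : ℝ) (m : ℕ) (l : List (Fin d)) (v : ℝ → L2 d) : Prop :=
  ∃ g : ℝ → L2 d, (∀ t ∈ Set.Icc (0 : ℝ) T, HasWeakDeriv l (v t) (g t)) ∧ MemWInf T m g

/-- `u ∈ W^{2,∞}(H²) ∩ W^{1,∞}(D(B))`: derivatives of order at most two are in `W^{2,∞}(L²)`;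
`u(t) ∈ H¹₀`; and the derivatives that make up `B`, i.e. `∂_{xxyy}` for `d = 2` and
`∂_{xxyy}, ∂_{yyzz}, ∂_{zzxx}, ∂_{xxyyzz}` for `d = 3`, are in `W^{1,∞}(L²)`. -/
structure VelocityRegular {d : ℕ} (T : ℝ) (u : ℝ → Field d) : Prop where
  h2 : ∀ i, ∀ l : List (Fin d), l.length ≤ 2 → DerivMemWInf T 2 l (fun t => u t i)
  h10 : ∀ i, ∀ t ∈ Set.Icc (0 : ℝ) T, MemH10 (u t i)
  dB : ∀ i, ∀ l : List (Fin d), l.Nodup → 2 ≤ l.length →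
    DerivMemWInf T 1 (l ++ l) (fun t => u t i)

/-- `p ∈ W^{2,∞}(Y)`: `p(t)` has zero mean, and all derivatives that contain each direction at
most once are in `W^{2,∞}(L²)`. -/
structure PressureRegular {d : ℕ} (T : ℝ) (p : ℝ → L2 d) : Prop where
  zeroMean : ∀ t ∈ Set.Icc (0 : ℝ) T, ZeroMean (p t)
  mixed : ∀ l : List (Fin d), l.Nodup → DerivMemWInf T 2 l p

/-! ### The Stokes system -/

/-- `(u, p)` solves `u_t - Δu + ∇p = f`, `div u = 0`, `u = 0` on `∂Ω`. -/
structure IsStokesSolution {d : ℕ} (T : ℝ) (f u : ℝ → Field d) (p : ℝ → L2 d) : Prop where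
  momentum : ∀ t ∈ Set.Ioc (0 : ℝ) T, ∃ L G : Field d,
    HasLaplacian (u t) L ∧ HasGrad (p t) G ∧
    HasDerivWithinAt u (L - G + f t) (Set.Icc 0 T) t
  divFree : ∀ t ∈ Set.Icc (0 : ℝ) T, HasDiv (u t) 0
  boundary : ∀ t ∈ Set.Ioc (0 : ℝ) T, ∀ i, MemH10 (u t i)

/-! ### The direction splitting scheme -/

/-- `g = (1 - ∂ᵢᵢ) v` with `∂ᵢ v = 0` at `xᵢ = 0, 1`. -/
def HasHelmholtz {d : ℕ} (i : Fin d) (v g : L2 d) : Prop :=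
  ∃ v'' : L2 d, HasNeumannDeriv2 i v v'' ∧ g = v - v''

/-- `q ∈ D(A)` and `A q = g`, where `A = (1 - ∂_{xx})(1 - ∂_{yy})` for `d = 2` and
`A = (1 - ∂_{xx})(1 - ∂_{yy})(1 - ∂_{zz})` for `d = 3`. -/
def HasA : (d : ℕ) → L2 d → L2 d → Prop
  | 2, q, g => ZeroMean q ∧ ∃ w : L2 2, HasHelmholtz 1 q w ∧ HasHelmholtz 0 w g
  | 3, q, g => ZeroMean q ∧ ∃ w₁ w₂ : L2 3,
      HasHelmholtz 2 q w₁ ∧ HasHelmholtz 1 w₁ w₂ ∧ HasHelmholtz 0 w₂ g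
  | _, _, _ => False

/-- The two-dimensional velocity update `u ↦ v` with pressure predictor `q` and source `F`;
`w` is the half-step velocity. -/
def VelocityStep2 (τ : ℝ) (F : Field 2) (q : L2 2) (u v : Field 2) : Prop :=
  ∃ w wxx uyy vyy G : Field 2,
    (∀ i, HasDirichletDeriv2 0 (w i) (wxx i)) ∧
    (∀ i, HasWeakDeriv [1, 1] (u i) (uyy i)) ∧
    (∀ i, HasDirichletDeriv2 1 (v i) (vyy i)) ∧
    HasGrad q G ∧
    (τ / 2)⁻¹ • (w - u) - wxx - uyy + G = F ∧
    (τ / 2)⁻¹ • (v - w) - wxx - vyy + G = F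

/-- The three-dimensional velocity update `u ↦ v` with pressure predictor `q` and source `F`.
The field `ξ` is given explicitly by the first equation. -/
def VelocityStep3 (τ : ℝ) (F : Field 3) (q : L2 3) (u v : Field 3) : Prop :=
  ∃ ξ η ζ L G uxx uyy uzz ηxx ζyy vzz : Field 3,
    HasLaplacian u L ∧ HasGrad q G ∧
    (∀ i, HasWeakDeriv [0, 0] (u i) (uxx i)) ∧
    (∀ i, HasWeakDeriv [1, 1] (u i) (uyy i)) ∧
    (∀ i, HasWeakDeriv [2, 2] (u i) (uzz i)) ∧
    (∀ i, HasDirichletDeriv2 0 (η i) (ηxx i)) ∧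
    (∀ i, HasDirichletDeriv2 1 (ζ i) (ζyy i)) ∧
    (∀ i, HasDirichletDeriv2 2 (v i) (vzz i)) ∧
    τ⁻¹ • (ξ - u) - L + G = F ∧
    τ⁻¹ • (η - ξ) - (1 / 2 : ℝ) • (ηxx - uxx) = 0 ∧
    τ⁻¹ • (ζ - η) - (1 / 2 : ℝ) • (ζyy - uyy) = 0 ∧
    τ⁻¹ • (v - ζ) - (1 / 2 : ℝ) • (vzz - uzz) = 0

/-- The velocity update in dimension two or three. -/
def VelocityStep : (d : ℕ) → ℝ → Field d → L2 d → Field d → Field d → Prop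
  | 2, τ, F, q, u, v => VelocityStep2 τ F q u v
  | 3, τ, F, q, u, v => VelocityStep3 τ F q u v
  | _, _, _, _, _, _ => False

/-- The sequences `u k = u^k`, `φ k = φ^{k-1/2}`, `p k = p^{k-1/2}` are produced by `K` steps of
the scheme with time step `τ`, parameter `χ`, source `f`, initial velocity `u₀`, initial pressure
`p₀` and initial pressure increment `φs`. -/
structure IsSchemeSolution {d : ℕ} (K : ℕ) (τ χ : ℝ) (f : ℝ → Field d)
    (u₀ : Field d) (p₀ φs : L2 d) (u : ℕ → Field d) (φ p : ℕ → L2 d) : Prop where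
  init_u : u 0 = u₀
  init_p : p 0 = p₀
  init_φ : φ 0 = φs
  /-- Velocity update, with the pressure predictor `p^{k-1/2} + φ^{k-1/2}`. -/
  velocity : ∀ k < K,
    VelocityStep d τ (f (((k : ℝ) + 1 / 2) * τ)) (p k + φ k) (u k) (u (k + 1))
  penalty : ∀ k < K, ∃ D : L2 d, HasDiv (u (k + 1)) D ∧ HasA d (φ (k + 1)) (-(τ⁻¹ • D))
  pressure : ∀ k < K, ∃ D : L2 d, HasDiv ((1 / 2 : ℝ) • (u (k + 1) + u k)) D ∧
    p (k + 1) = p k + φ (k + 1) - χ • D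

/-- `q ∈ H¹(Ω)` and its `H¹` norm is at most `r`. -/
def H1NormLE {d : ℕ} (q : L2 d) (r : ℝ) : Prop :=
  ∃ G : Field d, HasGrad q G ∧ Real.sqrt (‖q‖ ^ 2 + l2Norm G ^ 2) ≤ r

/-! ### Errors -/

/-- The velocity error `e^k = u(t_k) - u^k`, with `t_k = kτ`. -/
def velErr {d : ℕ} (τ : ℝ) (uE : ℝ → Field d) (u : ℕ → Field d) (k : ℕ) : Field d :=
  uE ((k : ℝ) * τ) - u k

/-- The time increment `δψ^k = ψ^k - ψ^{k-1}`, used for `k ≥ 1`. -/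
def incr {d : ℕ} (ψ : ℕ → Field d) (k : ℕ) : Field d := ψ k - ψ (k - 1)

/-- The time average `(ψ^{k+1} + ψ^k) / 2`, indexed by `k`. -/
def avg {d : ℕ} (ψ : ℕ → Field d) (k : ℕ) : Field d := (1 / 2 : ℝ) • (ψ (k + 1) + ψ k)

end DirectionSplitting

end

/-!
In the sine coefficients of the velocity error `e`, both splittings amount to the same two-level
scheme `B (e^{k+1} - e^k) = τ (Δ e^k - ∇ q^k + r^k)`, where `B = ∏ᵢ (1 - (τ/2) ∂ᵢᵢ)`, `q^k` is the
error of the pressure predictor, and the residual `r^k` is of size `τ²`; here the bounds on the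
mixed derivatives of the velocity control `B - 1 + (τ/2) Δ`. Difference this equation in time and
test it with the new increment `δe = e^{k+2} - e^{k+1}`. As `B ≥ 1 - (τ/2) Δ` and
`‖∇v‖² = ‖div v‖² + ‖curl v‖²` for fields that vanish on the boundary, the velocity terms bound
`‖δe‖²` and the curls.

The pressure enters through the pairing of the increment of `q` with `div δe`. The penalty equation
says `div e = A (τ φ)`, and `A` is diagonal in the cosine basis, so `A^{1/2}` can be moved from
`div δe` to the other side, and the pairing becomes an inner product of increments
`X = A^{1/2} (τ φ)`. The pressure update turns it into a telescoping sum plus second differences of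
`X`; these are absorbed by the second differences of `e`, because
`‖A^{-1/2} div v‖ ≤ ‖v‖`. The mixed derivatives of the pressure bound the consistency errors of
`X` against the increments of `A^{1/2} 𝗉`.

If `S²` bounds the energy at all steps, what results is `S² ≤ a τ⁴ + b τ² S` with constants `a` and
`b`, and hence `S² ≤ c τ⁴`. The error of the initial guess, of size `τ` only, enters the residual of
the first step alone, and there it costs no more than a constant multiple of `τ² S` because
the residual is multiplied by `τ`.
-/

noncomputable section

namespace DirectionSplitting

open MeasureTheory
open scoped Real ContDiff

/-! ### Continuous functions as elements of `L²` -/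

section Cube

variable {d : ℕ}

lemma measurableSet_cube (d : ℕ) : MeasurableSet (cube d) :=
  MeasurableSet.univ_pi fun _ => measurableSet_Ioo

lemma isOpen_cube (d : ℕ) : IsOpen (cube d) :=
  isOpen_set_pi Set.finite_univ fun _ _ => isOpen_Ioo

lemma cube_subset_Icc (d : ℕ) : cube d ⊆ Set.Icc (0 : Fin d → ℝ) 1 := fun _ hx =>
  ⟨fun i => (hx i (Set.mem_univ i)).1.le, fun i => (hx i (Set.mem_univ i)).2.le⟩

lemma ae_cube_of_forall_mem {P : (Fin d → ℝ) → Prop} (h : ∀ x ∈ cube d, P x) :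
    ∀ᵐ x ∂volume.restrict (cube d), P x :=
  ae_restrict_of_forall_mem (measurableSet_cube d) h

lemma volume_restrict_cube (d : ℕ) : (volume : Measure (Fin d → ℝ)).restrict (cube d) =
    Measure.pi fun _ => (volume : Measure ℝ).restrict (Set.Ioo 0 1) :=
  Measure.restrict_pi_pi _ _

instance isFiniteMeasure_cube (d : ℕ) :
    IsFiniteMeasure ((volume : Measure (Fin d → ℝ)).restrict (cube d)) := by
  rw [volume_restrict_cube]; infer_instance

lemma memLp_cube_of_continuous {ψ : (Fin d → ℝ) → ℝ} (h : Continuous ψ) {p : ENNReal} :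
    MemLp ψ p (volume.restrict (cube d)) := by
  obtain ⟨C, hC⟩ := (isCompact_Icc (a := (0 : Fin d → ℝ)) (b := 1)).exists_bound_of_continuousOn
    h.continuousOn
  exact MemLp.of_bound h.aestronglyMeasurable C
    (ae_cube_of_forall_mem fun x hx => hC x (cube_subset_Icc d hx))

open Classical in
/-- The class in `L²(Ω)` of a function on the whole space, `0` if it is not square integrable. -/
def toL2 (ψ : (Fin d → ℝ) → ℝ) : L2 d :=
  if h : MemLp ψ 2 (volume.restrict (cube d)) then h.toLp ψ else 0

lemma coeFn_toL2 {ψ : (Fin d → ℝ) → ℝ} (h : Continuous ψ) :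
    toL2 ψ =ᵐ[volume.restrict (cube d)] ψ := by
  rw [toL2, dif_pos (memLp_cube_of_continuous h)]
  exact MemLp.coeFn_toLp _

lemma inner_toL2 (v : L2 d) {ψ : (Fin d → ℝ) → ℝ} (h : Continuous ψ) :
    inner ℝ v (toL2 ψ) = ∫ x in cube d, v x * ψ x := by
  rw [L2.inner_def]
  refine integral_congr_ae ?_
  filter_upwards [coeFn_toL2 h] with x hx
  rw [hx, real_inner_eq_re_inner, RCLike.inner_apply', conj_trivial, RCLike.re_to_real]

lemma integrable_mul_continuous (v : L2 d) {ψ : (Fin d → ℝ) → ℝ} (h : Continuous ψ) :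
    Integrable (fun x => v x * ψ x) (volume.restrict (cube d)) :=
  MemLp.integrable_mul (p := 2) (q := 2) (Lp.memLp v) (memLp_cube_of_continuous h)

lemma ae_eq_zero_of_integral_mul_testFunction {F : (Fin d → ℝ) → ℝ}
    (hF : Integrable F (volume.restrict (cube d)))
    (h : ∀ ψ : (Fin d → ℝ) → ℝ, IsSmooth ψ → HasCompactSupport ψ → tsupport ψ ⊆ cube d →
      ∫ x in cube d, F x * ψ x = 0) : F =ᵐ[volume.restrict (cube d)] 0 := by
  refine (ae_restrict_iff' (measurableSet_cube d)).2 <|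
    (isOpen_cube d).ae_eq_zero_of_integral_contDiff_smul_eq_zero (μ := volume)
      (IntegrableOn.locallyIntegrableOn hF) fun ψ hψ hc ht => ?_
  have hvanish : ∀ x ∉ cube d, ψ x • F x = 0 := fun x hx => by
    rw [image_eq_zero_of_notMem_tsupport (mt (@ht x) hx), zero_smul]
  rw [← setIntegral_eq_integral_of_forall_compl_eq_zero hvanish, ← h ψ hψ hc ht]
  simp only [smul_eq_mul, mul_comm]

lemma eq_of_integral_mul_testFunction {v w : L2 d}
    (h : ∀ ψ : (Fin d → ℝ) → ℝ, IsSmooth ψ → HasCompactSupport ψ → tsupport ψ ⊆ cube d →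
      ∫ x in cube d, v x * ψ x = ∫ x in cube d, w x * ψ x) : v = w := by
  refine sub_eq_zero.1 (Lp.ext (.trans ?_ (Lp.coeFn_zero _ _ _).symm))
  refine ae_eq_zero_of_integral_mul_testFunction ((Lp.memLp (v - w)).integrable one_le_two)
    fun ψ hψ hc ht => ?_
  rw [← inner_toL2 _ hψ.continuous, inner_sub_left, inner_toL2 _ hψ.continuous,
    inner_toL2 _ hψ.continuous, h ψ hψ hc ht, sub_self]

lemma HasWeakDeriv.unique {l : List (Fin d)} {v g g' : L2 d}
    (h : HasWeakDeriv l v g) (h' : HasWeakDeriv l v g') : g = g' :=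
  eq_of_integral_mul_testFunction fun ψ hψ hc ht =>
    mul_left_cancel₀ (pow_ne_zero _ (by norm_num)) ((h ψ hψ hc ht).symm.trans (h' ψ hψ hc ht))

end Cube

/-! ### Products of sines and cosines -/

section TrigMode

/-- The constant that normalizes `cos(πkx)` in `L²(0,1)`. -/
def cosNorm (k : ℕ) : ℝ := if k = 0 then 1 else √2

/-- The normalized functions `√2 sin(πkx)` (`s = true`) and `1`, `√2 cos(πkx)` (`s = false`)
on the unit interval. -/
def trigMode (s : Bool) (k : ℕ) (x : ℝ) : ℝ :=
  bif s then √2 * Real.sin (π * k * x) else cosNorm k * Real.cos (π * k * x)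

lemma cosNorm_sq (k : ℕ) : cosNorm k * cosNorm k = if k = 0 then 1 else 2 := by
  unfold cosNorm
  split_ifs <;> norm_num

lemma cosNorm_ne_zero (k : ℕ) : cosNorm k ≠ 0 := by
  unfold cosNorm
  split_ifs <;> positivity

lemma contDiff_trigMode (s : Bool) (k : ℕ) : ContDiff ℝ ∞ (trigMode s k) := by
  cases s <;> unfold trigMode <;> dsimp only [cond_true, cond_false] <;> fun_prop

lemma trigMode_true_mul (j k : ℕ) (x : ℝ) : trigMode true j x * trigMode true k x =
    Real.cos (π * ((j - k : ℤ) : ℝ) * x) - Real.cos (π * ((j + k : ℤ) : ℝ) * x) := by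
  push_cast
  simp only [mul_sub π, mul_add π, sub_mul, add_mul, Real.cos_sub, Real.cos_add, trigMode,
    cond_true]
  linear_combination Real.sin (π * j * x) * Real.sin (π * k * x) *
    Real.mul_self_sqrt (zero_le_two (α := ℝ))

lemma trigMode_false_mul (j k : ℕ) (x : ℝ) : trigMode false j x * trigMode false k x =
    cosNorm j * cosNorm k / 2 *
      (Real.cos (π * ((j - k : ℤ) : ℝ) * x) + Real.cos (π * ((j + k : ℤ) : ℝ) * x)) := by
  push_cast
  simp only [mul_sub π, mul_add π, sub_mul, add_mul (π * (j : ℝ)), Real.cos_sub, Real.cos_add,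
    trigMode, cond_false]
  ring

lemma integral_cos_pi_mul_int (m : ℤ) :
    ∫ x in Set.Ioo (0 : ℝ) 1, Real.cos (π * m * x) = if m = 0 then 1 else 0 := by
  rw [← integral_Ioc_eq_integral_Ioo, ← intervalIntegral.integral_of_le zero_le_one]
  split_ifs with h
  · simp [h]
  · have hm : π * m ≠ 0 := mul_ne_zero Real.pi_ne_zero (by exact_mod_cast h)
    rw [intervalIntegral.integral_comp_mul_left (fun y => Real.cos y) hm]
    simp [mul_comm π, Real.sin_int_mul_pi]

lemma integral_trigMode_mul (s : Bool) (j k : ℕ) :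
    ∫ x in Set.Ioo (0 : ℝ) 1, trigMode s j x * trigMode s k x =
      if j = k ∧ (s = true → k ≠ 0) then 1 else 0 := by
  have hint : ∀ m : ℤ, IntegrableOn (fun x => Real.cos (π * m * x)) (Set.Ioo (0 : ℝ) 1) :=
    fun m => (Continuous.integrableOn_Icc (by fun_prop)).mono_set Set.Ioo_subset_Icc_self
  cases s with
  | true =>
    simp_rw [trigMode_true_mul]
    rw [integral_sub (hint _) (hint _), integral_cos_pi_mul_int, integral_cos_pi_mul_int]
    grind
  | false =>
    simp_rw [trigMode_false_mul]
    rw [integral_const_mul, integral_add (hint _) (hint _), integral_cos_pi_mul_int,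
      integral_cos_pi_mul_int]
    rcases eq_or_ne j k with rfl | hjk
    · rw [cosNorm_sq]
      grind
    · grind

lemma exists_trigMode_mul_cos_eq (s : Bool) (k : ℕ) : ∃ (a b : ℝ) (k₁ k₂ : ℕ), ∀ x,
    trigMode s k x * Real.cos (π * x) = a * trigMode s k₁ x + b * trigMode s k₂ x := by
  have hadd : ∀ (m : ℕ) (x : ℝ), π * (m + 1 : ℕ) * x = π * m * x + π * x := fun m x => by
    push_cast; ring
  match s, k with
  | true, 0 => exact ⟨0, 0, 0, 0, fun x => by simp [trigMode]⟩
  | true, m + 1 =>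
    refine ⟨1 / 2, 1 / 2, m + 2, m, fun x => ?_⟩
    simp only [trigMode, cond_true, hadd, Real.sin_add, Real.cos_add]
    linear_combination (√2 / 2 * Real.sin (π * m * x)) * Real.sin_sq_add_cos_sq (π * x)
  | false, 0 =>
    refine ⟨1 / cosNorm 1, 0, 1, 0, fun x => ?_⟩
    have := cosNorm_ne_zero 1
    simp only [trigMode, cond_false, cosNorm, if_true]
    field_simp
    simp
  | false, m + 1 =>
    refine ⟨cosNorm (m + 1) / (2 * cosNorm (m + 2)), cosNorm (m + 1) / (2 * cosNorm m), m + 2, m,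
      fun x => ?_⟩
    have h₀ := cosNorm_ne_zero m
    have h₂ := cosNorm_ne_zero (m + 2)
    simp only [trigMode, cond_false, hadd, Real.sin_add, Real.cos_add]
    field_simp
    linear_combination (cosNorm (m + 1) * Real.cos (π * m * x)) * Real.sin_sq_add_cos_sq (π * x)

end TrigMode

section TrigProd

variable {d : ℕ}

/-- The tensor product `x ↦ ∏ₗ αₗ(xₗ)` of functions of one variable. -/
def tensor (α : Fin d → ℝ → ℝ) (x : Fin d → ℝ) : ℝ := ∏ l, α l (x l)

/-- The trigonometric product of multi-index `n`, with sines in the directions where `σ` is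
`true` and cosines in the others. -/
def trigProd (σ : Fin d → Bool) (n : Fin d → ℕ) : (Fin d → ℝ) → ℝ :=
  tensor fun l => trigMode (σ l) (n l)

/-- The coefficient of an element of `L²(Ω)` along `trigProd σ n`. -/
def trigCoeff (σ : Fin d → Bool) (n : Fin d → ℕ) : L2 d →L[ℝ] ℝ :=
  innerSL ℝ (toL2 (trigProd σ n))

/-- The multi-indices of the trigonometric products of type `σ` that do not vanish identically,
`sin 0 = 0` being the only degeneracy. -/
def IsMode (σ : Fin d → Bool) (n : Fin d → ℕ) : Prop := ∀ l, σ l = true → n l ≠ 0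

lemma isSmooth_tensor {α : Fin d → ℝ → ℝ} (h : ∀ l, ContDiff ℝ ∞ (α l)) :
    IsSmooth (tensor α) :=
  contDiff_prod fun l _ => (h l).comp (contDiff_apply ℝ ℝ l)

lemma continuous_tensor {α : Fin d → ℝ → ℝ} (h : ∀ l, Continuous (α l)) :
    Continuous (tensor α) :=
  continuous_finsetProd _ fun l _ => (h l).comp (continuous_apply l)

lemma tensor_update (α : Fin d → ℝ → ℝ) (i : Fin d) (β : ℝ → ℝ) (x : Fin d → ℝ) :
    tensor (Function.update α i β) x = β (x i) * ∏ l ∈ Finset.univ.erase i, α l (x l) := by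
  rw [tensor, ← Finset.mul_prod_erase _ _ (Finset.mem_univ i), Function.update_self]
  congr 1
  exact Finset.prod_congr rfl fun l hl => by
    rw [Function.update_of_ne (Finset.ne_of_mem_erase hl)]

lemma tensor_eq_mul (α : Fin d → ℝ → ℝ) (i : Fin d) (x : Fin d → ℝ) :
    tensor α x = α i (x i) * ∏ l ∈ Finset.univ.erase i, α l (x l) := by
  rw [← tensor_update, Function.update_eq_self]

lemma integral_tensor (α : Fin d → ℝ → ℝ) :
    ∫ x in cube d, tensor α x = ∏ l, ∫ x in Set.Ioo (0 : ℝ) 1, α l x := by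
  rw [volume_restrict_cube]
  exact integral_fintype_prod_eq_prod α

lemma isSmooth_trigProd (σ : Fin d → Bool) (n : Fin d → ℕ) : IsSmooth (trigProd σ n) :=
  isSmooth_tensor fun _ => contDiff_trigMode _ _

lemma continuous_trigProd (σ : Fin d → Bool) (n : Fin d → ℕ) : Continuous (trigProd σ n) :=
  (isSmooth_trigProd σ n).continuous

lemma trigProd_update_index (σ : Fin d → Bool) (n : Fin d → ℕ) (i : Fin d) (k : ℕ) :
    trigProd σ (Function.update n i k) =
      tensor (Function.update (fun l => trigMode (σ l) (n l)) i (trigMode (σ i) k)) := by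
  unfold trigProd
  congr 1
  funext l
  rcases eq_or_ne l i with rfl | h
  · simp only [Function.update_self]
  · simp only [Function.update_of_ne h]

lemma trigProd_eq_zero {σ : Fin d → Bool} {n : Fin d → ℕ} (h : ¬ IsMode σ n) :
    trigProd σ n = 0 := by
  simp only [IsMode, not_forall, not_not] at h
  obtain ⟨l, hl, hn⟩ := h
  funext x
  exact Finset.prod_eq_zero (Finset.mem_univ l) (by simp [trigMode, hl, hn])

lemma trigCoeff_apply (σ : Fin d → Bool) (n : Fin d → ℕ) (v : L2 d) :
    trigCoeff σ n v = ∫ x in cube d, v x * trigProd σ n x := by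
  rw [trigCoeff, innerSL_apply_apply, real_inner_comm, inner_toL2 v (continuous_trigProd σ n)]

lemma trigCoeff_eq_zero {σ : Fin d → Bool} {n : Fin d → ℕ} (h : ¬ IsMode σ n) (v : L2 d) :
    trigCoeff σ n v = 0 := by
  simp only [trigCoeff_apply, trigProd_eq_zero h, Pi.zero_apply, mul_zero, integral_zero]

lemma orthonormal_trigProd (σ : Fin d → Bool) :
    Orthonormal ℝ fun n : {n // IsMode σ n} => (toL2 (trigProd σ n.1) : L2 d) := by
  classical
  rw [orthonormal_iff_ite]
  intro n m
  have hcongr : ∫ x in cube d, (toL2 (trigProd σ n.1) : L2 d) x * trigProd σ m.1 x =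
      ∫ x in cube d, tensor (fun l y => trigMode (σ l) (n.1 l) y * trigMode (σ l) (m.1 l) y) x := by
    refine integral_congr_ae ?_
    filter_upwards [coeFn_toL2 (continuous_trigProd σ n.1)] with x hx
    rw [hx]
    simp only [trigProd, tensor, Finset.prod_mul_distrib]
  rw [inner_toL2 _ (continuous_trigProd σ m.1), hcongr, integral_tensor]
  simp_rw [integral_trigMode_mul]
  split_ifs with h
  · exact Finset.prod_eq_one fun l _ => if_pos ⟨congrFun (congrArg Subtype.val h) l, m.2 l⟩
  · obtain ⟨l, hl⟩ := Function.ne_iff.1 (Subtype.coe_ne_coe.2 h)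
    exact Finset.prod_eq_zero (Finset.mem_univ l) (if_neg fun hc => hl hc.1)

end TrigProd

/-! ### Completeness of the trigonometric systems -/

section Completeness

variable {d : ℕ}

/-- The algebra of functions on `ℝ^d` generated by the coordinate cosines `cos(πxᵢ)`. It is
uniformly dense on the closed cube, and the span of each trigonometric system is a module
over it. -/
def cosAlgebra (d : ℕ) : Subalgebra ℝ C(Fin d → ℝ, ℝ) :=
  Algebra.adjoin ℝ (Set.range fun i : Fin d => ⟨fun x => Real.cos (π * x i), by fun_prop⟩)

lemma exists_mem_cosAlgebra_near (f : C(Fin d → ℝ, ℝ)) {ε : ℝ} (hε : 0 < ε) :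
    ∃ q ∈ cosAlgebra d, ∀ x ∈ Set.Icc (0 : Fin d → ℝ) 1, ‖q x - f x‖ < ε := by
  let restrictIcc : C(Fin d → ℝ, ℝ) →ₐ[ℝ] C(Set.Icc (0 : Fin d → ℝ) 1, ℝ) :=
    ContinuousMap.compRightAlgHom ℝ ℝ ⟨Subtype.val, continuous_subtype_val⟩
  have hsep : ((cosAlgebra d).map restrictIcc).SeparatesPoints := by
    intro x y hxy
    obtain ⟨i, hi⟩ := Function.ne_iff.1 (Subtype.coe_ne_coe.2 hxy)
    refine ⟨_, ⟨_, ⟨_, Algebra.subset_adjoin ⟨i, rfl⟩, rfl⟩, rfl⟩, fun h => hi ?_⟩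
    have hmem : ∀ z : Set.Icc (0 : Fin d → ℝ) 1, π * z.1 i ∈ Set.Icc 0 π := fun z =>
      ⟨mul_nonneg Real.pi_pos.le (z.2.1 i), mul_le_of_le_one_right Real.pi_pos.le (z.2.2 i)⟩
    exact mul_left_cancel₀ Real.pi_ne_zero (Real.injOn_cos (hmem x) (hmem y) h)
  obtain ⟨⟨_, q, hq, rfl⟩, hqf⟩ :=
    ContinuousMap.exists_mem_subalgebra_near_continuousMap_of_separatesPoints _ hsep
      (restrictIcc f) ε hε
  exact ⟨q, hq, fun x hx => (ContinuousMap.norm_lt_iff _ hε).1 hqf ⟨x, hx⟩⟩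

lemma ae_eq_zero_of_integral_mul_cosAlgebra {F : (Fin d → ℝ) → ℝ}
    (hF : Integrable F (volume.restrict (cube d)))
    (h : ∀ q ∈ cosAlgebra d, ∫ x in cube d, F x * q x = 0) :
    F =ᵐ[volume.restrict (cube d)] 0 := by
  refine ae_eq_zero_of_integral_mul_testFunction hF fun ψ hψ _ _ => ?_
  have hint : ∀ q : C(Fin d → ℝ, ℝ), Integrable (fun x => F x * q x)
      (volume.restrict (cube d)) := fun q =>
    hF.mul_of_top_left (memLp_cube_of_continuous q.continuous)
  have hintψ := hint ⟨ψ, hψ.continuous⟩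
  simp only [ContinuousMap.coe_mk] at hintψ
  set C := ∫ x in cube d, ‖F x‖
  have : 0 ≤ C := integral_nonneg fun x => norm_nonneg _
  refine norm_le_zero_iff.1 (le_of_forall_pos_le_add fun ε hε => ?_)
  obtain ⟨q, hq, hqψ⟩ := exists_mem_cosAlgebra_near ⟨ψ, hψ.continuous⟩
    (show 0 < ε / (C + 1) by positivity)
  calc ‖∫ x in cube d, F x * ψ x‖
      = ‖∫ x in cube d, (F x * q x - F x * ψ x)‖ := by
        rw [integral_sub (hint q) hintψ, h q hq, zero_sub, norm_neg]
    _ ≤ ∫ x in cube d, ‖F x‖ * (ε / (C + 1)) := by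
        refine norm_integral_le_of_norm_le (hF.norm.mul_const _) (ae_cube_of_forall_mem ?_)
        intro x hx
        rw [← mul_sub, norm_mul]
        exact mul_le_mul_of_nonneg_left (hqψ x (cube_subset_Icc d hx)).le (norm_nonneg _)
    _ = C / (C + 1) * ε := by rw [integral_mul_const]; ring
    _ ≤ 0 + ε := by
        rw [zero_add]
        exact mul_le_of_le_one_left hε.le (div_le_one_of_le₀ (by linarith) (by positivity))

lemma integral_trigProd_mul_cosAlgebra_eq_zero {σ : Fin d → Bool} {v : L2 d}
    {q : C(Fin d → ℝ, ℝ)} (hq : q ∈ cosAlgebra d) :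
    ∀ F : C(Fin d → ℝ, ℝ), (∀ n, ∫ x in cube d, v x * (trigProd σ n x * F x) = 0) →
      ∀ n, ∫ x in cube d, v x * (trigProd σ n x * (q x * F x)) = 0 := by
  have hint : ∀ (n : Fin d → ℕ) (F : C(Fin d → ℝ, ℝ)),
      Integrable (fun x => v x * (trigProd σ n x * F x)) (volume.restrict (cube d)) :=
    fun n F => integrable_mul_continuous v ((continuous_trigProd σ n).mul F.continuous)
  induction hq using Algebra.adjoin_induction with
  | mem q hq =>
    obtain ⟨i, rfl⟩ := hq
    intro F hF n
    obtain ⟨a, b, k₁, k₂, hk⟩ := exists_trigMode_mul_cos_eq (σ i) (n i)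
    have hsplit : ∀ x, v x * (trigProd σ n x * (Real.cos (π * x i) * F x)) =
        a * (v x * (trigProd σ (Function.update n i k₁) x * F x)) +
          b * (v x * (trigProd σ (Function.update n i k₂) x * F x)) := by
      intro x
      rw [trigProd_update_index, trigProd_update_index, tensor_update, tensor_update, trigProd,
        tensor_eq_mul _ i]
      linear_combination
        v x * F x * (∏ l ∈ Finset.univ.erase i, trigMode (σ l) (n l) (x l)) * hk (x i)
    simp only [ContinuousMap.coe_mk, hsplit]
    rw [integral_add ((hint _ F).const_mul a) ((hint _ F).const_mul b), integral_const_mul,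
      integral_const_mul, hF, hF, mul_zero, mul_zero, add_zero]
  | algebraMap r =>
    intro F hF n
    simp only [algebraMap_apply, smul_eq_mul, mul_one, mul_left_comm _ r]
    rw [integral_const_mul, hF, mul_zero]
  | add p q _ _ hp hq =>
    intro F hF n
    have hsum := integral_add (hint n (p * F)) (hint n (q * F))
    simp only [ContinuousMap.mul_apply, hp F hF n, hq F hF n, add_zero] at hsum
    simpa only [ContinuousMap.add_apply, add_mul, mul_add] using hsum
  | mul p q _ _ hp hq =>
    intro F hF n
    simpa only [ContinuousMap.mul_apply, mul_assoc] using hp (q * F) (hq F hF) n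

lemma trigProd_lowest_pos (σ : Fin d → Bool) {x : Fin d → ℝ} (hx : x ∈ cube d) :
    0 < trigProd σ (fun l => bif σ l then 1 else 0) x := by
  rw [trigProd, tensor]
  refine Finset.prod_pos fun l _ => ?_
  obtain ⟨hx₀, hx₁⟩ := hx l (Set.mem_univ l)
  cases h : σ l with
  | true =>
    simp only [trigMode, cond_true, Nat.cast_one, mul_one]
    exact mul_pos (by positivity) (Real.sin_pos_of_pos_of_lt_pi (mul_pos Real.pi_pos hx₀)
      (mul_lt_of_lt_one_right Real.pi_pos hx₁))
  | false => simp [trigMode, cosNorm]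

lemma eq_zero_of_trigCoeff_eq_zero {σ : Fin d → Bool} {v : L2 d}
    (hv : ∀ n, trigCoeff σ n v = 0) : v = 0 := by
  set n₀ : Fin d → ℕ := fun l => bif σ l then 1 else 0
  have hvanish : (fun x => v x * trigProd σ n₀ x) =ᵐ[volume.restrict (cube d)] 0 := by
    refine ae_eq_zero_of_integral_mul_cosAlgebra
      (integrable_mul_continuous v (continuous_trigProd σ n₀)) fun q hq => ?_
    have := integral_trigProd_mul_cosAlgebra_eq_zero hq 1
      (fun n => by simpa [trigCoeff_apply] using hv n) n₀
    simpa [mul_assoc] using this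
  refine Lp.ext ?_
  filter_upwards [hvanish, ae_restrict_mem (measurableSet_cube d),
    Lp.coeFn_zero ℝ 2 (volume.restrict (cube d))] with x hx hxm h0
  rw [h0]
  exact (mul_eq_zero.1 hx).resolve_right (trigProd_lowest_pos σ hxm).ne'

lemma eq_of_trigCoeff_eq (σ : Fin d → Bool) {v w : L2 d}
    (h : ∀ n, trigCoeff σ n v = trigCoeff σ n w) : v = w :=
  sub_eq_zero.1 (eq_zero_of_trigCoeff_eq_zero (σ := σ) fun n => by rw [map_sub, h, sub_self])

/-- The nonvanishing trigonometric products of type `σ` as a Hilbert basis of `L²(Ω)`. -/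
def trigHilbertBasis (σ : Fin d → Bool) : HilbertBasis {n // IsMode σ n} ℝ (L2 d) :=
  HilbertBasis.mkOfOrthogonalEqBot (orthonormal_trigProd σ) (by
    rw [Submodule.eq_bot_iff]
    intro v hv
    refine eq_zero_of_trigCoeff_eq_zero (σ := σ) fun n => ?_
    by_cases h : IsMode σ n
    · exact (Submodule.mem_orthogonal _ _).1 hv _ (Submodule.subset_span ⟨⟨n, h⟩, rfl⟩)
    · exact trigCoeff_eq_zero h v)

lemma trigHilbertBasis_repr (σ : Fin d → Bool) (v : L2 d) (n : {n // IsMode σ n}) :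
    (trigHilbertBasis σ).repr v n = trigCoeff σ n.1 v := by
  rw [HilbertBasis.repr_apply_apply, trigHilbertBasis, HilbertBasis.coe_mkOfOrthogonalEqBot]
  rfl

lemma hasSum_trigCoeff_mul (σ : Fin d → Bool) (v w : L2 d) :
    HasSum (fun n => trigCoeff σ n v * trigCoeff σ n w) (inner ℝ v w) := by
  have h := (trigHilbertBasis σ).hasSum_inner_mul_inner v w
  refine (Function.Injective.hasSum_iff Subtype.val_injective ?_).1 (h.congr_fun ?_)
  · intro n hn
    rw [trigCoeff_eq_zero (fun hg => hn ⟨⟨n, hg⟩, rfl⟩), zero_mul]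
  · intro n
    rw [Function.comp, real_inner_comm _ v, ← HilbertBasis.repr_apply_apply,
      ← HilbertBasis.repr_apply_apply, trigHilbertBasis_repr, trigHilbertBasis_repr]

lemma hasSum_trigCoeff_sq (σ : Fin d → Bool) (v : L2 d) :
    HasSum (fun n => trigCoeff σ n v ^ 2) (‖v‖ ^ 2) := by
  simpa only [pow_two, real_inner_self_eq_norm_mul_norm] using hasSum_trigCoeff_mul σ v v

lemma exists_trigCoeff_eq (σ : Fin d → Bool) (c : (Fin d → ℕ) → ℝ)
    (hc : Summable fun n => c n ^ 2) (hmode : ∀ n, ¬ IsMode σ n → c n = 0) :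
    ∃ v : L2 d, ∀ n, trigCoeff σ n v = c n := by
  have hmem : Memℓp (fun n : {n // IsMode σ n} => c n.1) 2 :=
    memℓp_gen (by
      simpa [Function.comp_def] using hc.comp_injective Subtype.val_injective)
  refine ⟨(trigHilbertBasis σ).repr.symm ⟨_, hmem⟩, fun n => ?_⟩
  by_cases h : IsMode σ n
  · rw [← trigHilbertBasis_repr σ _ ⟨n, h⟩, LinearIsometryEquiv.apply_symm_apply]
  · rw [trigCoeff_eq_zero h, hmode n h]

end Completeness

/-! ### Classical partial derivatives -/

section PartialDeriv

variable {d : ℕ} {ψ : (Fin d → ℝ) → ℝ}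

lemma IsSmooth.pd (h : IsSmooth ψ) (i : Fin d) : IsSmooth (pd i ψ) :=
  (ContDiff.fderiv_right (m := ∞) h le_rfl).clm_apply contDiff_const

lemma hasCompactSupport_pd (h : HasCompactSupport ψ) (i : Fin d) : HasCompactSupport (pd i ψ) :=
  h.fderiv_apply ℝ _

lemma tsupport_pd_subset (ψ : (Fin d → ℝ) → ℝ) (i : Fin d) : tsupport (pd i ψ) ⊆ tsupport ψ :=
  tsupport_fderiv_apply_subset ℝ _

lemma pd_comm (h : IsSmooth ψ) (i j : Fin d) : pd i (pd j ψ) = pd j (pd i ψ) := by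
  funext x
  have hsymm : IsSymmSndFDerivAt ℝ ψ x := (ContDiff.contDiffAt h).isSymmSndFDerivAt (by
    rw [minSmoothness_of_isRCLikeNormedField]; exact WithTop.coe_le_coe.2 le_top)
  have hdiff : DifferentiableAt ℝ (fderiv ℝ ψ) x :=
    (ContDiff.fderiv_right (m := ∞) h le_rfl).differentiable (by simp) x
  have hpd : ∀ a b : Fin d, pd a (pd b ψ) x =
      fderiv ℝ (fderiv ℝ ψ) x (Pi.single a 1) (Pi.single b 1) := fun a b => by
    unfold pd
    rw [fderiv_clm_apply hdiff (differentiableAt_const _)]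
    simp
  rw [hpd, hpd, hsymm]

lemma IsSmooth.pdList (h : IsSmooth ψ) (l : List (Fin d)) : IsSmooth (pdList l ψ) := by
  induction l with
  | nil => exact h
  | cons i l ih => exact ih.pd i

lemma pdList_append (l l' : List (Fin d)) (ψ : (Fin d → ℝ) → ℝ) :
    pdList (l ++ l') ψ = pdList l (pdList l' ψ) :=
  List.foldr_append

lemma pdList_pd (h : IsSmooth ψ) (l : List (Fin d)) (i : Fin d) :
    pdList l (pd i ψ) = pd i (pdList l ψ) := by
  induction l with
  | nil => rfl
  | cons j l ih => exact (congrArg (pd j) ih).trans (pd_comm (h.pdList l) j i)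

lemma pd_tensor {α : Fin d → ℝ → ℝ} (h : ∀ l, Differentiable ℝ (α l)) (i : Fin d) :
    pd i (tensor α) = tensor (Function.update α i (deriv (α i))) := by
  funext x
  have hfderiv : HasFDerivAt (tensor α) _ x := HasFDerivAt.finsetProd (u := Finset.univ)
    (g := fun l (y : Fin d → ℝ) => α l (y l)) (x := x) fun l _ =>
      ((h l (x l)).hasDerivAt.hasFDerivAt).comp x
        (hasFDerivAt_apply (𝕜 := ℝ) (F' := fun _ : Fin d => ℝ) l x)
  rw [pd, hfderiv.fderiv, tensor_update, sum_apply, Finset.sum_eq_single i]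
  · simp [mul_comm]
  · intro b _ hb
    simp [hb]
  · simp

lemma deriv_trigMode_true (k : ℕ) :
    deriv (trigMode true k) = fun x => π * k * trigMode false k x := by
  funext x
  have hderiv : HasDerivAt (trigMode true k) (√2 * (Real.cos (π * k * x) * (π * k))) x := by
    unfold trigMode
    simpa using ((hasDerivAt_id x).const_mul (π * k)).sin.const_mul √2
  rw [hderiv.deriv]
  rcases eq_or_ne k 0 with rfl | hk
  · simp
  · simp only [trigMode, cosNorm, cond_false, if_neg hk]
    ring

lemma deriv_trigMode_false (k : ℕ) :
    deriv (trigMode false k) = fun x => -(π * k) * trigMode true k x := by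
  funext x
  have hderiv : HasDerivAt (trigMode false k)
      (cosNorm k * (-Real.sin (π * k * x) * (π * k))) x := by
    unfold trigMode
    simpa using ((hasDerivAt_id x).const_mul (π * k)).cos.const_mul (cosNorm k)
  rw [hderiv.deriv]
  rcases eq_or_ne k 0 with rfl | hk
  · simp
  · simp only [trigMode, cosNorm, cond_true, if_neg hk]
    ring

end PartialDeriv

/-! ### Cut-off functions on the unit interval -/

section Cutoff

open Filter Topology

/-- A smooth function that vanishes near `0` and `1` and is `1` on most of the interval. -/
def cutoff (m : ℕ) (x : ℝ) : ℝ :=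
  Real.smoothTransition ((m + 1) * x - 1) * Real.smoothTransition ((m + 1) * (1 - x) - 1)

/-- Bounded pointwise convergence on `(0,1)` of continuous functions: the mode of convergence
under which integrals against tensor products pass to the limit. -/
structure BoundedlyConverges (α : ℕ → ℝ → ℝ) (β : ℝ → ℝ) : Prop where
  continuous : ∀ m, Continuous (α m)
  bounded : ∃ C, ∀ m, ∀ x ∈ Set.Ioo (0 : ℝ) 1, |α m x| ≤ C
  tendsto : ∀ x ∈ Set.Ioo (0 : ℝ) 1, Tendsto (fun m => α m x) atTop (𝓝 (β x))

lemma contDiff_cutoff (m : ℕ) : ContDiff ℝ ∞ (cutoff m) :=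
  (Real.smoothTransition.contDiff.comp (by fun_prop)).mul
    (Real.smoothTransition.contDiff.comp (by fun_prop))

lemma abs_smoothTransition_le_one (x : ℝ) : |Real.smoothTransition x| ≤ 1 :=
  abs_le.2 ⟨by linarith [Real.smoothTransition.nonneg x], Real.smoothTransition.le_one x⟩

lemma abs_cutoff_le_one (m : ℕ) (x : ℝ) : |cutoff m x| ≤ 1 := by
  rw [cutoff, abs_mul]
  exact mul_le_one₀ (abs_smoothTransition_le_one _) (abs_nonneg _) (abs_smoothTransition_le_one _)

lemma tsupport_cutoff_subset (m : ℕ) : tsupport (cutoff m) ⊆ Set.Ioo 0 1 := by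
  have hm : (0 : ℝ) < m + 1 := by positivity
  have hsub : tsupport (cutoff m) ⊆ Set.Icc (1 / (m + 1 : ℝ)) (1 - 1 / (m + 1)) := by
    refine closure_minimal (fun x hx => ?_) isClosed_Icc
    obtain ⟨hleft, hright⟩ := mul_ne_zero_iff.1 hx
    have hleft := not_le.1 fun h => hleft (Real.smoothTransition.zero_of_nonpos h)
    have hright := not_le.1 fun h => hright (Real.smoothTransition.zero_of_nonpos h)
    rw [Set.mem_Icc, le_sub_comm, div_le_iff₀ hm, div_le_iff₀ hm]
    constructor <;> linarith
  have hpos : 0 < 1 / (m + 1 : ℝ) := by positivity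
  exact hsub.trans fun x hx => ⟨by linarith [hx.1], by linarith [hx.2]⟩

lemma cutoff_eventuallyEq_one {x : ℝ} (hx : x ∈ Set.Ioo (0 : ℝ) 1) :
    ∀ᶠ m in atTop, cutoff m =ᶠ[𝓝 x] fun _ => 1 := by
  have hlarge : ∀ {y : ℝ}, 0 < y → ∀ᶠ m : ℕ in atTop, 2 < (m + 1 : ℝ) * y := fun hy =>
    ((tendsto_natCast_atTop_atTop.atTop_add tendsto_const_nhds).atTop_mul_const
      hy).eventually_gt_atTop 2
  filter_upwards [hlarge hx.1, hlarge (sub_pos.2 hx.2)] with m hm hm'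
  have hnear : ∀ᶠ y in 𝓝 x, 2 < (m + 1 : ℝ) * y :=
    (by fun_prop : Continuous fun y : ℝ => (m + 1 : ℝ) * y).continuousAt.eventually_const_lt hm
  have hnear' : ∀ᶠ y in 𝓝 x, 2 < (m + 1 : ℝ) * (1 - y) :=
    (by fun_prop : Continuous fun y : ℝ => (m + 1 : ℝ) * (1 - y)).continuousAt.eventually_const_lt
      hm'
  filter_upwards [hnear, hnear'] with y hy hy'
  rw [cutoff, Real.smoothTransition.one_of_one_le (by linarith),
    Real.smoothTransition.one_of_one_le (by linarith), mul_one]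

lemma exists_abs_deriv_smoothTransition_mul_le :
    ∃ C, ∀ y, |deriv Real.smoothTransition y * (y + 1)| ≤ C := by
  have : Continuous (deriv Real.smoothTransition) :=
    (Real.smoothTransition.contDiff (n := 1)).continuous_deriv le_rfl
  obtain ⟨C, hC⟩ := (isCompact_Icc (a := (0 : ℝ)) (b := 1)).exists_bound_of_continuousOn
    (f := fun y => deriv Real.smoothTransition y * (y + 1)) (by fun_prop)
  have hC₀ : 0 ≤ C := (norm_nonneg _).trans (hC 0 (by simp))
  refine ⟨C, fun y => ?_⟩
  rcases lt_or_ge y 0 with hy | hy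
  · have hconst : Real.smoothTransition =ᶠ[𝓝 y] fun _ => 0 := by
      filter_upwards [gt_mem_nhds hy] with z hz
      exact Real.smoothTransition.zero_of_nonpos hz.le
    simpa [hconst.deriv_eq] using hC₀
  rcases lt_or_ge 1 y with hy' | hy'
  · have hconst : Real.smoothTransition =ᶠ[𝓝 y] fun _ => 1 := by
      filter_upwards [lt_mem_nhds hy'] with z hz
      exact Real.smoothTransition.one_of_one_le hz.le
    simpa [hconst.deriv_eq] using hC₀
  · exact hC y ⟨hy, hy'⟩

lemma hasDerivAt_cutoff (m : ℕ) (x : ℝ) : HasDerivAt (cutoff m)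
    (deriv Real.smoothTransition ((m + 1) * x - 1) * (m + 1) *
        Real.smoothTransition ((m + 1) * (1 - x) - 1) +
      Real.smoothTransition ((m + 1) * x - 1) *
        (deriv Real.smoothTransition ((m + 1) * (1 - x) - 1) * -(m + 1))) x := by
  have hdiff : Differentiable ℝ Real.smoothTransition :=
    (Real.smoothTransition.contDiff (n := 1)).differentiable (by simp)
  have hleft : HasDerivAt (fun y : ℝ => (m + 1 : ℝ) * y - 1) (m + 1) x := by
    simpa using ((hasDerivAt_id x).const_mul (m + 1 : ℝ)).sub_const 1
  have hright : HasDerivAt (fun y : ℝ => (m + 1 : ℝ) * (1 - y) - 1) (-(m + 1)) x := by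
    simpa [mul_comm, add_comm] using
      (((hasDerivAt_id x).const_sub 1).const_mul (m + 1 : ℝ)).sub_const 1
  exact (HasDerivAt.comp x (hdiff _).hasDerivAt hleft).mul
    (HasDerivAt.comp x (hdiff _).hasDerivAt hright)

lemma exists_abs_deriv_cutoff_mul_min_le :
    ∃ C, ∀ m, ∀ x ∈ Set.Ioo (0 : ℝ) 1, |deriv (cutoff m) x| * min x (1 - x) ≤ C := by
  obtain ⟨C, hC⟩ := exists_abs_deriv_smoothTransition_mul_le
  refine ⟨C + C, fun m x hx => ?_⟩
  have hx₁ : 0 < 1 - x := sub_pos.2 hx.2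
  have hm : (0 : ℝ) < m + 1 := by positivity
  have hleft := hC ((m + 1) * x - 1)
  have hright := hC ((m + 1) * (1 - x) - 1)
  rw [sub_add_cancel, abs_mul, abs_mul, abs_of_pos hm] at hleft hright
  rw [abs_of_pos hx.1] at hleft
  rw [abs_of_pos hx₁] at hright
  rw [(hasDerivAt_cutoff m x).deriv]
  set A := (m + 1 : ℝ) * x - 1
  set B := (m + 1 : ℝ) * (1 - x) - 1
  have hmin : 0 ≤ min x (1 - x) := le_min hx.1.le hx₁.le
  calc _ ≤ (|deriv Real.smoothTransition A| * (m + 1) * |Real.smoothTransition B| +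
        |Real.smoothTransition A| * (|deriv Real.smoothTransition B| * (m + 1))) *
          min x (1 - x) := by
        refine mul_le_mul_of_nonneg_right ((abs_add_le _ _).trans_eq ?_) hmin
        simp only [abs_mul, abs_neg, abs_of_pos hm]
    _ ≤ (|deriv Real.smoothTransition A| * (m + 1) * 1 +
        1 * (|deriv Real.smoothTransition B| * (m + 1))) * min x (1 - x) := by
        gcongr <;> exact abs_smoothTransition_le_one _
    _ = |deriv Real.smoothTransition A| * ((m + 1) * min x (1 - x)) +
        |deriv Real.smoothTransition B| * ((m + 1) * min x (1 - x)) := by ring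
    _ ≤ |deriv Real.smoothTransition A| * ((m + 1) * x) +
        |deriv Real.smoothTransition B| * ((m + 1) * (1 - x)) := by
        gcongr
        · exact min_le_left _ _
        · exact min_le_right _ _
    _ ≤ C + C := add_le_add hleft hright

lemma exists_abs_le_mul_min {α : ℝ → ℝ} (hα : ContDiff ℝ 1 α) (h0 : α 0 = 0) (h1 : α 1 = 0) :
    ∃ L, ∀ x ∈ Set.Ioo (0 : ℝ) 1, |α x| ≤ L * min x (1 - x) := by
  obtain ⟨L, hL⟩ := (isCompact_Icc (a := (0 : ℝ)) (b := 1)).exists_bound_of_continuousOn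
    (hα.continuous_deriv le_rfl).continuousOn
  have hlip : ∀ x ∈ Set.Icc (0 : ℝ) 1, ∀ y ∈ Set.Icc (0 : ℝ) 1, ‖α y - α x‖ ≤ L * ‖y - x‖ :=
    fun x hx y hy => Convex.norm_image_sub_le_of_norm_deriv_le
      (fun z _ => hα.differentiable (by simp) z) hL (convex_Icc 0 1) hx hy
  refine ⟨L, fun x hx => ?_⟩
  have hxI := Set.Ioo_subset_Icc_self hx
  have hleft := hlip 0 (by simp) x hxI
  have hright := hlip 1 (by simp) x hxI
  rw [h0, sub_zero, sub_zero, Real.norm_eq_abs, Real.norm_eq_abs, abs_of_pos hx.1] at hleft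
  rw [h1, sub_zero, norm_sub_rev, Real.norm_eq_abs, Real.norm_eq_abs,
    abs_of_pos (sub_pos.2 hx.2)] at hright
  rcases min_choice x (1 - x) with h | h <;> rw [h] <;> assumption

lemma exists_abs_le_of_continuous {α : ℝ → ℝ} (hα : Continuous α) :
    ∃ C, ∀ x ∈ Set.Ioo (0 : ℝ) 1, |α x| ≤ C :=
  (isCompact_Icc.exists_bound_of_continuousOn hα.continuousOn).imp fun _ h _ hx =>
    h _ (Set.Ioo_subset_Icc_self hx)

lemma boundedlyConverges_const {α : ℝ → ℝ} (hα : Continuous α) :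
    BoundedlyConverges (fun _ => α) α where
  continuous _ := hα
  bounded := (exists_abs_le_of_continuous hα).imp fun _ h _ => h
  tendsto _ _ := tendsto_const_nhds

lemma boundedlyConverges_cutoff_mul {α : ℝ → ℝ} (hα : Continuous α) :
    BoundedlyConverges (fun m => cutoff m * α) α where
  continuous m := (contDiff_cutoff m).continuous.mul hα
  bounded := (exists_abs_le_of_continuous hα).imp fun _ h m x hx => by
    rw [Pi.mul_apply, abs_mul]
    exact (mul_le_of_le_one_left (abs_nonneg _) (abs_cutoff_le_one m x)).trans (h x hx)
  tendsto x hx := by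
    refine tendsto_const_nhds.congr' ?_
    filter_upwards [cutoff_eventuallyEq_one hx] with m hm
    rw [Pi.mul_apply, hm.self_of_nhds, one_mul]

lemma boundedlyConverges_deriv_cutoff_mul {α : ℝ → ℝ} (hα : ContDiff ℝ 1 α)
    (h0 : α 0 = 0) (h1 : α 1 = 0) :
    BoundedlyConverges (fun m => deriv (cutoff m * α)) (deriv α) where
  continuous m := (((contDiff_cutoff m).of_le (by simp)).mul hα).continuous_deriv le_rfl
  bounded := by
    obtain ⟨C, hC⟩ := exists_abs_deriv_cutoff_mul_min_le
    obtain ⟨L, hL⟩ := exists_abs_le_mul_min hα h0 h1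
    obtain ⟨M, hM⟩ := exists_abs_le_of_continuous (hα.continuous_deriv le_rfl)
    have hL₀ : 0 ≤ L := by
      have := (abs_nonneg _).trans (hL (1 / 2) (by norm_num))
      norm_num at this
      exact this
    refine ⟨C * L + M, fun m x hx => ?_⟩
    rw [deriv_mul ((contDiff_cutoff m).differentiable (by simp) x)
      (hα.differentiable (by simp) x)]
    refine (abs_add_le _ _).trans (add_le_add ?_ ?_) <;> rw [abs_mul]
    · calc |deriv (cutoff m) x| * |α x|
          ≤ |deriv (cutoff m) x| * (L * min x (1 - x)) := by gcongr; exact hL x hx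
        _ = |deriv (cutoff m) x| * min x (1 - x) * L := by ring
        _ ≤ C * L := by gcongr; exact hC m x hx
    · exact (mul_le_of_le_one_left (abs_nonneg _) (abs_cutoff_le_one m x)).trans (hM x hx)
  tendsto x hx := by
    refine tendsto_const_nhds.congr' ?_
    filter_upwards [cutoff_eventuallyEq_one hx] with m hm
    refine EventuallyEq.deriv_eq ?_
    filter_upwards [hm] with y hy
    rw [Pi.mul_apply, hy, one_mul]

lemma BoundedlyConverges.update {d : ℕ} {α : ℕ → Fin d → ℝ → ℝ} {β : Fin d → ℝ → ℝ}
    {γ : ℕ → ℝ → ℝ} {δ : ℝ → ℝ} {i : Fin d} (hγ : BoundedlyConverges γ δ)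
    (h : ∀ l ≠ i, BoundedlyConverges (fun m => α m l) (β l)) (l : Fin d) :
    BoundedlyConverges (fun m => Function.update (α m) i (γ m) l) (Function.update β i δ l) := by
  rcases eq_or_ne l i with rfl | hl
  · simpa only [Function.update_self] using hγ
  · simpa only [Function.update_of_ne hl] using h l hl

end Cutoff

/-! ### Pairings with tensor products -/

section TensorPairing

open Filter Topology

variable {d : ℕ}

/-- The integral over the cube of `v` against a tensor product. -/
def tensorPairing (v : L2 d) (α : Fin d → ℝ → ℝ) : ℝ := ∫ x in cube d, v x * tensor α x

lemma tensorPairing_update_const_mul (v : L2 d) (α : Fin d → ℝ → ℝ) (i : Fin d) (c : ℝ)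
    (β : ℝ → ℝ) : tensorPairing v (Function.update α i fun x => c * β x) =
      c * tensorPairing v (Function.update α i β) := by
  rw [tensorPairing, tensorPairing, ← integral_const_mul]
  simp only [tensor_update, mul_assoc, mul_left_comm c]

lemma tendsto_tensorPairing (v : L2 d) {α : ℕ → Fin d → ℝ → ℝ} {β : Fin d → ℝ → ℝ}
    (h : ∀ l, BoundedlyConverges (fun m => α m l) (β l)) :
    Tendsto (fun m => tensorPairing v (α m)) atTop (𝓝 (tensorPairing v β)) := by
  choose C hC using fun l => (h l).bounded
  refine tendsto_integral_of_dominated_convergence (fun x => ‖v x‖ * ∏ l, C l) (fun m => ?_)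
    (((Lp.memLp v).integrable one_le_two).norm.mul_const _) (fun m => ?_) ?_
  · exact (Lp.aestronglyMeasurable v).mul
      (continuous_tensor fun l => (h l).continuous m).aestronglyMeasurable
  · refine ae_cube_of_forall_mem fun x hx => ?_
    rw [norm_mul, tensor, Real.norm_eq_abs (∏ l, _), Finset.abs_prod]
    exact mul_le_mul_of_nonneg_left (Finset.prod_le_prod (fun _ _ => abs_nonneg _)
      fun l _ => hC l m _ (hx l (Set.mem_univ l))) (norm_nonneg _)
  · exact ae_cube_of_forall_mem fun x hx => (tendsto_finsetProd _ fun l _ =>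
      (h l).tendsto _ (hx l (Set.mem_univ l))).const_mul _

lemma tsupport_tensor_subset (α : Fin d → ℝ → ℝ) :
    tsupport (tensor α) ⊆ Set.univ.pi fun l => tsupport (α l) :=
  closure_minimal (fun _ hx l _ => subset_tsupport _ fun h0 =>
    hx (Finset.prod_eq_zero (Finset.mem_univ l) h0))
      (isClosed_set_pi fun _ _ => isClosed_tsupport _)

lemma tsupport_tensor_subset_cube {α : Fin d → ℝ → ℝ} (h : ∀ l, tsupport (α l) ⊆ Set.Ioo 0 1) :
    tsupport (tensor α) ⊆ cube d :=
  (tsupport_tensor_subset α).trans (Set.pi_mono fun l _ => h l)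

lemma hasCompactSupport_tensor {α : Fin d → ℝ → ℝ} (h : ∀ l, tsupport (α l) ⊆ Set.Ioo 0 1) :
    HasCompactSupport (tensor α) :=
  (isCompact_univ_pi fun l => isCompact_Icc.of_isClosed_subset (isClosed_tsupport (α l))
    ((h l).trans Set.Ioo_subset_Icc_self)).of_isClosed_subset (isClosed_tsupport _)
      (tsupport_tensor_subset α)

lemma tsupport_cutoff_mul_subset (m : ℕ) (α : ℝ → ℝ) : tsupport (cutoff m * α) ⊆ Set.Ioo 0 1 :=
  tsupport_mul_subset_left.trans (tsupport_cutoff_subset m)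

lemma contDiff_cutoff_mul (m : ℕ) {α : ℝ → ℝ} (hα : ContDiff ℝ ∞ α) :
    ContDiff ℝ ∞ (cutoff m * α) :=
  (contDiff_cutoff m).mul hα

lemma contDiff_update {α : Fin d → ℝ → ℝ} (hα : ∀ l, ContDiff ℝ ∞ (α l)) (i : Fin d)
    {β : ℝ → ℝ} (hβ : ContDiff ℝ ∞ β) (l : Fin d) : ContDiff ℝ ∞ (Function.update α i β l) := by
  rcases eq_or_ne l i with rfl | hl
  · simpa only [Function.update_self] using hβ
  · simpa only [Function.update_of_ne hl] using hα l

lemma HasWeakDerivZeroTrace.tensorPairing_deriv {i : Fin d} {v g : L2 d}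
    (h : HasWeakDerivZeroTrace i v g) {α : Fin d → ℝ → ℝ} (hα : ∀ l, ContDiff ℝ ∞ (α l)) :
    tensorPairing v (Function.update α i (deriv (α i))) = -tensorPairing g α := by
  have hgreen := h (tensor α) (isSmooth_tensor hα)
  rwa [pd_tensor fun l => (contDiff_infty_iff_deriv.1 (hα l)).1] at hgreen

lemma HasWeakDeriv.tensorPairing_deriv_of_tsupport_subset {i : Fin d} {v g : L2 d}
    (h : HasWeakDeriv [i] v g) {α : Fin d → ℝ → ℝ} (hα : ∀ l, ContDiff ℝ ∞ (α l))
    (hs : ∀ l, tsupport (α l) ⊆ Set.Ioo 0 1) :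
    tensorPairing v (Function.update α i (deriv (α i))) = -tensorPairing g α := by
  have hgreen := h (tensor α) (isSmooth_tensor hα) (hasCompactSupport_tensor hs)
    (tsupport_tensor_subset_cube hs)
  simp only [pdList, List.foldr_cons, List.foldr_nil, List.length_singleton, pow_one, neg_one_mul,
    pd_tensor fun l => (contDiff_infty_iff_deriv.1 (hα l)).1] at hgreen
  exact hgreen

lemma HasWeakDeriv.tensorPairing_deriv {i : Fin d} {v g : L2 d} (h : HasWeakDeriv [i] v g)
    {α : Fin d → ℝ → ℝ} (hα : ∀ l, ContDiff ℝ ∞ (α l)) (h0 : α i 0 = 0) (h1 : α i 1 = 0) :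
    tensorPairing v (Function.update α i (deriv (α i))) = -tensorPairing g α := by
  have hcut : ∀ l, BoundedlyConverges (fun m => cutoff m * α l) (α l) := fun l =>
    boundedlyConverges_cutoff_mul (hα l).continuous
  refine tendsto_nhds_unique (tendsto_tensorPairing v ((boundedlyConverges_deriv_cutoff_mul
    ((hα i).of_le (by simp)) h0 h1).update fun l _ => hcut l)) ?_
  refine (tendsto_tensorPairing g hcut).neg.congr fun m => Eq.symm ?_
  exact h.tensorPairing_deriv_of_tsupport_subset (fun l => contDiff_cutoff_mul m (hα l))
    fun l => tsupport_cutoff_mul_subset m (α l)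

lemma HasWeakDeriv.tensorPairing_deriv_deriv_of_tsupport_subset {i : Fin d} {v g : L2 d}
    (h : HasWeakDeriv [i, i] v g) {α : Fin d → ℝ → ℝ} (hα : ∀ l, ContDiff ℝ ∞ (α l))
    (hs : ∀ l, tsupport (α l) ⊆ Set.Ioo 0 1) :
    tensorPairing v (Function.update α i (deriv (deriv (α i)))) = tensorPairing g α := by
  have hgreen := h (tensor α) (isSmooth_tensor hα) (hasCompactSupport_tensor hs)
    (tsupport_tensor_subset_cube hs)
  have hα' := contDiff_update hα i (contDiff_infty_iff_deriv.1 (hα i)).2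
  simp only [pdList, List.foldr_cons, List.foldr_nil,
    pd_tensor fun l => (contDiff_infty_iff_deriv.1 (hα l)).1,
    pd_tensor fun l => (contDiff_infty_iff_deriv.1 (hα' l)).1, Function.update_self,
    Function.update_idem] at hgreen
  simpa [tensorPairing] using hgreen

lemma HasWeakDeriv.tensorPairing_deriv_deriv {i : Fin d} {v g : L2 d}
    (h : HasWeakDeriv [i, i] v g) {α : Fin d → ℝ → ℝ} (hα : ∀ l, ContDiff ℝ ∞ (α l))
    (hs : tsupport (α i) ⊆ Set.Ioo 0 1) :
    tensorPairing v (Function.update α i (deriv (deriv (α i)))) = tensorPairing g α := by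
  let β : ℕ → Fin d → ℝ → ℝ := fun m => Function.update (fun l => cutoff m * α l) i (α i)
  have hβi : ∀ m, β m i = α i := fun m => Function.update_self _ _ _
  have hβ : ∀ m, ∀ l ≠ i, β m l = cutoff m * α l := fun m l hl => Function.update_of_ne hl _ _
  have hlim : ∀ (w : L2 d) {γ : ℝ → ℝ}, Continuous γ →
      Tendsto (fun m => tensorPairing w (Function.update (β m) i γ)) atTop
        (𝓝 (tensorPairing w (Function.update α i γ))) := fun w γ hγ =>
    tendsto_tensorPairing w ((boundedlyConverges_const hγ).update fun l hl => by
      simpa only [hβ _ l hl] using boundedlyConverges_cutoff_mul (hα l).continuous)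
  have hβs : ∀ m l, tsupport (β m l) ⊆ Set.Ioo 0 1 := fun m l => by
    rcases eq_or_ne l i with rfl | hl
    · rwa [hβi]
    · rw [hβ m l hl]
      exact tsupport_cutoff_mul_subset m _
  have hα'' := (contDiff_infty_iff_deriv.1 (contDiff_infty_iff_deriv.1 (hα i)).2).2
  refine tendsto_nhds_unique (hlim v hα''.continuous) ?_
  have hg := hlim g (hα i).continuous
  rw [Function.update_eq_self] at hg
  refine hg.congr fun m => ?_
  have hgreen := h.tensorPairing_deriv_deriv_of_tsupport_subset
    (contDiff_update (fun l => contDiff_cutoff_mul m (hα l)) i (hα i)) (hβs m)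
  simp only [Function.update_self] at hgreen
  rw [← hβi m, Function.update_eq_self, hβi, hgreen]

lemma tensorPairing_eq_mul_of_forall_tsupport_subset {i : Fin d} {v w : L2 d} {c : ℝ}
    {α : Fin d → ℝ → ℝ} (hα : ∀ l, ContDiff ℝ ∞ (α l))
    (h : ∀ β : ℝ → ℝ, ContDiff ℝ ∞ β → tsupport β ⊆ Set.Ioo 0 1 →
      tensorPairing v (Function.update α i β) = c * tensorPairing w (Function.update α i β)) :
    tensorPairing v α = c * tensorPairing w α := by
  have hlim : ∀ u : L2 d, Tendsto
      (fun m => tensorPairing u (Function.update α i (cutoff m * α i))) atTop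
        (𝓝 (tensorPairing u α)) := fun u => by
    have := tendsto_tensorPairing u ((boundedlyConverges_cutoff_mul (hα i).continuous).update
      (α := fun _ => α) (β := α) (i := i) fun l _ => boundedlyConverges_const (hα l).continuous)
    rwa [Function.update_eq_self] at this
  refine tendsto_nhds_unique (hlim v) (((hlim w).const_mul c).congr fun m => Eq.symm ?_)
  exact h _ (contDiff_cutoff_mul m (hα i)) (tsupport_cutoff_mul_subset m _)

end TensorPairing

/-! ### Calculus of weak derivatives -/

section WeakDeriv

variable {d : ℕ} {i : Fin d} {l : List (Fin d)} {v v' w g g' : L2 d}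

lemma hasWeakDeriv_iff : HasWeakDeriv l v g ↔
    ∀ ψ : (Fin d → ℝ) → ℝ, IsSmooth ψ → HasCompactSupport ψ → tsupport ψ ⊆ cube d →
      inner ℝ v (toL2 (pdList l ψ)) = (-1 : ℝ) ^ l.length * inner ℝ g (toL2 ψ) := by
  refine forall₄_congr fun ψ hψ _ _ => ?_
  rw [inner_toL2 _ (hψ.pdList l).continuous, inner_toL2 _ hψ.continuous]

lemma hasWeakDerivZeroTrace_iff : HasWeakDerivZeroTrace i v g ↔
    ∀ ψ : (Fin d → ℝ) → ℝ, IsSmooth ψ → inner ℝ v (toL2 (pd i ψ)) = -inner ℝ g (toL2 ψ) := by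
  refine forall₂_congr fun ψ hψ => ?_
  rw [inner_toL2 _ (hψ.pd i).continuous, inner_toL2 _ hψ.continuous]

lemma hasWeakDeriv_nil (v : L2 d) : HasWeakDeriv [] v v := fun ψ _ _ _ => by simp [pdList]

lemma HasWeakDeriv.add (h : HasWeakDeriv l v g) (h' : HasWeakDeriv l v' g') :
    HasWeakDeriv l (v + v') (g + g') :=
  hasWeakDeriv_iff.2 fun ψ hψ hc hs => by
    rw [inner_add_left, inner_add_left, mul_add, hasWeakDeriv_iff.1 h ψ hψ hc hs,
      hasWeakDeriv_iff.1 h' ψ hψ hc hs]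

lemma HasWeakDeriv.smul (h : HasWeakDeriv l v g) (c : ℝ) : HasWeakDeriv l (c • v) (c • g) :=
  hasWeakDeriv_iff.2 fun ψ hψ hc hs => by
    rw [real_inner_smul_left, real_inner_smul_left, hasWeakDeriv_iff.1 h ψ hψ hc hs,
      mul_left_comm]

lemma HasWeakDeriv.neg (h : HasWeakDeriv l v g) : HasWeakDeriv l (-v) (-g) := by
  simpa only [neg_one_smul] using h.smul (-1)

lemma HasWeakDeriv.sub (h : HasWeakDeriv l v g) (h' : HasWeakDeriv l v' g') :
    HasWeakDeriv l (v - v') (g - g') := by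
  simpa only [sub_eq_add_neg] using h.add h'.neg

lemma HasWeakDerivZeroTrace.hasWeakDeriv (h : HasWeakDerivZeroTrace i v g) :
    HasWeakDeriv [i] v g := fun ψ hψ _ _ => by
  simpa [pdList] using h ψ hψ

lemma HasWeakDeriv.of_cons (h : HasWeakDeriv l v w) (h' : HasWeakDeriv (i :: l) v g) :
    HasWeakDeriv [i] w g := by
  intro ψ hψ hc hs
  have hw := h (pd i ψ) (hψ.pd i) (hasCompactSupport_pd hc i) ((tsupport_pd_subset ψ i).trans hs)
  have hg : ∫ x in cube d, v x * pd i (pdList l ψ) x = _ := h' ψ hψ hc hs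
  rw [pdList_pd hψ, hg] at hw
  refine mul_left_cancel₀ (pow_ne_zero l.length (by norm_num : (-1 : ℝ) ≠ 0)) (hw.symm.trans ?_)
  simp [pow_succ]

lemma pdList_cons_append_cons {ψ : (Fin d → ℝ) → ℝ} (h : IsSmooth ψ) (i : Fin d)
    (l : List (Fin d)) :
    pdList ((i :: l) ++ (i :: l)) ψ = pdList (l ++ l) (pd i (pd i ψ)) := by
  rw [pdList_append, pdList_append]
  change pd i (pdList l (pd i (pdList l ψ))) = _
  rw [pdList_pd (h.pdList l), pdList_pd (h.pd i), pdList_pd h, pdList_pd ((h.pdList l).pd i),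
    pdList_pd (h.pdList l)]

lemma HasWeakDeriv.of_cons_cons (h : HasWeakDeriv (l ++ l) v w)
    (h' : HasWeakDeriv ((i :: l) ++ (i :: l)) v g) : HasWeakDeriv [i, i] w g := by
  intro ψ hψ hc hs
  have heven : ∀ l : List (Fin d), (-1 : ℝ) ^ (l ++ l).length = 1 := fun l => by
    rw [List.length_append]
    exact Even.neg_one_pow ⟨_, rfl⟩
  have hw := h (pd i (pd i ψ)) ((hψ.pd i).pd i)
    (hasCompactSupport_pd (hasCompactSupport_pd hc i) i)
    (((tsupport_pd_subset _ i).trans (tsupport_pd_subset ψ i)).trans hs)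
  have hg := h' ψ hψ hc hs
  rw [pdList_cons_append_cons hψ, hw, heven, heven] at hg
  simpa [pdList] using hg

lemma HasWeakDerivZeroTrace.sub (h : HasWeakDerivZeroTrace i v g)
    (h' : HasWeakDerivZeroTrace i v' g') : HasWeakDerivZeroTrace i (v - v') (g - g') :=
  hasWeakDerivZeroTrace_iff.2 fun ψ hψ => by
    rw [inner_sub_left, inner_sub_left, hasWeakDerivZeroTrace_iff.1 h ψ hψ,
      hasWeakDerivZeroTrace_iff.1 h' ψ hψ, neg_sub_neg, neg_sub]

lemma HasWeakDerivZeroTrace.hasDirichletDeriv2 (h : HasWeakDerivZeroTrace i v w)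
    (h' : HasWeakDeriv [i, i] v g) : HasDirichletDeriv2 i v g :=
  ⟨w, h, h.hasWeakDeriv.of_cons h'⟩

lemma setIntegral_toL2_mul {ψ χ : (Fin d → ℝ) → ℝ} (hψ : Continuous ψ)
    (hs : tsupport χ ⊆ cube d) : ∫ x in cube d, (toL2 ψ : L2 d) x * χ x = ∫ x, ψ x * χ x := by
  rw [← setIntegral_eq_integral_of_forall_compl_eq_zero (s := cube d) (f := fun x => ψ x * χ x)
    fun x hx => by rw [image_eq_zero_of_notMem_tsupport fun h => hx (hs h), mul_zero]]
  refine integral_congr_ae ?_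
  filter_upwards [coeFn_toL2 hψ] with x hx
  rw [hx]

lemma hasWeakDeriv_toL2 {ψ : (Fin d → ℝ) → ℝ} (hψ : IsSmooth ψ) (i : Fin d) :
    HasWeakDeriv [i] (toL2 ψ) (toL2 (pd i ψ)) := by
  intro χ hχ hc hs
  have hint : ∀ {F G : (Fin d → ℝ) → ℝ}, Continuous F → Continuous G → HasCompactSupport G →
      Integrable fun x => F x * G x := fun hF hG hG' =>
    (hF.mul hG).integrable_of_hasCompactSupport hG'.mul_left
  have hparts : ∫ x, ψ x * pd i χ x = -∫ x, pd i ψ x * χ x :=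
    integral_mul_fderiv_eq_neg_fderiv_mul_of_integrable
      (hint (hψ.pd i).continuous hχ.continuous hc)
      (hint hψ.continuous (hχ.pd i).continuous (hasCompactSupport_pd hc i))
      (hint hψ.continuous hχ.continuous hc)
      (fun x _ => ContDiff.differentiable hψ (by simp) x)
      (fun x _ => ContDiff.differentiable hχ (by simp) x)
  change ∫ x in cube d, (toL2 ψ : L2 d) x * pd i χ x = _
  rw [setIntegral_toL2_mul hψ.continuous ((tsupport_pd_subset χ i).trans hs),
    setIntegral_toL2_mul (hψ.pd i).continuous hs, hparts, List.length_singleton, pow_one,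
    neg_one_mul]

end WeakDeriv

/-! ### Trigonometric coefficients of derivatives -/

section TrigCoeffDeriv

variable {d : ℕ} {i : Fin d} {v g : L2 d} {σ : Fin d → Bool} {n : Fin d → ℕ}

lemma trigCoeff_eq_tensorPairing (σ : Fin d → Bool) (n : Fin d → ℕ) (v : L2 d) :
    trigCoeff σ n v = tensorPairing v fun l => trigMode (σ l) (n l) :=
  trigCoeff_apply σ n v

lemma trigCoeff_update (σ : Fin d → Bool) (i : Fin d) (b : Bool) (n : Fin d → ℕ) (v : L2 d) :
    trigCoeff (Function.update σ i b) n v =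
      tensorPairing v (Function.update (fun l => trigMode (σ l) (n l)) i (trigMode b (n i))) := by
  rw [trigCoeff_eq_tensorPairing]
  congr 1
  funext l
  rcases eq_or_ne l i with rfl | h
  · simp only [Function.update_self]
  · simp only [Function.update_of_ne h]

lemma HasWeakDerivZeroTrace.tensorPairing_cos (h : HasWeakDerivZeroTrace i v g)
    {α : Fin d → ℝ → ℝ} (hα : ∀ l, ContDiff ℝ ∞ (α l)) (k : ℕ) :
    tensorPairing g (Function.update α i (trigMode false k)) =
      π * k * tensorPairing v (Function.update α i (trigMode true k)) := by
  have hgreen := h.tensorPairing_deriv (contDiff_update hα i (contDiff_trigMode false k))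
  rw [Function.update_self, Function.update_idem, deriv_trigMode_false,
    tensorPairing_update_const_mul] at hgreen
  linarith

lemma HasWeakDeriv.tensorPairing_sin (h : HasWeakDeriv [i] v g) {α : Fin d → ℝ → ℝ}
    (hα : ∀ l, ContDiff ℝ ∞ (α l)) (k : ℕ) :
    tensorPairing g (Function.update α i (trigMode true k)) =
      -(π * k) * tensorPairing v (Function.update α i (trigMode false k)) := by
  have hgreen := h.tensorPairing_deriv (contDiff_update hα i (contDiff_trigMode true k))
    (by simp [trigMode]) (by simp [trigMode, mul_comm π, Real.sin_nat_mul_pi])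
  rw [Function.update_self, Function.update_idem, deriv_trigMode_true,
    tensorPairing_update_const_mul] at hgreen
  linarith

lemma HasDirichletDeriv2.tensorPairing_sin (h : HasDirichletDeriv2 i v g) {α : Fin d → ℝ → ℝ}
    (hα : ∀ l, ContDiff ℝ ∞ (α l)) (k : ℕ) :
    tensorPairing g (Function.update α i (trigMode true k)) =
      -(π * k) ^ 2 * tensorPairing v (Function.update α i (trigMode true k)) := by
  obtain ⟨v', hv', hg⟩ := h
  rw [hg.tensorPairing_sin hα, hv'.tensorPairing_cos hα]
  ring

lemma HasWeakDerivZeroTrace.trigCoeff_eq (h : HasWeakDerivZeroTrace i v g) (σ : Fin d → Bool)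
    (n : Fin d → ℕ) : trigCoeff (Function.update σ i false) n g =
      π * n i * trigCoeff (Function.update σ i true) n v := by
  rw [trigCoeff_update, trigCoeff_update, h.tensorPairing_cos fun l => contDiff_trigMode _ _]

lemma HasWeakDeriv.trigCoeff_eq (h : HasWeakDeriv [i] v g) (σ : Fin d → Bool)
    (n : Fin d → ℕ) : trigCoeff (Function.update σ i true) n g =
      -(π * n i) * trigCoeff (Function.update σ i false) n v := by
  rw [trigCoeff_update, trigCoeff_update, h.tensorPairing_sin fun l => contDiff_trigMode _ _]

lemma HasDirichletDeriv2.trigCoeff_eq (h : HasDirichletDeriv2 i v g) (hσ : σ i = true)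
    (n : Fin d → ℕ) : trigCoeff σ n g = -(π * n i) ^ 2 * trigCoeff σ n v := by
  obtain ⟨v', hv', hg⟩ := h
  have hσ' : Function.update σ i true = σ := by rw [← hσ, Function.update_eq_self]
  have hg' := hg.trigCoeff_eq σ n
  rw [hv'.trigCoeff_eq σ n, hσ'] at hg'
  rw [hg']
  ring

lemma HasNeumannDeriv2.trigCoeff_eq (h : HasNeumannDeriv2 i v g) (hσ : σ i = false)
    (n : Fin d → ℕ) : trigCoeff σ n g = -(π * n i) ^ 2 * trigCoeff σ n v := by
  obtain ⟨v', hv', hg⟩ := h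
  have hσ' : Function.update σ i false = σ := by rw [← hσ, Function.update_eq_self]
  have hg' := hg.trigCoeff_eq σ n
  rw [hv'.trigCoeff_eq σ n, hσ'] at hg'
  rw [hg']
  ring

lemma HasHelmholtz.trigCoeff_eq (h : HasHelmholtz i v g) (hσ : σ i = false)
    (n : Fin d → ℕ) : trigCoeff σ n g = (1 + (π * n i) ^ 2) * trigCoeff σ n v := by
  obtain ⟨v'', hv'', rfl⟩ := h
  rw [map_sub, hv''.trigCoeff_eq hσ]
  ring

lemma IsMode.update_false (h : IsMode σ n) (i : Fin d) : IsMode (Function.update σ i false) n := by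
  intro l hl
  rcases eq_or_ne l i with rfl | hli
  · simp at hl
  · exact h l (by rwa [Function.update_of_ne hli] at hl)

lemma exists_hasWeakDerivZeroTrace (hσ : σ i = true)
    (h : Summable fun n => (π * n i * trigCoeff σ n v) ^ 2) :
    ∃ g, HasWeakDerivZeroTrace i v g := by
  obtain ⟨g, hg⟩ := exists_trigCoeff_eq (Function.update σ i false) _ h fun n hn => by
    rw [trigCoeff_eq_zero fun hmode => hn (hmode.update_false i), mul_zero]
  refine ⟨g, hasWeakDerivZeroTrace_iff.2 fun ψ hψ => ?_⟩
  refine (hasSum_trigCoeff_mul σ v (toL2 (pd i ψ))).unique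
    ((hasSum_trigCoeff_mul (Function.update σ i false) g (toL2 ψ)).neg.congr_fun fun n => ?_)
  have hψ' := (hasWeakDeriv_toL2 hψ i).trigCoeff_eq σ n
  rw [← hσ, Function.update_eq_self] at hψ'
  rw [hψ', hg]
  ring

end TrigCoeffDeriv

/-! ### Fourier symbols -/

section Symbol

variable {d : ℕ} {a b : ℝ}

/-- The eigenvalue of `-∂ᵢᵢ` on the products of sines and cosines of frequency `n`. -/
def freqSq (n : Fin d → ℕ) (i : Fin d) : ℝ := (π * n i) ^ 2

/-- The eigenvalue of `-Δ` on the products of sines and cosines of frequency `n`. -/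
def laplaceSymbol (n : Fin d → ℕ) : ℝ := ∑ i, freqSq n i

/-- The eigenvalue of the direction splitting operator `∏ᵢ (1 - a ∂ᵢᵢ)` on the products of sines
and cosines of frequency `n`. -/
def splitSymbol (a : ℝ) (n : Fin d → ℕ) : ℝ := ∏ i, (1 + a * freqSq n i)

lemma freqSq_nonneg (n : Fin d → ℕ) (i : Fin d) : 0 ≤ freqSq n i := sq_nonneg _

lemma laplaceSymbol_nonneg (n : Fin d → ℕ) : 0 ≤ laplaceSymbol n :=
  Finset.sum_nonneg fun i _ => freqSq_nonneg n i

lemma one_add_sum_le_prod_one_add {ι : Type*} (s : Finset ι) {f : ι → ℝ}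
    (hf : ∀ i ∈ s, 0 ≤ f i) : 1 + ∑ i ∈ s, f i ≤ ∏ i ∈ s, (1 + f i) := by
  classical
  induction s using Finset.induction_on with
  | empty => simp
  | insert i s hi ih =>
    obtain ⟨hi₀, hs₀⟩ := Finset.forall_mem_insert _ _ _ |>.1 hf
    rw [Finset.sum_insert hi, Finset.prod_insert hi]
    nlinarith [ih hs₀, mul_nonneg hi₀ (Finset.sum_nonneg hs₀)]

lemma one_add_mul_laplaceSymbol_le (ha : 0 ≤ a) (n : Fin d → ℕ) :
    1 + a * laplaceSymbol n ≤ splitSymbol a n := by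
  rw [laplaceSymbol, Finset.mul_sum]
  exact one_add_sum_le_prod_one_add _ fun i _ => mul_nonneg ha (freqSq_nonneg n i)

lemma one_le_splitSymbol (ha : 0 ≤ a) (n : Fin d → ℕ) : 1 ≤ splitSymbol a n :=
  (le_add_of_nonneg_right (mul_nonneg ha (laplaceSymbol_nonneg n))).trans
    (one_add_mul_laplaceSymbol_le ha n)

lemma splitSymbol_pos (ha : 0 ≤ a) (n : Fin d → ℕ) : 0 < splitSymbol a n :=
  zero_lt_one.trans_le (one_le_splitSymbol ha n)

lemma splitSymbol_le_mul_splitSymbol (ha : 0 < a) (hb : 0 < b) (n : Fin d → ℕ) :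
    splitSymbol a n ≤ (1 + a / b) ^ d * splitSymbol b n := by
  have hconst : (1 + a / b) ^ d = ∏ _i : Fin d, (1 + a / b) := by simp
  rw [hconst, splitSymbol, splitSymbol, ← Finset.prod_mul_distrib]
  refine Finset.prod_le_prod (fun i _ => ?_) fun i _ => ?_ <;> have := freqSq_nonneg n i
  · positivity
  · have hmul : (1 + a / b) * (1 + b * freqSq n i) =
        1 + a * freqSq n i + (a / b + b * freqSq n i) := by
      field_simp
      ring
    rw [hmul]
    exact le_add_of_nonneg_right (by positivity)

lemma laplaceSymbol_le_splitSymbol (n : Fin d → ℕ) : laplaceSymbol n ≤ splitSymbol 1 n := by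
  linarith [one_add_mul_laplaceSymbol_le zero_le_one n]

lemma abs_freq_le_splitSymbol (n : Fin d → ℕ) (i : Fin d) : |π * n i| ≤ splitSymbol 1 n := by
  have hle : (π * n i) ^ 2 ≤ laplaceSymbol n :=
    Finset.single_le_sum (fun j _ => freqSq_nonneg n j) (Finset.mem_univ i)
  nlinarith [one_add_mul_laplaceSymbol_le zero_le_one n, sq_abs (π * n i),
    sq_nonneg (|π * n i| - 1)]

lemma splitSymbol_eq_sum (a : ℝ) (n : Fin d → ℕ) :
    splitSymbol a n = ∑ S : Finset (Fin d), a ^ S.card * ∏ i ∈ S, freqSq n i := by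
  rw [splitSymbol, Finset.prod_one_add, Finset.powerset_univ]
  simp only [Finset.prod_mul_distrib, Finset.prod_const]

end Symbol

/-! ### The domain of the splitting operator with Dirichlet conditions -/

lemma summable_sq_of_abs_le_mul {ι : Type*} {f g : ι → ℝ} (C : ℝ) (h : ∀ n, |f n| ≤ C * |g n|)
    (hg : Summable fun n => g n ^ 2) : Summable fun n => f n ^ 2 := by
  refine Summable.of_nonneg_of_le (fun n => sq_nonneg _) (fun n => ?_) (hg.mul_left (C ^ 2))
  rw [← sq_abs, ← sq_abs (g n), ← mul_pow]
  exact pow_le_pow_left₀ (abs_nonneg _) (h n) 2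

lemma summable_sq_add {ι : Type*} {f g : ι → ℝ} (hf : Summable fun n => f n ^ 2)
    (hg : Summable fun n => g n ^ 2) : Summable fun n => (f n + g n) ^ 2 :=
  Summable.of_nonneg_of_le (fun n => sq_nonneg _)
    (fun n => by nlinarith [sq_nonneg (f n - g n)]) ((hf.mul_left 2).add (hg.mul_left 2))

section DirichletDomain

variable {d : ℕ} {v w z g : L2 d} {m : (Fin d → ℕ) → ℝ} {a C : ℝ} {i : Fin d}

/-- The coefficient of an element of `L²(Ω)` along the product of sines of frequency `n`. -/
abbrev sinCoeff (n : Fin d → ℕ) : L2 d →L[ℝ] ℝ := trigCoeff (fun _ => true) n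

/-- The coefficient of an element of `L²(Ω)` along the product of cosines of frequency `n`. -/
abbrev cosCoeff (n : Fin d → ℕ) : L2 d →L[ℝ] ℝ := trigCoeff (fun _ => false) n

/-- `v` is in the domain of `∏ᵢ (1 - ∂ᵢᵢ)` with Dirichlet conditions on the whole boundary,
defined through its sine coefficients. -/
def MemDirichletDomain (v : L2 d) : Prop :=
  Summable fun n => (splitSymbol 1 n * sinCoeff n v) ^ 2

namespace MemDirichletDomain

lemma add (hv : MemDirichletDomain v) (hw : MemDirichletDomain w) :
    MemDirichletDomain (v + w) := by
  simpa only [MemDirichletDomain, map_add, mul_add] using summable_sq_add hv hw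

lemma smul (hv : MemDirichletDomain v) (c : ℝ) : MemDirichletDomain (c • v) :=
  (Summable.mul_left (c ^ 2) hv).congr fun n => by
    rw [map_smul, smul_eq_mul]
    ring

lemma sub (hv : MemDirichletDomain v) (hw : MemDirichletDomain w) :
    MemDirichletDomain (v - w) := by
  simpa only [sub_eq_add_neg, neg_one_smul] using hv.add (hw.smul (-1))

lemma summable_sq_mul (h : MemDirichletDomain v) (hm : ∀ n, |m n| ≤ C * splitSymbol 1 n) :
    Summable fun n => (m n * sinCoeff n v) ^ 2 :=
  summable_sq_of_abs_le_mul C (fun n => by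
    rw [abs_mul, abs_mul, ← mul_assoc, abs_of_pos (splitSymbol_pos zero_le_one n)]
    exact mul_le_mul_of_nonneg_right (hm n) (abs_nonneg _)) h

lemma exists_sinCoeff_eq_mul (h : MemDirichletDomain v) (hm : ∀ n, |m n| ≤ C * splitSymbol 1 n) :
    ∃ z : L2 d, ∀ n, sinCoeff n z = m n * sinCoeff n v :=
  exists_trigCoeff_eq _ _ (h.summable_sq_mul hm) fun n hn => by
    rw [trigCoeff_eq_zero hn, mul_zero]

lemma exists_sinCoeff_eq_splitSymbol_mul (h : MemDirichletDomain v) (ha : 0 < a) :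
    ∃ z : L2 d, ∀ n, sinCoeff n z = splitSymbol a n * sinCoeff n v :=
  h.exists_sinCoeff_eq_mul fun n => by
    rw [abs_of_pos (splitSymbol_pos ha.le n)]
    exact splitSymbol_le_mul_splitSymbol ha one_pos n

lemma exists_sinCoeff_eq_laplaceSymbol_mul (h : MemDirichletDomain v) :
    ∃ z : L2 d, ∀ n, sinCoeff n z = laplaceSymbol n * sinCoeff n v :=
  h.exists_sinCoeff_eq_mul (C := 1) fun n => by
    rw [abs_of_nonneg (laplaceSymbol_nonneg n), one_mul]
    exact laplaceSymbol_le_splitSymbol n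

lemma of_sinCoeff_eq_splitSymbol_mul (ha : 0 < a)
    (h : ∀ n, sinCoeff n z = splitSymbol a n * sinCoeff n v) : MemDirichletDomain v := by
  refine summable_sq_of_abs_le_mul ((1 + 1 / a) ^ d) (fun n => ?_)
    (hasSum_trigCoeff_sq (fun _ => true) z).summable
  rw [h, abs_mul, abs_mul, abs_of_pos (splitSymbol_pos ha.le n),
    abs_of_pos (splitSymbol_pos zero_le_one n), ← mul_assoc]
  exact mul_le_mul_of_nonneg_right (splitSymbol_le_mul_splitSymbol one_pos ha n) (abs_nonneg _)

lemma exists_hasWeakDerivZeroTrace (h : MemDirichletDomain v) (i : Fin d) :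
    ∃ g, HasWeakDerivZeroTrace i v g :=
  DirectionSplitting.exists_hasWeakDerivZeroTrace rfl (h.summable_sq_mul (C := 1) fun n => by
    rw [one_mul]
    exact abs_freq_le_splitSymbol n i)

end MemDirichletDomain

lemma HasDirichletDeriv2.sinCoeff_eq (h : HasDirichletDeriv2 i v g) (n : Fin d → ℕ) :
    sinCoeff n g = -freqSq n i * sinCoeff n v :=
  h.trigCoeff_eq rfl n

lemma MemDirichletDomain.sinCoeff_deriv2 (h : MemDirichletDomain v)
    (hg : HasWeakDeriv [i, i] v g) (n : Fin d → ℕ) : sinCoeff n g = -freqSq n i * sinCoeff n v := by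
  obtain ⟨v', hv'⟩ := h.exists_hasWeakDerivZeroTrace i
  exact (hv'.hasDirichletDeriv2 hg).sinCoeff_eq n

end DirichletDomain

/-! ### Mixed second derivatives of functions with zero trace -/

section MixedDeriv2

variable {d : ℕ} {u : L2 d} {w : List (Fin d) → L2 d}

/- The derivatives `w l` for `l ≠ []` are not assumed to have traces. In the step from `l` to
`i :: l`, a factor compactly supported in `xᵢ` reduces the claim to `∂ᵢᵢ u`, whose sine
coefficients are known because `u` itself vanishes on the boundary. -/
lemma tensorPairing_mixedDeriv2 (hu : MemH10 u)
    (hw : ∀ l : List (Fin d), l.Nodup → HasWeakDeriv (l ++ l) u (w l)) (n : Fin d → ℕ)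
    (l : List (Fin d)) (hl : l.Nodup) (α : Fin d → ℝ → ℝ) (hα : ∀ i, ContDiff ℝ ∞ (α i))
    (hsin : ∀ i ∈ l, α i = trigMode true (n i)) :
    tensorPairing (w l) α = (l.map fun i => -freqSq n i).prod * tensorPairing u α := by
  induction l generalizing α with
  | nil =>
    rw [(hw [] List.nodup_nil).unique (hasWeakDeriv_nil u), List.map_nil, List.prod_nil, one_mul]
  | cons i l ih =>
    obtain ⟨hi, hl'⟩ := List.nodup_cons.1 hl
    have hconsl : HasWeakDeriv [i, i] (w l) (w (i :: l)) := (hw l hl').of_cons_cons (hw (i :: l) hl)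
    have hsingle : HasWeakDeriv [i, i] u (w [i]) := hw [i] (List.nodup_singleton i)
    have hreduce : tensorPairing (w (i :: l)) α =
        (l.map fun i => -freqSq n i).prod * tensorPairing (w [i]) α := by
      refine tensorPairing_eq_mul_of_forall_tsupport_subset (i := i) hα fun β hβ hβs => ?_
      have hα' := contDiff_update hα i hβ
      have hconsl' := hconsl.tensorPairing_deriv_deriv hα' (by simpa using hβs)
      have hsingle' := hsingle.tensorPairing_deriv_deriv hα' (by simpa using hβs)
      rw [Function.update_self, Function.update_idem] at hconsl' hsingle'
      rw [← hconsl', ← hsingle']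
      refine ih hl' _ (contDiff_update hα i (contDiff_infty_iff_deriv.1
        (contDiff_infty_iff_deriv.1 hβ).2).2) fun j hj => ?_
      rw [Function.update_of_ne fun h : j = i => hi (h ▸ hj)]
      exact hsin j (List.mem_cons_of_mem _ hj)
    obtain ⟨g, hg⟩ := hu i
    have hdirichlet := (hg.hasDirichletDeriv2 hsingle).tensorPairing_sin hα (n i)
    rw [← hsin i List.mem_cons_self, Function.update_eq_self] at hdirichlet
    rw [hreduce, hdirichlet, List.map_cons, List.prod_cons, freqSq]
    ring

lemma sinCoeff_mixedDeriv2 (hu : MemH10 u)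
    (hw : ∀ l : List (Fin d), l.Nodup → HasWeakDeriv (l ++ l) u (w l)) (S : Finset (Fin d))
    (n : Fin d → ℕ) :
    sinCoeff n (w S.toList) = (-1) ^ S.card * (∏ i ∈ S, freqSq n i) * sinCoeff n u := by
  rw [trigCoeff_eq_tensorPairing, trigCoeff_eq_tensorPairing, tensorPairing_mixedDeriv2 hu hw n
    S.toList S.nodup_toList _ (fun i => contDiff_trigMode _ _) fun _ _ => rfl,
    Finset.prod_map_toList, Finset.prod_neg]

lemma sinCoeff_sum_mixedDeriv2 (hu : MemH10 u)
    (hw : ∀ l : List (Fin d), l.Nodup → HasWeakDeriv (l ++ l) u (w l)) (a : ℝ) (n : Fin d → ℕ) :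
    sinCoeff n (∑ S : Finset (Fin d), (-a) ^ S.card • w S.toList) =
      splitSymbol a n * sinCoeff n u := by
  rw [map_sum, splitSymbol_eq_sum, Finset.sum_mul]
  refine Finset.sum_congr rfl fun S _ => ?_
  rw [map_smul, sinCoeff_mixedDeriv2 hu hw, smul_eq_mul, ← mul_assoc, ← mul_assoc, ← mul_pow,
    neg_mul_neg, mul_one]

end MixedDeriv2

/-! ### The quadratic forms of the Laplacian and of the splitting operator -/

section Energy

variable {d : ℕ} {v z : L2 d} {a : ℝ}

/-- The quadratic form `⟨∏ᵢ (1 - a ∂ᵢᵢ) v, v⟩` with Dirichlet conditions. -/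
def splitEnergy (a : ℝ) (v : L2 d) : ℝ := ∑' n, splitSymbol a n * sinCoeff n v ^ 2

/-- The quadratic form `⟨-Δ v, v⟩` with Dirichlet conditions. -/
def dirichletEnergy (v : L2 d) : ℝ := ∑' n, laplaceSymbol n * sinCoeff n v ^ 2

lemma hasSum_mul_sinCoeff_sq {m : (Fin d → ℕ) → ℝ} (hz : ∀ n, sinCoeff n z = m n * sinCoeff n v) :
    HasSum (fun n => m n * sinCoeff n v ^ 2) (inner ℝ z v) :=
  (hasSum_trigCoeff_mul (fun _ => true) z v).congr_fun fun n => by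
    rw [hz]
    ring

lemma hasSum_splitEnergy (h : MemDirichletDomain v) (ha : 0 < a) :
    HasSum (fun n => splitSymbol a n * sinCoeff n v ^ 2) (splitEnergy a v) := by
  obtain ⟨z, hz⟩ := h.exists_sinCoeff_eq_splitSymbol_mul ha
  exact (hasSum_mul_sinCoeff_sq hz).summable.hasSum

lemma hasSum_dirichletEnergy (h : MemDirichletDomain v) :
    HasSum (fun n => laplaceSymbol n * sinCoeff n v ^ 2) (dirichletEnergy v) := by
  obtain ⟨z, hz⟩ := h.exists_sinCoeff_eq_laplaceSymbol_mul
  exact (hasSum_mul_sinCoeff_sq hz).summable.hasSum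

lemma dirichletEnergy_eq_sum {g : Fin d → L2 d} (hv : MemDirichletDomain v)
    (hg : ∀ i, HasWeakDerivZeroTrace i v (g i)) : dirichletEnergy v = ∑ i, ‖g i‖ ^ 2 := by
  refine (hasSum_dirichletEnergy hv).unique ((hasSum_sum (s := Finset.univ) fun i _ =>
    hasSum_trigCoeff_sq (Function.update (fun _ => true) i false) (g i)).congr_fun fun n => ?_)
  rw [laplaceSymbol, Finset.sum_mul]
  refine Finset.sum_congr rfl fun i _ => ?_
  rw [(hg i).trigCoeff_eq, Function.update_eq_self i (fun _ : Fin d => true), freqSq]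
  ring

lemma norm_sq_add_dirichletEnergy_le (ha : 0 < a) (h : MemDirichletDomain v) :
    ‖v‖ ^ 2 + a * dirichletEnergy v ≤ splitEnergy a v :=
  hasSum_le (fun n => by
      nlinarith [one_add_mul_laplaceSymbol_le ha.le n, sq_nonneg (sinCoeff n v)])
    ((hasSum_trigCoeff_sq (fun _ => true) v).add ((hasSum_dirichletEnergy h).mul_left a))
    (hasSum_splitEnergy h ha)

lemma splitEnergy_le_norm_sq (ha : 0 < a) (h : MemDirichletDomain v)
    (hz : ∀ n, sinCoeff n z = splitSymbol a n * sinCoeff n v) : splitEnergy a v ≤ ‖z‖ ^ 2 :=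
  hasSum_le (fun n => by
      rw [hz, mul_pow]
      exact mul_le_mul_of_nonneg_right
        (le_self_pow₀ (one_le_splitSymbol ha.le n) two_ne_zero) (sq_nonneg _))
    (hasSum_splitEnergy h ha) (hasSum_trigCoeff_sq (fun _ => true) z)

lemma splitEnergy_sub_add_le {τ : ℝ} (hτ : 0 < τ) {v w z : L2 d} (hv : MemDirichletDomain v)
    (hw : MemDirichletDomain w) (hz : ∀ n, sinCoeff n z = splitSymbol (τ / 2) n *
      (sinCoeff n v - sinCoeff n w) + τ * laplaceSymbol n * sinCoeff n w) :
    splitEnergy (τ / 2) v - splitEnergy (τ / 2) w + ‖v - w‖ ^ 2 +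
      τ / 2 * dirichletEnergy (v + w) ≤ 2 * inner ℝ z v := by
  have hτ2 : 0 < τ / 2 := half_pos hτ
  refine hasSum_le (fun n => ?_) ((((hasSum_splitEnergy hv hτ2).sub
    (hasSum_splitEnergy hw hτ2)).add (hasSum_trigCoeff_sq (fun _ => true) (v - w))).add
      ((hasSum_dirichletEnergy (hv.add hw)).mul_left (τ / 2)))
    ((hasSum_trigCoeff_mul (fun _ => true) z v).mul_left 2)
  rw [hz, map_sub, map_add]
  nlinarith [mul_nonneg (sub_nonneg.2 (one_add_mul_laplaceSymbol_le hτ2.le n))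
    (sq_nonneg (sinCoeff n v - sinCoeff n w))]

end Energy

/-! ### Integration by parts and the identity of gradient, divergence and curl -/

section IntegrationByParts

variable {d : ℕ} {i j : Fin d}

lemma HasWeakDerivZeroTrace.cosCoeff_eq {v D : L2 d} (h : HasWeakDerivZeroTrace i v D)
    (n : Fin d → ℕ) :
    cosCoeff n D = π * n i * trigCoeff (Function.update (fun _ => false) i true) n v := by
  have hcoeff := h.trigCoeff_eq (fun _ => false) n
  rwa [Function.update_eq_self i (fun _ : Fin d => false)] at hcoeff

lemma HasWeakDeriv.inner_eq_neg_inner {q G v D : L2 d} (hq : HasWeakDeriv [i] q G)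
    (hv : HasWeakDerivZeroTrace i v D) : inner ℝ G v = -inner ℝ q D := by
  refine (hasSum_trigCoeff_mul (Function.update (fun _ => false) i true) G v).unique
    ((hasSum_trigCoeff_mul (fun _ => false) q D).neg.congr_fun fun n => ?_)
  have hG := hq.trigCoeff_eq (fun _ => false) n
  rw [Function.update_eq_self i (fun _ : Fin d => false)] at hG
  rw [hG, hv.cosCoeff_eq]
  ring

lemma inner_mixedDeriv_comm (hij : i ≠ j) {v w vi vj wi wj : L2 d}
    (hvi : HasWeakDerivZeroTrace i v vi) (hvj : HasWeakDerivZeroTrace j v vj)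
    (hwi : HasWeakDerivZeroTrace i w wi) (hwj : HasWeakDerivZeroTrace j w wj) :
    inner ℝ vi wj = inner ℝ vj wi := by
  let s : Fin d → Bool := fun _ => true
  refine (hasSum_trigCoeff_mul (Function.update s i false) vi wj).unique
    ((hasSum_trigCoeff_mul (Function.update s j false) vj wi).congr_fun fun n => ?_)
  have hs : ∀ k, Function.update s k true = s := fun k => Function.update_eq_self k s
  have hs' : ∀ k l : Fin d, k ≠ l →
      Function.update (Function.update s k false) l true = Function.update s k false :=
    fun k l hkl => by rw [Function.update_comm hkl, hs]
  have hwj' := hwj.hasWeakDeriv.trigCoeff_eq (Function.update s i false) n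
  have hwi' := hwi.hasWeakDeriv.trigCoeff_eq (Function.update s j false) n
  rw [hs' _ _ hij] at hwj'
  rw [hs' _ _ hij.symm, Function.update_comm hij.symm] at hwi'
  rw [hvi.trigCoeff_eq s n, hvj.trigCoeff_eq s n, hs, hs, hwj', hwi']
  ring

lemma two_mul_sum_sum_lt {ι : Type*} [Fintype ι] [LinearOrder ι] {F : ι → ι → ℝ}
    (hs : ∀ i j, F i j = F j i) (h0 : ∀ i, F i i = 0) :
    2 * ∑ i, ∑ j ∈ Finset.univ.filter (fun j => i < j), F i j = ∑ i, ∑ j, F i j := by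
  have hsplit : ∀ i j, F i j = (if i < j then F i j else 0) + (if j < i then F j i else 0) := by
    intro i j
    rcases lt_trichotomy i j with h | rfl | h
    · simp [h, h.not_gt]
    · simp [h0]
    · simp [h, h.not_gt, hs i j]
  simp_rw [Finset.sum_filter]
  conv_rhs => enter [2, i, 2, j]; rw [hsplit i j]
  simp_rw [Finset.sum_add_distrib]
  rw [Finset.sum_comm (f := fun i j => if j < i then F j i else 0)]
  ring

/-- The squared `L²` norm of the curl of a vector field `v` with gradient `g i j = ∂ᵢ vⱼ`. As in
`curlNorm`, the components of the curl are indexed by the pairs `i < j`. -/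
def curlSq (g : Fin d → Fin d → L2 d) : ℝ :=
  ∑ i, ∑ j ∈ Finset.univ.filter (fun j => i < j), ‖g i j - g j i‖ ^ 2

lemma curlSq_nonneg (g : Fin d → Fin d → L2 d) : 0 ≤ curlSq g :=
  Finset.sum_nonneg fun _ _ => Finset.sum_nonneg fun _ _ => sq_nonneg _

lemma curlSq_smul (c : ℝ) (g : Fin d → Fin d → L2 d) : curlSq (c • g) = c ^ 2 * curlSq g := by
  simp_rw [curlSq, Finset.mul_sum, Pi.smul_apply, ← smul_sub, norm_smul, mul_pow,
    Real.norm_eq_abs, sq_abs]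

lemma sum_norm_sq_grad_eq {v : Fin d → L2 d} {g : Fin d → Fin d → L2 d}
    (hg : ∀ i j, HasWeakDerivZeroTrace i (v j) (g i j)) :
    ∑ j, ∑ i, ‖g i j‖ ^ 2 = ‖∑ i, g i i‖ ^ 2 + curlSq g := by
  have hmixed : ∀ i j, inner ℝ (g i j) (g j i) = inner ℝ (g i i) (g j j) := by
    intro i j
    rcases eq_or_ne i j with rfl | h
    · rfl
    · rw [inner_mixedDeriv_comm h (hg i j) (hg j j) (hg i i) (hg j i), real_inner_comm]
  have hcurl : 2 * curlSq g = ∑ i, ∑ j, ‖g i j - g j i‖ ^ 2 :=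
    two_mul_sum_sum_lt (fun i j => by rw [norm_sub_rev]) (fun i => by simp)
  have hexpand : ∑ i, ∑ j, ‖g i j - g j i‖ ^ 2 =
      2 * ∑ j, ∑ i, ‖g i j‖ ^ 2 - 2 * ‖∑ i, g i i‖ ^ 2 := by
    simp_rw [norm_sub_sq_real, hmixed, Finset.sum_add_distrib, Finset.sum_sub_distrib,
      ← Finset.mul_sum, ← inner_sum, ← sum_inner, real_inner_self_eq_norm_sq]
    rw [Finset.sum_comm (f := fun i j => ‖g i j‖ ^ 2)]
    ring
  linarith

lemma sum_dirichletEnergy_eq {v : Fin d → L2 d} {g : Fin d → Fin d → L2 d}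
    (hv : ∀ j, MemDirichletDomain (v j)) (hg : ∀ i j, HasWeakDerivZeroTrace i (v j) (g i j)) :
    ∑ j, dirichletEnergy (v j) = ‖∑ i, g i i‖ ^ 2 + curlSq g := by
  rw [← sum_norm_sq_grad_eq hg]
  exact Finset.sum_congr rfl fun j _ => dirichletEnergy_eq_sum (hv j) fun i => hg i j

end IntegrationByParts

/-! ### The energy space of the pressure operator -/

section SqrtA

variable {d : ℕ} {q q' x x' y r g : L2 d} {v D : Fin d → L2 d}

/-- `x = A^{1/2} q`, where `A = ∏ᵢ (1 - ∂ᵢᵢ)` with Neumann conditions is diagonal in the cosine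
basis. Such an `x` exists exactly when `q` is in the form domain of `A`. -/
def HasSqrtA (q x : L2 d) : Prop := ∀ n, cosCoeff n x = √(splitSymbol 1 n) * cosCoeff n q

lemma sq_sqrt_splitSymbol (n : Fin d → ℕ) : √(splitSymbol 1 n) ^ 2 = splitSymbol 1 n :=
  Real.sq_sqrt (splitSymbol_pos zero_le_one n).le

namespace HasSqrtA

lemma add (h : HasSqrtA q x) (h' : HasSqrtA q' x') : HasSqrtA (q + q') (x + x') := fun n => by
  rw [map_add, map_add, h, h', mul_add]

lemma smul (h : HasSqrtA q x) (c : ℝ) : HasSqrtA (c • q) (c • x) := fun n => by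
  rw [map_smul, map_smul, h, smul_eq_mul, smul_eq_mul, mul_left_comm]

lemma sub (h : HasSqrtA q x) (h' : HasSqrtA q' x') : HasSqrtA (q - q') (x - x') := fun n => by
  rw [map_sub, map_sub, h, h', mul_sub]

lemma zero : HasSqrtA (0 : L2 d) 0 := fun n => by rw [map_zero, mul_zero]

lemma unique (h : HasSqrtA q x) (h' : HasSqrtA q x') : x = x' :=
  eq_of_trigCoeff_eq (fun _ => false) fun n => (h n).trans (h' n).symm

lemma inner_comm (hx : HasSqrtA q x) (hr : HasSqrtA y r) : inner ℝ q r = inner ℝ x y := by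
  refine (hasSum_trigCoeff_mul (fun _ => false) q r).unique
    ((hasSum_trigCoeff_mul (fun _ => false) x y).congr_fun fun n => ?_)
  rw [hx, hr]
  ring

end HasSqrtA

lemma exists_cosCoeff_eq (c : (Fin d → ℕ) → ℝ) (hc : Summable fun n => c n ^ 2) :
    ∃ x : L2 d, ∀ n, cosCoeff n x = c n :=
  exists_trigCoeff_eq _ c hc fun n hn => absurd (fun l hl => by simp at hl) hn

lemma exists_hasSqrtA (h : ∀ n, cosCoeff n g = splitSymbol 1 n * cosCoeff n q) :
    ∃ x, HasSqrtA q x ∧ HasSqrtA x g := by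
  have hle : ∀ n : Fin d → ℕ, √(splitSymbol 1 n) ≤ splitSymbol 1 n := fun n =>
    Real.sqrt_le_iff.2 ⟨(splitSymbol_pos zero_le_one n).le,
      le_self_pow₀ (one_le_splitSymbol zero_le_one n) two_ne_zero⟩
  have hsum : Summable fun n => (√(splitSymbol 1 n) * cosCoeff n q) ^ 2 := by
    refine summable_sq_of_abs_le_mul 1 (fun n => ?_)
      (hasSum_trigCoeff_sq (fun _ => false) g).summable
    rw [h, abs_mul, abs_mul, one_mul, abs_of_nonneg (Real.sqrt_nonneg _),
      abs_of_pos (splitSymbol_pos zero_le_one n)]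
    exact mul_le_mul_of_nonneg_right (hle n) (abs_nonneg _)
  obtain ⟨x, hx⟩ := exists_cosCoeff_eq _ hsum
  refine ⟨x, hx, fun n => ?_⟩
  rw [h, hx, ← mul_assoc, ← pow_two, sq_sqrt_splitSymbol]

lemma cosCoeff_div_sq_le (hD : ∀ i, HasWeakDerivZeroTrace i (v i) (D i)) (n : Fin d → ℕ) :
    cosCoeff n (∑ i, D i) ^ 2 ≤ splitSymbol 1 n *
      ∑ i, trigCoeff (Function.update (fun _ => false) i true) n (v i) ^ 2 := by
  rw [map_sum]
  simp_rw [fun i => (hD i).cosCoeff_eq n]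
  exact (Finset.sum_mul_sq_le_sq_mul_sq _ _ _).trans (mul_le_mul_of_nonneg_right
    (laplaceSymbol_le_splitSymbol n) (Finset.sum_nonneg fun i _ => sq_nonneg _))

/- In operator terms: `x = A^{-1/2} div v`, and `A` dominates `-Δ`. -/
lemma HasSqrtA.norm_sq_le_of_div (hD : ∀ i, HasWeakDerivZeroTrace i (v i) (D i))
    (hx : HasSqrtA x (∑ i, D i)) : ‖x‖ ^ 2 ≤ ∑ i, ‖v i‖ ^ 2 := by
  refine hasSum_le (fun n => ?_) (hasSum_trigCoeff_sq (fun _ => false) x)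
    (hasSum_sum (s := Finset.univ) fun i _ =>
      hasSum_trigCoeff_sq (Function.update (fun _ => false) i true) (v i))
  have hdiv := cosCoeff_div_sq_le hD n
  rw [hx n, mul_pow, sq_sqrt_splitSymbol] at hdiv
  exact le_of_mul_le_mul_left hdiv (splitSymbol_pos zero_le_one n)

variable {w : List (Fin d) → L2 d}

/- Each differentiation turns a cosine factor into a sine factor, so the sine factors of the test
product sit exactly in the directions of `l` and no boundary term appears. -/
lemma trigCoeff_mixedDeriv (hw : ∀ l : List (Fin d), l.Nodup → HasWeakDeriv l q (w l))
    (n : Fin d → ℕ) (l : List (Fin d)) (hl : l.Nodup) :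
    trigCoeff (fun i => decide (i ∈ l)) n (w l) =
      (l.map fun i => -(π * n i)).prod * cosCoeff n q := by
  induction l with
  | nil =>
    rw [(hw [] List.nodup_nil).unique (hasWeakDeriv_nil q)]
    simp
  | cons i l ih =>
    obtain ⟨hi, hl'⟩ := List.nodup_cons.1 hl
    have hstep := ((hw l hl').of_cons (hw (i :: l) hl)).trigCoeff_eq (fun i => decide (i ∈ l)) n
    have hsin : Function.update (fun j => decide (j ∈ l)) i true =
        fun j => decide (j ∈ i :: l) := by
      funext j
      rcases eq_or_ne j i with rfl | h
      · simp
      · simp [h]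
    have hcos : Function.update (fun j => decide (j ∈ l)) i false = fun j => decide (j ∈ l) :=
      Function.update_eq_self_iff.2 (decide_eq_false hi).symm
    rw [hsin, hcos, ih hl'] at hstep
    rw [hstep, List.map_cons, List.prod_cons, mul_assoc]

lemma exists_hasSqrtA_norm_sq_eq (hw : ∀ l : List (Fin d), l.Nodup → HasWeakDeriv l q (w l)) :
    ∃ x, HasSqrtA q x ∧ ‖x‖ ^ 2 = ∑ S : Finset (Fin d), ‖w S.toList‖ ^ 2 := by
  have hsum : HasSum (fun n => (√(splitSymbol 1 n) * cosCoeff n q) ^ 2)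
      (∑ S : Finset (Fin d), ‖w S.toList‖ ^ 2) := by
    refine (hasSum_sum (s := Finset.univ) fun S _ =>
      hasSum_trigCoeff_sq (fun i => decide (i ∈ Finset.toList S)) (w S.toList)).congr_fun
        fun n => ?_
    rw [mul_pow, sq_sqrt_splitSymbol, splitSymbol_eq_sum, Finset.sum_mul]
    refine Finset.sum_congr rfl fun S _ => ?_
    rw [trigCoeff_mixedDeriv hw n _ S.nodup_toList, Finset.prod_map_toList, mul_pow,
      ← Finset.prod_pow]
    simp [freqSq]
  obtain ⟨x, hx⟩ := exists_cosCoeff_eq _ hsum.summable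
  exact ⟨x, hx, (hasSum_trigCoeff_sq (fun _ => false) x).unique
    (hsum.congr_fun fun n => by rw [hx])⟩

end SqrtA

/-! ### The scheme in trigonometric coefficients -/

section SchemeCoeff

lemma HasLaplacian.sinCoeff_eq {d : ℕ} {u L : Field d} (h : HasLaplacian u L)
    (hu : ∀ i, MemDirichletDomain (u i)) (i : Fin d) (n : Fin d → ℕ) :
    sinCoeff n (L i) = -(laplaceSymbol n * sinCoeff n (u i)) := by
  obtain ⟨D, hD, hL⟩ := h
  rw [hL, map_sum, laplaceSymbol, Finset.sum_mul, ← Finset.sum_neg_distrib]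
  exact Finset.sum_congr rfl fun j _ => by rw [(hu i).sinCoeff_deriv2 (hD i j) n, neg_mul]

lemma VelocityStep2.exists_hasGrad_sinCoeff {τ : ℝ} (hτ : 0 < τ) {F u v : Field 2} {q : L2 2}
    (hu : ∀ i, MemDirichletDomain (u i)) (h : VelocityStep2 τ F q u v) :
    ∃ G : Field 2, HasGrad q G ∧ ∀ i n,
      splitSymbol (τ / 2) n * (sinCoeff n (v i) - sinCoeff n (u i)) =
        τ * (-(laplaceSymbol n * sinCoeff n (u i)) - sinCoeff n (G i) + sinCoeff n (F i)) := by
  obtain ⟨w, wxx, uyy, vyy, G, hw, huy, hv, hG, hhalf, hfull⟩ := h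
  refine ⟨G, hG, fun i n => ?_⟩
  have chalf := congrArg (fun z : Field 2 => sinCoeff n (z i)) hhalf
  have cfull := congrArg (fun z : Field 2 => sinCoeff n (z i)) hfull
  simp only [Pi.add_apply, Pi.sub_apply, Pi.smul_apply, map_add, map_sub, map_smul, smul_eq_mul,
    (hw i).sinCoeff_eq, (hv i).sinCoeff_eq, (hu i).sinCoeff_deriv2 (huy i)] at chalf cfull
  simp only [splitSymbol, laplaceSymbol, Fin.prod_univ_two, Fin.sum_univ_two]
  field_simp at chalf cfull
  linear_combination (1 / 2 - τ / 4 * freqSq n 0) * chalf + (1 / 2 + τ / 4 * freqSq n 0) * cfull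

lemma VelocityStep3.exists_hasGrad_sinCoeff {τ : ℝ} (hτ : 0 < τ) {F u v : Field 3} {q : L2 3}
    (hu : ∀ i, MemDirichletDomain (u i)) (h : VelocityStep3 τ F q u v) :
    ∃ G : Field 3, HasGrad q G ∧ ∀ i n,
      splitSymbol (τ / 2) n * (sinCoeff n (v i) - sinCoeff n (u i)) =
        τ * (-(laplaceSymbol n * sinCoeff n (u i)) - sinCoeff n (G i) + sinCoeff n (F i)) := by
  obtain ⟨ξ, η, ζ, L, G, uxx, uyy, uzz, ηxx, ζyy, vzz, hL, hG, hux, huy, huz, hη, hζ, hv,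
    heqξ, heqη, heqζ, heqv⟩ := h
  refine ⟨G, hG, fun i n => ?_⟩
  have cξ := congrArg (fun z : Field 3 => sinCoeff n (z i)) heqξ
  have cη := congrArg (fun z : Field 3 => sinCoeff n (z i)) heqη
  have cζ := congrArg (fun z : Field 3 => sinCoeff n (z i)) heqζ
  have cv := congrArg (fun z : Field 3 => sinCoeff n (z i)) heqv
  simp only [Pi.add_apply, Pi.sub_apply, Pi.smul_apply, Pi.zero_apply, map_add, map_sub, map_smul,
    map_zero, smul_eq_mul, hL.sinCoeff_eq hu, (hη i).sinCoeff_eq, (hζ i).sinCoeff_eq,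
    (hv i).sinCoeff_eq, (hu i).sinCoeff_deriv2 (hux i), (hu i).sinCoeff_deriv2 (huy i),
    (hu i).sinCoeff_deriv2 (huz i)] at cξ cη cζ cv
  simp only [splitSymbol, Fin.prod_univ_three]
  field_simp at cξ cη cζ cv
  linear_combination cξ + 1 / 2 * cη + 1 / 2 * (1 + τ / 2 * freqSq n 0) * cζ
    + 1 / 2 * (1 + τ / 2 * freqSq n 0) * (1 + τ / 2 * freqSq n 1) * cv

/- Eliminating the intermediate velocities from a step of the scheme leaves
`∏ᵢ (1 - τ/2 ∂ᵢᵢ) (v - u) = τ (Δ u - ∇ q + F)`. -/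
lemma VelocityStep.exists_hasGrad_sinCoeff {d : ℕ} (hd : d = 2 ∨ d = 3) {τ : ℝ} (hτ : 0 < τ)
    {F u v : Field d} {q : L2 d} (hu : ∀ i, MemDirichletDomain (u i))
    (h : VelocityStep d τ F q u v) :
    ∃ G : Field d, HasGrad q G ∧ ∀ i n,
      splitSymbol (τ / 2) n * (sinCoeff n (v i) - sinCoeff n (u i)) =
        τ * (-(laplaceSymbol n * sinCoeff n (u i)) - sinCoeff n (G i) + sinCoeff n (F i)) := by
  rcases hd with rfl | rfl
  · exact VelocityStep2.exists_hasGrad_sinCoeff hτ hu h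
  · exact VelocityStep3.exists_hasGrad_sinCoeff hτ hu h

lemma HasHelmholtz.cosCoeff_eq {d : ℕ} {i : Fin d} {v g : L2 d} (h : HasHelmholtz i v g)
    (n : Fin d → ℕ) : cosCoeff n g = (1 + freqSq n i) * cosCoeff n v :=
  h.trigCoeff_eq rfl n

lemma HasA.cosCoeff_eq {d : ℕ} (hd : d = 2 ∨ d = 3) {q g : L2 d} (h : HasA d q g)
    (n : Fin d → ℕ) : cosCoeff n g = splitSymbol 1 n * cosCoeff n q := by
  rcases hd with rfl | rfl
  · obtain ⟨_, w, hw, hg⟩ := h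
    rw [hg.cosCoeff_eq, hw.cosCoeff_eq]
    simp only [splitSymbol, Fin.prod_univ_two]
    ring
  · obtain ⟨_, w₁, w₂, hw₁, hw₂, hg⟩ := h
    rw [hg.cosCoeff_eq, hw₂.cosCoeff_eq, hw₁.cosCoeff_eq]
    simp only [splitSymbol, Fin.prod_univ_three]
    ring

end SchemeCoeff

/-! ### Increments of functions of time -/

section Time

open Set
open scoped NNReal

variable {E : Type*} [NormedAddCommGroup E] {T : ℝ} {M M' : ℝ≥0} {g g' : ℝ → E}

/-- The increments of `g` over subintervals of `[0, T]` of length `h` are `M h`-Lipschitz in the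
left endpoint. This says that `g''` is bounded by `M` without differentiating `g`. -/
def LipschitzIncrements (T : ℝ) (M : ℝ≥0) (g : ℝ → E) : Prop :=
  ∀ h : ℝ≥0, LipschitzOnWith (M * h) (fun t => g (t + h) - g t) (Icc 0 (T - h))

namespace LipschitzIncrements

lemma norm_sub_le (hg : LipschitzIncrements T M g) {a b h : ℝ} (hh : 0 ≤ h) (ha : 0 ≤ a)
    (hah : a + h ≤ T) (hb : 0 ≤ b) (hbh : b + h ≤ T) :
    ‖(g (a + h) - g a) - (g (b + h) - g b)‖ ≤ M * h * |a - b| :=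
  (hg ⟨h, hh⟩).norm_sub_le ⟨ha, le_sub_iff_add_le.2 hah⟩ ⟨hb, le_sub_iff_add_le.2 hbh⟩

lemma add (hg : LipschitzIncrements T M g) (hg' : LipschitzIncrements T M' g') :
    LipschitzIncrements T (M + M') fun t => g t + g' t := fun h => by
  simpa only [add_mul, add_sub_add_comm] using (hg h).add (hg' h)

lemma neg (hg : LipschitzIncrements T M g) : LipschitzIncrements T M fun t => -g t := fun h => by
  simpa only [Pi.neg_def, neg_sub', sub_neg_eq_add] using (hg h).neg

lemma sum {ι : Type*} (s : Finset ι) {M : ι → ℝ≥0} {g : ι → ℝ → E}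
    (hg : ∀ j ∈ s, LipschitzIncrements T (M j) (g j)) :
    LipschitzIncrements T (∑ j ∈ s, M j) fun t => ∑ j ∈ s, g j t := by
  classical
  induction s using Finset.induction_on with
  | empty => exact fun h => LipschitzOnWith.of_dist_le_mul fun _ _ _ _ => by simp
  | insert j s hj ih =>
    simp_rw [Finset.sum_insert hj]
    exact (hg j (Finset.mem_insert_self j s)).add
      (ih fun k hk => hg k (Finset.mem_insert_of_mem hk))

end LipschitzIncrements

variable [NormedSpace ℝ E]

lemma sub_eq_integral (hi : IntegrableOn g' (Ioc 0 T))
    (h : ∀ t ∈ Icc (0 : ℝ) T, g t = g 0 + ∫ s in (0 : ℝ)..t, g' s) {a b : ℝ}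
    (ha : a ∈ Icc 0 T) (hb : b ∈ Icc 0 T) : g b - g a = ∫ s in a..b, g' s := by
  have hii : ∀ t ∈ Icc (0 : ℝ) T, IntervalIntegrable g' volume 0 t := fun t ht =>
    (intervalIntegrable_iff_integrableOn_Ioc_of_le ht.1).2
      (hi.mono_set (Ioc_subset_Ioc_right ht.2))
  rw [h a ha, h b hb, ← intervalIntegral.integral_interval_sub_left (hii b hb) (hii a ha),
    add_sub_add_left_eq_sub]

lemma MemWInf.exists_lipschitzOnWith (hg : MemWInf T 1 g) :
    ∃ M, LipschitzOnWith M g (Icc 0 T) := by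
  obtain ⟨g', hg', hint⟩ := hg
  have hmem : MemLp g' ⊤ (volume.restrict (Ioc 0 T)) := hg'
  have hbound : ∀ᵐ s, s ∈ Ioc 0 T →
      ‖g' s‖ ≤ (eLpNormEssSup g' (volume.restrict (Ioc 0 T))).toReal := by
    rw [← ae_restrict_iff' measurableSet_Ioc]
    filter_upwards [ae_le_eLpNormEssSup (f := g')] with s hs
    rw [← toReal_enorm]
    exact ENNReal.toReal_mono (eLpNorm_exponent_top (f := g') ▸ hmem.eLpNorm_ne_top) hs
  refine ⟨(eLpNormEssSup g' (volume.restrict (Ioc 0 T))).toNNReal,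
    LipschitzOnWith.of_dist_le_mul fun a ha b hb => ?_⟩
  rw [dist_eq_norm, sub_eq_integral (hmem.integrable le_top) hint hb ha, Real.dist_eq]
  refine intervalIntegral.norm_integral_le_of_norm_le_const_ae ?_
  filter_upwards [hbound] with s hs hs'
  exact hs ⟨(le_min hb.1 ha.1).trans_lt hs'.1, hs'.2.trans (max_le hb.2 ha.2)⟩

lemma MemWInf.of_succ : ∀ {m : ℕ} {g : ℝ → E}, MemWInf T (m + 1) g → MemWInf T m g
  | 0, g, h => by
    obtain ⟨M, hM⟩ := h.exists_lipschitzOnWith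
    obtain ⟨C, hC⟩ := isCompact_Icc.exists_bound_of_continuousOn hM.continuousOn
    have hcont : ContinuousOn g (Ioc 0 T) := hM.continuousOn.mono Ioc_subset_Icc_self
    exact MemLp.of_bound (hcont.aestronglyMeasurable measurableSet_Ioc) C
      (ae_restrict_of_forall_mem measurableSet_Ioc fun s hs => hC s (Ioc_subset_Icc_self hs))
  | _ + 1, _, ⟨g', hg', hint⟩ => ⟨g', hg'.of_succ, hint⟩

lemma lipschitzIncrements_of_eq_integral (hg' : LipschitzOnWith M g' (Icc 0 T))
    (h : ∀ t ∈ Icc (0 : ℝ) T, g t = g 0 + ∫ s in (0 : ℝ)..t, g' s) :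
    LipschitzIncrements T M g := by
  refine fun h₀ => LipschitzOnWith.of_dist_le_mul fun a ha b hb => ?_
  have hmem : ∀ {c y : ℝ}, c ∈ Icc 0 (T - h₀) → y ∈ Icc 0 (h₀ : ℝ) → c + y ∈ Icc 0 T :=
    fun hc hy => ⟨by linarith [hc.1, hy.1], by linarith [hc.2, hy.2]⟩
  have hincr : ∀ {c : ℝ}, c ∈ Icc 0 (T - h₀) →
      g (c + h₀) - g c = ∫ y in (0 : ℝ)..h₀, g' (c + y) := fun {c} hc => by
    have hc₀ : c ∈ Icc 0 T := by simpa using hmem hc ⟨le_rfl, h₀.coe_nonneg⟩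
    rw [sub_eq_integral (hg'.continuousOn.integrableOn_Icc.mono_set Ioc_subset_Icc_self) h hc₀
      (hmem hc ⟨h₀.coe_nonneg, le_rfl⟩), intervalIntegral.integral_comp_add_left, add_zero]
  have hinteg : ∀ {c : ℝ}, c ∈ Icc 0 (T - h₀) →
      IntervalIntegrable (fun y => g' (c + y)) volume 0 h₀ := fun hc => by
    refine ContinuousOn.intervalIntegrable ?_
    rw [uIcc_of_le h₀.coe_nonneg]
    exact hg'.continuousOn.comp (by fun_prop) fun y hy => hmem hc hy
  rw [dist_eq_norm, hincr ha, hincr hb, ← intervalIntegral.integral_sub (hinteg ha) (hinteg hb)]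
  have hbound : ∀ y ∈ uIoc 0 (h₀ : ℝ), ‖g' (a + y) - g' (b + y)‖ ≤ M * dist a b := fun y hy => by
    rw [uIoc_of_le h₀.coe_nonneg] at hy
    simpa [Real.dist_eq] using hg'.norm_sub_le (hmem ha (Ioc_subset_Icc_self hy))
      (hmem hb (Ioc_subset_Icc_self hy))
  refine (intervalIntegral.norm_integral_le_of_norm_le_const hbound).trans_eq ?_
  rw [sub_zero, abs_of_nonneg h₀.coe_nonneg, NNReal.coe_mul]
  ring

lemma MemWInf.exists_lipschitzIncrements (hg : MemWInf T 2 g) :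
    ∃ M, LipschitzOnWith M g (Icc 0 T) ∧ LipschitzIncrements T M g := by
  obtain ⟨M, hM⟩ := hg.of_succ.exists_lipschitzOnWith
  obtain ⟨g', hg', hint⟩ := hg
  obtain ⟨M', hM'⟩ := hg'.exists_lipschitzOnWith
  exact ⟨max M M', hM.weaken (le_max_left _ _),
    lipschitzIncrements_of_eq_integral (hM'.weaken (le_max_right _ _)) hint⟩

variable {r : ℝ → E} {m h : ℝ}

lemma LipschitzIncrements.norm_second_difference_le (hr : LipschitzIncrements T M r) (hh : 0 ≤ h)
    (hm : h ≤ m) (hmT : m + h ≤ T) : ‖r (m + h) + r (m - h) - (2 : ℝ) • r m‖ ≤ M * h ^ 2 := by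
  have hdiff := hr.norm_sub_le (a := m) (b := m - h) hh (hh.trans hm) hmT (sub_nonneg.2 hm)
    (by linarith)
  rw [sub_add_cancel, sub_sub_cancel, abs_of_nonneg hh, mul_assoc, ← pow_two] at hdiff
  convert hdiff using 2
  module

lemma hasDerivAt_symmetric_difference (hp : HasDerivAt g (r (m + h)) (m + h))
    (hm : HasDerivAt g (r (m - h)) (m - h)) (c : E) :
    HasDerivAt (fun x => g (m + x) - g (m - x) - (2 * x) • c)
      (r (m + h) + r (m - h) - (2 : ℝ) • c) h := by
  have hlin : HasDerivAt (fun x : ℝ => (2 * x) • c) ((2 : ℝ) • c) h := by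
    simpa using ((hasDerivAt_id h).const_mul (2 : ℝ)).smul_const c
  exact (((hp.comp_const_add m h).sub (hm.comp_const_sub m h)).sub hlin).congr_deriv
    (by rw [sub_neg_eq_add])

lemma norm_midpoint_error_le (hg : ContinuousOn g (Icc 0 T)) (hr : LipschitzIncrements T M r)
    (hd : ∀ s ∈ Ioo 0 T, HasDerivAt g (r s) s) (hh : 0 ≤ h) (hm : h ≤ m) (hmT : m + h ≤ T) :
    ‖g (m + h) - g (m - h) - (2 * h) • r m‖ ≤ M * h ^ 3 := by
  have hcont : ContinuousOn (fun x => g (m + x) - g (m - x) - (2 * x) • r m) (Icc 0 h) := by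
    refine ((hg.comp (by fun_prop) fun x hx => ?_).sub (hg.comp (by fun_prop) fun x hx => ?_)).sub
      (by fun_prop)
    all_goals exact ⟨by linarith [hx.1, hx.2], by linarith [hx.1, hx.2]⟩
  have hderiv : ∀ x ∈ Ico 0 h, HasDerivWithinAt
      (fun x => g (m + x) - g (m - x) - (2 * x) • r m)
      (r (m + x) + r (m - x) - (2 : ℝ) • r m) (Ici x) x := fun x hx =>
    (hasDerivAt_symmetric_difference (hd _ ⟨by linarith [hx.1, hx.2], by linarith [hx.2]⟩)
      (hd _ ⟨by linarith [hx.2], by linarith [hx.1, hx.2]⟩) (r m)).hasDerivWithinAt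
  have hbound : ∀ x ∈ Ico 0 h, ‖r (m + x) + r (m - x) - (2 : ℝ) • r m‖ ≤ M * h ^ 2 :=
    fun x hx => (hr.norm_second_difference_le hx.1 (hx.2.le.trans hm) (by linarith [hx.2])).trans
      (by gcongr; exacts [hx.1, hx.2.le])
  have hmean := norm_image_sub_le_of_norm_deriv_right_le_segment hcont hderiv hbound h ⟨hh, le_rfl⟩
  simp only [add_zero, sub_zero, sub_self, mul_zero, zero_smul] at hmean
  exact hmean.trans_eq (by ring)

end Time

/-! ### Consistency -/

section Consistency

open Set
open scoped NNReal

lemma sum_eq_empty_add_singleton_add_two_le_card {ι M : Type*} [Fintype ι] [AddCommMonoid M]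
    (F : Finset ι → M) :
    ∑ S, F S = F ∅ + ∑ j, F {j} + ∑ S with 2 ≤ S.card, F S := by
  classical
  have hsmall : (Finset.univ.filter fun S : Finset ι => ¬ 2 ≤ S.card) =
      insert ∅ (Finset.univ.image fun j : ι => ({j} : Finset ι)) := by
    ext S
    simp only [Finset.mem_filter_univ, Finset.mem_insert, Finset.mem_image, Finset.mem_univ,
      true_and, not_le, Nat.lt_succ_iff, Nat.le_one_iff_eq_zero_or_eq_one, Finset.card_eq_zero,
      Finset.card_eq_one, eq_comm (a := S)]
  rw [← Finset.sum_filter_not_add_sum_filter Finset.univ (fun S : Finset ι => 2 ≤ S.card), hsmall,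
    Finset.sum_insert (by simp), Finset.sum_image Finset.singleton_injective.injOn]

variable {E ι : Type*} [NormedAddCommGroup E] [NormedSpace ℝ E] [Fintype ι]

lemma sum_neg_pow_card_smul (a : ℝ) (F : Finset ι → E) :
    ∑ S, (-a) ^ S.card • F S =
      F ∅ - a • ∑ j, F {j} + ∑ S with 2 ≤ S.card, (-a) ^ S.card • F S := by
  simp only [sum_eq_empty_add_singleton_add_two_le_card, Finset.card_empty, pow_zero, one_smul,
    Finset.card_singleton, pow_one, neg_smul, Finset.sum_neg_distrib, Finset.smul_sum,
    sub_eq_add_neg]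

lemma norm_sum_two_le_card_le {h T : ℝ} (hh : 0 ≤ h) (hT : h ≤ T) {F : Finset ι → E}
    {M : Finset ι → ℝ≥0} (hF : ∀ S, ‖F S‖ ≤ M S * (2 * h)) :
    ‖∑ S with 2 ≤ S.card, (-h) ^ S.card • F S‖ ≤
      (∑ S : Finset ι with 2 ≤ S.card, 2 * M S * T ^ (S.card - 2)) * h ^ 3 := by
  have hT₀ : 0 ≤ T := hh.trans hT
  rw [Finset.sum_mul]
  refine norm_sum_le_of_le _ fun S hS => ?_
  have hcard : 2 ≤ S.card := (Finset.mem_filter.1 hS).2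
  rw [norm_smul, norm_pow, norm_neg, Real.norm_of_nonneg hh]
  calc h ^ S.card * ‖F S‖ = h ^ 2 * h ^ (S.card - 2) * ‖F S‖ := by
        rw [← pow_add, Nat.add_sub_cancel' hcard]
    _ ≤ h ^ 2 * T ^ (S.card - 2) * (M S * (2 * h)) := by gcongr; exact hF S
    _ = 2 * M S * T ^ (S.card - 2) * h ^ 3 := by ring

variable {T : ℝ} {W : Finset ι → ℝ → E} {q : ℝ → E} {M : Finset ι → ℝ≥0} {N : ℝ≥0}

/- If `W S` is the mixed derivative of `W ∅ = u` twice in each direction of `S`, the left-hand side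
is `∏ⱼ (1 - h ∂ⱼⱼ)` applied to the increment of `u`, so that the scheme is second order consistent
with `u' = Δ u + q`. -/
lemma exists_residual (hT : 0 ≤ T) (hW : ∀ S, LipschitzOnWith (M S) (W S) (Icc 0 T))
    (hW' : ∀ j, LipschitzIncrements T (M {j}) (W {j})) (hq : LipschitzIncrements T N q)
    (hd : ∀ s ∈ Ioo 0 T, HasDerivAt (W ∅) (∑ j, W {j} s + q s) s) :
    ∃ C, 0 ≤ C ∧ ∀ m h : ℝ, 0 < h → h ≤ m → m + h ≤ T → ∃ R : E, ‖R‖ ≤ C * h ^ 2 ∧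
      ∑ S, (-h) ^ S.card • (W S (m + h) - W S (m - h)) =
        (2 * h) • (∑ j, W {j} (m - h) + q m + R) := by
  set L : ℝ → E := fun t => ∑ j, W {j} t with hL
  have hLinc : LipschitzIncrements T (∑ j, M {j}) L := LipschitzIncrements.sum _ fun j _ => hW' j
  refine ⟨((∑ j, M {j} + N : ℝ≥0) + (∑ j, M {j} : ℝ≥0) +
    ∑ S : Finset ι with 2 ≤ S.card, 2 * M S * T ^ (S.card - 2)) / 2, by positivity,
    fun m h hh hm hmT => ?_⟩
  set midpointError : E := W ∅ (m + h) - W ∅ (m - h) - (2 * h) • (L m + q m) with hmid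
  set secondDifference : E := L (m + h) + L (m - h) - (2 : ℝ) • L m with hsecond
  set splittingError : E :=
    ∑ S with 2 ≤ S.card, (-h) ^ S.card • (W S (m + h) - W S (m - h))
  refine ⟨(2 * h)⁻¹ • (midpointError - h • secondDifference + splittingError), ?_, ?_⟩
  · have hmid_le : ‖midpointError‖ ≤ (∑ j, M {j} + N : ℝ≥0) * h ^ 3 :=
      norm_midpoint_error_le (hW ∅).continuousOn (hLinc.add hq) hd hh.le hm hmT
    have hsecond_le : ‖h • secondDifference‖ ≤ (∑ j, M {j} : ℝ≥0) * h ^ 3 := by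
      rw [norm_smul, Real.norm_of_nonneg hh.le]
      exact (mul_le_mul_of_nonneg_left (hLinc.norm_second_difference_le hh.le hm hmT)
        hh.le).trans_eq (by ring)
    have hsplit_le := norm_sum_two_le_card_le hh.le (by linarith : h ≤ T)
      (F := fun S => W S (m + h) - W S (m - h)) (M := M) fun S =>
        ((hW S).norm_sub_le ⟨by linarith, hmT⟩ ⟨sub_nonneg.2 hm, by linarith⟩).trans_eq <| by
          rw [show m + h - (m - h) = 2 * h by ring, Real.norm_of_nonneg (by positivity)]
    rw [norm_smul, norm_inv, Real.norm_of_nonneg (by positivity), inv_mul_le_iff₀ (by positivity)]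
    calc ‖midpointError - h • secondDifference + splittingError‖
        ≤ ‖midpointError‖ + ‖h • secondDifference‖ + ‖splittingError‖ :=
          (norm_add_le _ _).trans (add_le_add_left (norm_sub_le _ _) _)
      _ ≤ _ := by linarith
  · rw [sum_neg_pow_card_smul, Finset.sum_sub_distrib, smul_add _ _ (_ • _),
      smul_inv_smul₀ (by positivity)]
    simp only [hmid, hsecond, hL]
    module

end Consistency

section Regularity

open Set
open scoped NNReal

variable {d : ℕ} {T : ℝ} {f u : ℝ → Field d} {p : ℝ → L2 d}

lemma VelocityRegular.exists_mixedDeriv2 (hu : VelocityRegular T u) (i : Fin d)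
    (l : List (Fin d)) (hl : l.Nodup) :
    ∃ (w : ℝ → L2 d) (M : ℝ≥0), (∀ t ∈ Icc 0 T, HasWeakDeriv (l ++ l) (u t i) (w t)) ∧
      LipschitzOnWith M w (Icc 0 T) ∧ (l.length ≤ 1 → LipschitzIncrements T M w) := by
  rcases le_or_gt l.length 1 with hlen | hlen
  · obtain ⟨w, hw, hmem⟩ := hu.h2 i (l ++ l) (by rw [List.length_append]; lia)
    obtain ⟨M, hM, hM'⟩ := hmem.exists_lipschitzIncrements
    exact ⟨w, M, hw, hM, fun _ => hM'⟩
  · obtain ⟨w, hw, hmem⟩ := hu.dB i l hl hlen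
    obtain ⟨M, hM⟩ := hmem.exists_lipschitzOnWith
    exact ⟨w, M, hw, hM, fun h => absurd h hlen.not_ge⟩

lemma VelocityRegular.memDirichletDomain (hu : VelocityRegular T u) {t : ℝ} (ht : t ∈ Icc 0 T)
    (i : Fin d) : MemDirichletDomain (u t i) := by
  choose! w _ hw _ using hu.exists_mixedDeriv2 i
  exact .of_sinCoeff_eq_splitSymbol_mul one_pos (sinCoeff_sum_mixedDeriv2 (hu.h10 i t ht)
    (w := fun l => w l t) (fun l hl => hw l hl t ht) 1)

lemma IsStokesSolution.hasDerivAt (hsol : IsStokesSolution T f u p) {i : Fin d} {s : ℝ}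
    (hs : s ∈ Ioo 0 T) {L : Fin d → L2 d} {G : L2 d}
    (hL : ∀ j, HasWeakDeriv [j, j] (u s i) (L j)) (hG : HasWeakDeriv [i] (p s) G) :
    HasDerivAt (fun t => u t i) (∑ j, L j + (f s i - G)) s := by
  obtain ⟨L', G', ⟨D, hD, hL'⟩, hG', hd⟩ := hsol.momentum s (Ioo_subset_Ioc_self hs)
  refine ((hasDerivWithinAt_pi.1 hd i).hasDerivAt (Icc_mem_nhds hs.1 hs.2)).congr_deriv ?_
  rw [Pi.add_apply, Pi.sub_apply, hL', (hG' i).unique hG,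
    Finset.sum_congr rfl fun j _ => (hD i j).unique (hL j)]
  abel

lemma IsStokesSolution.exists_residual (hT : 0 ≤ T) (hf : ∀ i, MemWInf T 2 (fun t => f t i))
    (hsol : IsStokesSolution T f u p) (hu : VelocityRegular T u) (hp : PressureRegular T p)
    (i : Fin d) :
    ∃ C, 0 ≤ C ∧ ∀ m h : ℝ, 0 < h → h ≤ m → m + h ≤ T → ∀ G : L2 d, HasWeakDeriv [i] (p m) G →
      ∃ R : L2 d, ‖R‖ ≤ C * h ^ 2 ∧ ∀ n,
        splitSymbol h n * (sinCoeff n (u (m + h) i) - sinCoeff n (u (m - h) i)) =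
          2 * h * (-(laplaceSymbol n * sinCoeff n (u (m - h) i)) - sinCoeff n G
            + sinCoeff n (f m i) + sinCoeff n R) := by
  choose! w M hw hLip hInc using hu.exists_mixedDeriv2 i
  obtain ⟨Gp, hGp, hGmem⟩ := hp.mixed [i] (List.nodup_singleton i)
  obtain ⟨MG, -, hGinc⟩ := hGmem.exists_lipschitzIncrements
  obtain ⟨Mf, -, hfinc⟩ := (hf i).exists_lipschitzIncrements
  have hnil : ∀ t ∈ Icc 0 T, w [] t = u t i := fun t ht =>
    (hw [] List.nodup_nil t ht).unique (hasWeakDeriv_nil _)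
  have hw₁ : ∀ j, ∀ t ∈ Icc 0 T, HasWeakDeriv [j, j] (u t i) (w [j] t) := fun j =>
    hw [j] (List.nodup_singleton j)
  obtain ⟨C, hC, hres⟩ := DirectionSplitting.exists_residual hT
    (W := fun S : Finset (Fin d) => w S.toList) (q := fun t => f t i + -Gp t)
    (fun S => hLip _ S.nodup_toList) (fun j => hInc _ (Finset.nodup_toList _) (by simp))
    (hfinc.add hGinc.neg) fun s hs => by
      simp only [Finset.toList_empty, Finset.toList_singleton, ← sub_eq_add_neg]
      refine (hsol.hasDerivAt hs (fun j => hw₁ j s (Ioo_subset_Icc_self hs))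
        (hGp s (Ioo_subset_Icc_self hs))).congr_of_eventuallyEq ?_
      exact Filter.eventually_of_mem (Icc_mem_nhds hs.1 hs.2) hnil
  refine ⟨C, hC, fun m h hh hm hmT G hG => ?_⟩
  obtain ⟨R, hR, heq⟩ := hres m h hh hm hmT
  refine ⟨R, hR, fun n => ?_⟩
  have hcoeff : ∀ t ∈ Icc 0 T, _ := fun t ht => sinCoeff_sum_mixedDeriv2 (hu.h10 i t ht)
    (w := fun l => w l t) (fun l hl => hw l hl t ht) h n
  have hm₀ : m - h ∈ Icc 0 T := ⟨sub_nonneg.2 hm, by linarith⟩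
  have hcoeq := congrArg (sinCoeff n) heq
  simp only [smul_sub, Finset.sum_sub_distrib, map_sub, hcoeff _ hm₀,
    hcoeff (m + h) ⟨by linarith, hmT⟩, map_smul, map_add, map_neg, map_sum,
    Finset.toList_singleton, smul_eq_mul,
    fun j => (hu.memDirichletDomain hm₀ i).sinCoeff_deriv2 (hw₁ j _ hm₀) n,
    hG.unique (hGp m ⟨by linarith, by linarith⟩), Finset.sum_neg_distrib, neg_mul,
    ← Finset.sum_mul] at hcoeq ⊢
  rw [← mul_sub] at hcoeq
  rw [hcoeq, laplaceSymbol]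
  ring

lemma HasSqrtA.norm_le_sum {q x : L2 d} {w : List (Fin d) → L2 d} (hx : HasSqrtA q x)
    (hw : ∀ l : List (Fin d), l.Nodup → HasWeakDeriv l q (w l)) :
    ‖x‖ ≤ ∑ S : Finset (Fin d), ‖w S.toList‖ := by
  obtain ⟨x', hx', hnorm⟩ := exists_hasSqrtA_norm_sq_eq hw
  rw [hx.unique hx', ← sq_le_sq₀ (norm_nonneg _) (Finset.sum_nonneg fun _ _ => norm_nonneg _),
    hnorm]
  exact Finset.sum_sq_le_sq_sum_of_nonneg fun _ _ => norm_nonneg _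

lemma HasSqrtA.lipschitzOnWith {s : Set ℝ} {q J : ℝ → L2 d} {w : List (Fin d) → ℝ → L2 d}
    {M : List (Fin d) → ℝ≥0} (hJ : ∀ t ∈ s, HasSqrtA (q t) (J t))
    (hw : ∀ l : List (Fin d), l.Nodup → ∀ t ∈ s, HasWeakDeriv l (q t) (w l t))
    (hLip : ∀ l : List (Fin d), l.Nodup → LipschitzOnWith (M l) (w l) s) :
    LipschitzOnWith (∑ S : Finset (Fin d), M S.toList) J s := by
  refine LipschitzOnWith.of_dist_le_mul fun a ha b hb => ?_
  rw [dist_eq_norm, NNReal.coe_sum, Finset.sum_mul]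
  refine (((hJ a ha).sub (hJ b hb)).norm_le_sum
    (w := fun l => w l a - w l b) fun l hl => (hw l hl a ha).sub (hw l hl b hb)).trans
      (Finset.sum_le_sum fun S _ => ?_)
  exact (hLip _ S.nodup_toList).norm_sub_le ha hb

lemma PressureRegular.exists_hasSqrtA (hp : PressureRegular T p) :
    ∃ (J : ℝ → L2 d) (C : ℝ≥0), (∀ t ∈ Icc 0 T, HasSqrtA (p t) (J t)) ∧
      LipschitzOnWith C J (Icc 0 T) ∧ LipschitzIncrements T C J := by
  choose! w hw hmem using hp.mixed
  choose! M hLip hInc using fun l hl => (hmem l hl).exists_lipschitzIncrements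
  have hJ : ∀ t ∈ Icc 0 T, ∃ x, HasSqrtA (p t) x := fun t ht =>
    (exists_hasSqrtA_norm_sq_eq (w := fun l => w l t) fun l hl => hw l hl t ht).imp
      fun _ => And.left
  choose! J hJ using hJ
  refine ⟨J, _, hJ, HasSqrtA.lipschitzOnWith hJ hw hLip, fun h => ?_⟩
  have hmem₀ : ∀ {t : ℝ}, t ∈ Icc 0 (T - h) → t ∈ Icc 0 T ∧ t + h ∈ Icc 0 T := fun ht =>
    ⟨⟨ht.1, by linarith [ht.2, h.coe_nonneg]⟩, by linarith [ht.1, h.coe_nonneg],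
      by linarith [ht.2]⟩
  rw [Finset.sum_mul]
  exact HasSqrtA.lipschitzOnWith (q := fun t => p (t + h) - p t)
    (w := fun l t => w l (t + h) - w l t) (M := fun l => M l * h)
    (fun t ht => (hJ _ (hmem₀ ht).2).sub (hJ _ (hmem₀ ht).1))
    (fun l hl t ht => (hw l hl _ (hmem₀ ht).2).sub (hw l hl _ (hmem₀ ht).1))
    fun l hl => hInc l hl h

lemma PressureRegular.exists_hasGrad (hp : PressureRegular T p) :
    ∃ (G : ℝ → Field d) (C : ℝ≥0), (∀ t ∈ Icc 0 T, HasGrad (p t) (G t)) ∧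
      ∀ i, LipschitzOnWith C (fun t => G t i) (Icc 0 T) := by
  choose G hG hmem using fun i => hp.mixed [i] (List.nodup_singleton i)
  choose M hLip _ using fun i => (hmem i).exists_lipschitzIncrements
  exact ⟨fun t i => G i t, ∑ i, M i, fun t ht i => hG i t ht, fun i =>
    (hLip i).weaken (Finset.single_le_sum (fun _ _ => zero_le) (Finset.mem_univ i))⟩

end Regularity

/-! ### The energy identity of the error equations -/

/-- The errors of `K` steps of the scheme, with the equations and the consistency bounds that enter
the error estimate. Here `err k` is the velocity error at time `kτ` with gradient
`grad k i j = ∂ᵢ (err k)ⱼ`, and `pressureErr k` is the error of the predicted pressure in step `k`.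
The three sequences of pressure increments carry a factor `τ A^{1/2}`: `discreteIncr k` stands for
`φ^{k-1/2}`, `exactIncr k` for `p(t_k) - p(t_{k-1})` and `midpointIncr k` for
`p(t_{k+3/2}) - p(t_{k+1/2})`. The initial guess `φ^{-1/2}` is replaced by `0`; the pressure
gradient that it contributes to the first step is part of `residual 0`. -/
structure ErrorSystem (d K : ℕ) (τ χ C : ℝ) where
  err : ℕ → Field d
  grad : ℕ → Fin d → Field d
  discreteIncr : ℕ → L2 d
  exactIncr : ℕ → L2 d
  midpointIncr : ℕ → L2 d
  pressureErr : ℕ → L2 d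
  pressureGrad : ℕ → Field d
  residual : ℕ → Field d
  err_zero : err 0 = 0
  memDirichletDomain : ∀ k ≤ K, ∀ i, MemDirichletDomain (err k i)
  zeroTrace : ∀ k ≤ K, ∀ i j, HasWeakDerivZeroTrace i (err k j) (grad k i j)
  hasGrad : ∀ k < K, HasGrad (pressureErr k) (pressureGrad k)
  momentum : ∀ k < K, ∀ i n,
    splitSymbol (τ / 2) n * (sinCoeff n (err (k + 1) i) - sinCoeff n (err k i)) =
      τ * (-(laplaceSymbol n * sinCoeff n (err k i)) - sinCoeff n (pressureGrad k i) +
        sinCoeff n (residual k i))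
  penalty : ∀ k ≤ K, HasSqrtA (discreteIncr k) (∑ i, grad k i i)
  pressure_update : ∀ k, k + 1 < K →
    HasSqrtA (τ • (pressureErr (k + 1) - pressureErr k +
        (χ / 2) • (∑ i, grad (k + 1) i i + ∑ i, grad k i i)))
      (midpointIncr k - (2 : ℝ) • discreteIncr (k + 1) + discreteIncr k)
  norm_residual_le : ∀ k < K, ∀ i,
    ‖residual k i‖ ≤ C * τ ^ 2 + if k = 0 then C * τ else 0
  norm_pressureGrad_zero_le : ∀ i, ‖pressureGrad 0 i‖ ≤ C * τ
  norm_exactIncr_le : ∀ k ≤ K, ‖exactIncr k‖ ≤ C * τ ^ 2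
  norm_exactIncr_sub_le : ∀ k < K, ‖exactIncr (k + 1) - exactIncr k‖ ≤ C * τ ^ 3
  norm_midpointIncr_sub_le : ∀ k, k + 1 < K →
    ‖midpointIncr k - ((2 : ℝ) • exactIncr (k + 1) - exactIncr k)‖ ≤ C * τ ^ 3

namespace ErrorSystem

variable {d K k : ℕ} {τ χ C : ℝ} (s : ErrorSystem d K τ χ C)

/-- The divergence of the velocity error. -/
def divErr (k : ℕ) : L2 d := ∑ i, s.grad k i i

/-- The increment `e^{k+1} - e^k` of the velocity error. -/
def errIncr (k : ℕ) : Field d := s.err (k + 1) - s.err k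

/-- The error of the scaled pressure increment. -/
def incrErr (k : ℕ) : L2 d := s.exactIncr k - s.discreteIncr k

lemma memDirichletDomain_sub {j k : ℕ} (hj : j ≤ K) (hk : k ≤ K) (i : Fin d) :
    MemDirichletDomain ((s.err j - s.err k) i) :=
  (s.memDirichletDomain j hj i).sub (s.memDirichletDomain k hk i)

lemma zeroTrace_sub {j k : ℕ} (hj : j ≤ K) (hk : k ≤ K) (i l : Fin d) :
    HasWeakDerivZeroTrace i ((s.err j - s.err k) l) ((s.grad j - s.grad k) i l) :=
  (s.zeroTrace j hj i l).sub (s.zeroTrace k hk i l)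

lemma sum_grad_sub (j k : ℕ) :
    ∑ i, (s.grad j - s.grad k) i i = s.divErr j - s.divErr k := by
  simp only [Pi.sub_apply, Finset.sum_sub_distrib, divErr]

lemma sum_dirichletEnergy_sub_eq {j k : ℕ} (hj : j ≤ K) (hk : k ≤ K) :
    ∑ i, dirichletEnergy ((s.err j - s.err k) i) =
      ‖s.divErr j - s.divErr k‖ ^ 2 + curlSq (s.grad j - s.grad k) := by
  rw [sum_dirichletEnergy_eq (s.memDirichletDomain_sub hj hk) (s.zeroTrace_sub hj hk),
    sum_grad_sub]

lemma norm_sq_discreteIncr_le (hk : k ≤ K) :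
    ‖s.discreteIncr k‖ ^ 2 ≤ ∑ i, ‖s.err k i‖ ^ 2 :=
  HasSqrtA.norm_sq_le_of_div (fun i => s.zeroTrace k hk i i) (s.penalty k hk)

lemma discreteIncr_zero : s.discreteIncr 0 = 0 := by
  have hle := s.norm_sq_discreteIncr_le (Nat.zero_le K)
  simp only [s.err_zero, Pi.zero_apply, norm_zero, ne_eq, OfNat.ofNat_ne_zero, not_false_eq_true,
    zero_pow, Finset.sum_const_zero] at hle
  exact norm_eq_zero.1 (pow_eq_zero_iff two_ne_zero |>.1 (hle.antisymm (sq_nonneg _)))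

lemma divErr_zero : s.divErr 0 = 0 := by
  have hpenalty := s.penalty 0 (Nat.zero_le K)
  rw [s.discreteIncr_zero] at hpenalty
  exact hpenalty.unique HasSqrtA.zero

lemma norm_sq_discreteIncr_second_difference_le (hk : k + 1 < K) :
    ‖s.discreteIncr (k + 2) - (2 : ℝ) • s.discreteIncr (k + 1) + s.discreteIncr k‖ ^ 2 ≤
      ∑ i, ‖s.errIncr (k + 1) i - s.errIncr k i‖ ^ 2 := by
  have hincr : ∀ i, HasWeakDerivZeroTrace i (s.errIncr (k + 1) i - s.errIncr k i)
      ((s.grad (k + 2) - s.grad (k + 1)) i i - (s.grad (k + 1) - s.grad k) i i) := fun i =>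
    (s.zeroTrace_sub hk hk.le i i).sub (s.zeroTrace_sub hk.le (by lia) i i)
  refine HasSqrtA.norm_sq_le_of_div hincr ?_
  have hsqrt := ((s.penalty (k + 2) hk).sub ((s.penalty (k + 1) hk.le).smul 2)).add
    (s.penalty k (by lia))
  rw [Finset.sum_sub_distrib, sum_grad_sub, sum_grad_sub]
  convert hsqrt using 1
  simp only [divErr]
  module

/-- The energy of the error after step `k`. -/
def energy (k : ℕ) : ℝ :=
  ∑ i, splitEnergy (τ / 2) (s.errIncr k i) + ‖s.incrErr (k + 1)‖ ^ 2 +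
    χ * τ * ‖s.divErr (k + 1)‖ ^ 2 - χ * τ / 2 * ‖s.divErr (k + 1) - s.divErr k‖ ^ 2

lemma sum_norm_sq_errIncr_add_le (hτ : 0 < τ) (hk : k < K) :
    ∑ i, ‖s.errIncr k i‖ ^ 2 + τ / 2 * (‖s.divErr (k + 1) - s.divErr k‖ ^ 2 +
        curlSq (s.grad (k + 1) - s.grad k)) ≤ ∑ i, splitEnergy (τ / 2) (s.errIncr k i) := by
  rw [← s.sum_dirichletEnergy_sub_eq hk hk.le, Finset.mul_sum, ← Finset.sum_add_distrib]
  exact Finset.sum_le_sum fun i _ =>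
    norm_sq_add_dirichletEnergy_le (half_pos hτ) (s.memDirichletDomain_sub hk hk.le i)

lemma le_energy (hτ : 0 < τ) (hχ : χ ≤ 1) (hk : k < K) :
    ∑ i, ‖s.errIncr k i‖ ^ 2 + τ / 2 * curlSq (s.grad (k + 1) - s.grad k) +
      ‖s.incrErr (k + 1)‖ ^ 2 + χ * τ * ‖s.divErr (k + 1)‖ ^ 2 ≤ s.energy k := by
  have hsplit := s.sum_norm_sq_errIncr_add_le hτ hk
  have hdiv : χ * τ / 2 * ‖s.divErr (k + 1) - s.divErr k‖ ^ 2 ≤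
      τ / 2 * ‖s.divErr (k + 1) - s.divErr k‖ ^ 2 := by
    gcongr
    exact mul_le_of_le_one_left hτ.le hχ
  rw [energy]
  linarith

lemma splitEnergy_errIncr_sub_add_le (hτ : 0 < τ) (hk : k + 1 < K) (i : Fin d) :
    splitEnergy (τ / 2) (s.errIncr (k + 1) i) - splitEnergy (τ / 2) (s.errIncr k i) +
        ‖s.errIncr (k + 1) i - s.errIncr k i‖ ^ 2 +
        τ / 2 * dirichletEnergy ((s.err (k + 2) - s.err k) i) ≤
      2 * τ * inner ℝ (s.residual (k + 1) i - s.residual k i) (s.errIncr (k + 1) i) -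
        2 * τ * inner ℝ (s.pressureGrad (k + 1) i - s.pressureGrad k i)
          (s.errIncr (k + 1) i) := by
  have hsum : (s.err (k + 2) - s.err k) i = s.errIncr (k + 1) i + s.errIncr k i := by
    simp only [errIncr, Pi.sub_apply, sub_add_sub_cancel]
  rw [hsum]
  refine (splitEnergy_sub_add_le hτ (v := s.errIncr (k + 1) i) (w := s.errIncr k i)
    (s.memDirichletDomain_sub hk hk.le i) (s.memDirichletDomain_sub hk.le (by lia) i)
    (z := τ • (s.residual (k + 1) i - s.residual k i -
      (s.pressureGrad (k + 1) i - s.pressureGrad k i))) fun n => ?_).trans_eq ?_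
  · simp only [errIncr, Pi.sub_apply, map_smul, map_sub, smul_eq_mul]
    linear_combination s.momentum k (by lia) i n - s.momentum (k + 1) hk i n
  · rw [real_inner_smul_left, inner_sub_left]
    ring

lemma sum_inner_pressureGrad_sub_eq (hk : k + 1 < K) :
    ∑ i, inner ℝ (s.pressureGrad (k + 1) i - s.pressureGrad k i) (s.errIncr (k + 1) i) =
      -inner ℝ (s.pressureErr (k + 1) - s.pressureErr k)
        (s.divErr (k + 2) - s.divErr (k + 1)) := by
  rw [← s.sum_grad_sub, inner_sum, ← Finset.sum_neg_distrib]
  exact Finset.sum_congr rfl fun i _ =>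
    ((s.hasGrad (k + 1) hk i).sub (s.hasGrad k (by lia) i)).inner_eq_neg_inner
      (s.zeroTrace_sub hk hk.le i i)

lemma inner_pressureErr_sub_eq (hk : k + 1 < K) :
    2 * τ * inner ℝ (s.pressureErr (k + 1) - s.pressureErr k)
        (s.divErr (k + 2) - s.divErr (k + 1)) =
      2 * inner ℝ (s.midpointIncr k - (2 : ℝ) • s.discreteIncr (k + 1) + s.discreteIncr k)
          (s.discreteIncr (k + 2) - s.discreteIncr (k + 1)) -
        χ * τ * inner ℝ (s.divErr (k + 1) + s.divErr k)
          (s.divErr (k + 2) - s.divErr (k + 1)) := by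
  have hpair : inner ℝ (τ • (s.pressureErr (k + 1) - s.pressureErr k +
        (χ / 2) • (s.divErr (k + 1) + s.divErr k))) (s.divErr (k + 2) - s.divErr (k + 1)) = _ :=
    (s.pressure_update k hk).inner_comm ((s.penalty (k + 2) hk).sub (s.penalty (k + 1) hk.le))
  rw [← mul_right_inj' two_ne_zero, real_inner_smul_left, inner_add_left,
    real_inner_smul_left] at hpair
  linarith

lemma sum_splitEnergy_step_le (hτ : 0 < τ) (hk : k + 1 < K) :
    ∑ i, splitEnergy (τ / 2) (s.errIncr (k + 1) i) - ∑ i, splitEnergy (τ / 2) (s.errIncr k i) +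
        ∑ i, ‖s.errIncr (k + 1) i - s.errIncr k i‖ ^ 2 +
        τ / 2 * (‖s.divErr (k + 2) - s.divErr k‖ ^ 2 + curlSq (s.grad (k + 2) - s.grad k)) ≤
      2 * τ * ∑ i, inner ℝ (s.residual (k + 1) i - s.residual k i) (s.errIncr (k + 1) i) +
        2 * inner ℝ (s.midpointIncr k - (2 : ℝ) • s.discreteIncr (k + 1) + s.discreteIncr k)
          (s.discreteIncr (k + 2) - s.discreteIncr (k + 1)) -
        χ * τ * inner ℝ (s.divErr (k + 1) + s.divErr k)
          (s.divErr (k + 2) - s.divErr (k + 1)) := by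
  have hsum := Finset.sum_le_sum fun i (_ : i ∈ Finset.univ) =>
    s.splitEnergy_errIncr_sub_add_le hτ hk i
  simp only [Finset.sum_add_distrib, Finset.sum_sub_distrib, ← Finset.mul_sum] at hsum
  rw [s.sum_inner_pressureGrad_sub_eq hk, s.sum_dirichletEnergy_sub_eq hk (by lia)] at hsum
  linarith [s.inner_pressureErr_sub_eq hk]

end ErrorSystem

/-! ### The energy estimate -/

section Hilbert

variable {H : Type*} [NormedAddCommGroup H] [InnerProductSpace ℝ H]

lemma two_mul_inner_add_sub_eq (D₀ D₁ D₂ : H) : 2 * inner ℝ (D₁ + D₀) (D₂ - D₁) =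
    2 * (‖D₂‖ ^ 2 - ‖D₁‖ ^ 2) - ‖D₂ - D₀‖ ^ 2 - (‖D₂ - D₁‖ ^ 2 - ‖D₁ - D₀‖ ^ 2) := by
  simp only [norm_sub_sq_real, inner_add_left, inner_sub_right, real_inner_self_eq_norm_sq]
  rw [real_inner_comm D₂ D₀, real_inner_comm D₂ D₁, real_inner_comm D₁ D₀]
  ring

lemma two_mul_inner_extrapolation_sub_eq (Q₀ Q₁ Q₂ : H) :
    2 * inner ℝ ((2 : ℝ) • Q₁ - Q₀) (Q₂ - Q₁) =
      ‖Q₂‖ ^ 2 - ‖Q₁‖ ^ 2 + ‖Q₁ - Q₀‖ ^ 2 - ‖Q₂ - (2 : ℝ) • Q₁ + Q₀‖ ^ 2 := by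
  have hdiff : Q₂ - (2 : ℝ) • Q₁ + Q₀ = (Q₂ - Q₁) - (Q₁ - Q₀) := by module
  rw [hdiff, norm_sub_sq_real (Q₂ - Q₁)]
  simp only [norm_sub_sq_real, inner_sub_left, inner_sub_right, real_inner_smul_left,
    real_inner_self_eq_norm_sq]
  rw [real_inner_comm Q₂ Q₀, real_inner_comm Q₂ Q₁, real_inner_comm Q₁ Q₀]
  ring

lemma two_mul_inner_add_extrapolation_le {ε S : ℝ} {Q₀ Q₁ Q₂ ρ σ : H} (hρ : ‖ρ‖ ≤ ε)
    (hσ : ‖σ‖ ≤ ε) (h₀ : ‖Q₀‖ ≤ S) (h₁ : ‖Q₁‖ ≤ S) (h₂ : ‖Q₂‖ ≤ S) :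
    2 * inner ℝ (ρ + ((2 : ℝ) • Q₁ - Q₀)) (σ - (Q₂ - Q₁)) ≤
      ‖Q₁‖ ^ 2 - ‖Q₂‖ ^ 2 + ‖Q₂ - (2 : ℝ) • Q₁ + Q₀‖ ^ 2 + 10 * ε * S + 2 * ε ^ 2 := by
  have hε : 0 ≤ ε := (norm_nonneg ρ).trans hρ
  have hρσ : inner ℝ ρ σ ≤ ε * ε :=
    (real_inner_le_norm _ _).trans (mul_le_mul hρ hσ (norm_nonneg _) hε)
  have hρQ : inner ℝ ρ (Q₁ - Q₂) ≤ ε * (S + S) :=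
    (real_inner_le_norm _ _).trans
      (mul_le_mul hρ ((norm_sub_le _ _).trans (add_le_add h₁ h₂)) (norm_nonneg _) hε)
  have hextrapolation : ‖(2 : ℝ) • Q₁ - Q₀‖ ≤ 2 * S + S := by
    refine (norm_sub_le _ _).trans (add_le_add ?_ h₀)
    rw [norm_smul, Real.norm_ofNat]
    gcongr
  have hQσ : inner ℝ ((2 : ℝ) • Q₁ - Q₀) σ ≤ (2 * S + S) * ε :=
    (real_inner_le_norm _ _).trans
      (mul_le_mul hextrapolation hσ (norm_nonneg _) ((norm_nonneg _).trans hextrapolation))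
  have hexpand : inner ℝ (ρ + ((2 : ℝ) • Q₁ - Q₀)) (σ - (Q₂ - Q₁)) =
      inner ℝ ρ σ + inner ℝ ρ (Q₁ - Q₂) + inner ℝ ((2 : ℝ) • Q₁ - Q₀) σ -
        inner ℝ ((2 : ℝ) • Q₁ - Q₀) (Q₂ - Q₁) := by
    rw [inner_add_left, inner_sub_right, inner_sub_right _ σ, ← neg_sub Q₂ Q₁, inner_neg_right]
    ring
  rw [hexpand]
  linarith [two_mul_inner_extrapolation_sub_eq Q₀ Q₁ Q₂, sq_nonneg ‖Q₁ - Q₀‖]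

lemma two_mul_inner_second_difference_le {ε S A : ℝ} {X₀ X₁ X₂ P₀ P₁ P₂ ν : H}
    (hP₁ : ‖P₁ - P₀‖ ≤ ε) (hP₂ : ‖P₂ - P₁‖ ≤ ε) (hν : ‖ν - ((2 : ℝ) • P₁ - P₀)‖ ≤ ε)
    (h₀ : ‖P₀ - X₀‖ ≤ S) (h₁ : ‖P₁ - X₁‖ ≤ S) (h₂ : ‖P₂ - X₂‖ ≤ S)
    (hX : ‖X₂ - (2 : ℝ) • X₁ + X₀‖ ≤ A) :
    2 * inner ℝ (ν - (2 : ℝ) • X₁ + X₀) (X₂ - X₁) ≤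
      ‖P₁ - X₁‖ ^ 2 - ‖P₂ - X₂‖ ^ 2 + A ^ 2 + 4 * ε * A + 10 * ε * S + 6 * ε ^ 2 := by
  have hQ : ‖P₂ - X₂ - (2 : ℝ) • (P₁ - X₁) + (P₀ - X₀)‖ ≤ (ε + ε) + A := by
    have hsplit : P₂ - X₂ - (2 : ℝ) • (P₁ - X₁) + (P₀ - X₀) =
        ((P₂ - P₁) - (P₁ - P₀)) - (X₂ - (2 : ℝ) • X₁ + X₀) := by module
    rw [hsplit]
    exact (norm_sub_le _ _).trans
      (add_le_add ((norm_sub_le _ _).trans (add_le_add hP₂ hP₁)) hX)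
  have hle := two_mul_inner_add_extrapolation_le hν hP₂ h₀ h₁ h₂
  have hleft : ν - ((2 : ℝ) • P₁ - P₀) + ((2 : ℝ) • (P₁ - X₁) - (P₀ - X₀)) =
      ν - (2 : ℝ) • X₁ + X₀ := by module
  have hright : P₂ - P₁ - (P₂ - X₂ - (P₁ - X₁)) = X₂ - X₁ := by abel
  rw [hleft, hright] at hle
  linarith [pow_le_pow_left₀ (norm_nonneg _) hQ 2]

lemma norm_sub_sq_le_two_mul (x y : H) : ‖x - y‖ ^ 2 ≤ 2 * ‖x‖ ^ 2 + 2 * ‖y‖ ^ 2 := by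
  linarith [parallelogram_law_with_norm ℝ x y, mul_self_nonneg ‖x + y‖, sq ‖x - y‖, sq ‖x‖,
    sq ‖y‖]

lemma sum_inner_le_card_mul {ι : Type*} [Fintype ι] {v w : ι → H} {a b : ℝ} (hb : 0 ≤ b)
    (hv : ∀ i, ‖v i‖ ≤ a) (hw : ∑ i, ‖w i‖ ^ 2 ≤ b ^ 2) :
    ∑ i, inner ℝ (v i) (w i) ≤ Fintype.card ι * (a * b) := by
  have hwi (i : ι) : ‖w i‖ ≤ b :=
    (sq_le_sq₀ (norm_nonneg _) hb).1 ((Finset.single_le_sum (f := fun i => ‖w i‖ ^ 2)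
      (fun j _ => sq_nonneg _) (Finset.mem_univ i)).trans hw)
  have hsum := Finset.sum_le_card_nsmul Finset.univ (fun i => inner ℝ (v i) (w i)) (a * b)
    fun i _ => (real_inner_le_norm _ _).trans
      (mul_le_mul (hv i) (hwi i) (norm_nonneg _) ((norm_nonneg _).trans (hv i)))
  rwa [Finset.card_univ, nsmul_eq_mul] at hsum

end Hilbert

namespace ErrorSystem

variable {d K k : ℕ} {τ χ C S T : ℝ} (s : ErrorSystem d K τ χ C)

lemma sum_norm_sq_errIncr_le_energy (hτ : 0 < τ) (hχ₀ : 0 ≤ χ) (hχ₁ : χ ≤ 1) (hk : k < K) :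
    ∑ i, ‖s.errIncr k i‖ ^ 2 ≤ s.energy k := by
  have hcurl := mul_nonneg (half_pos hτ).le (curlSq_nonneg (s.grad (k + 1) - s.grad k))
  have hdiv : 0 ≤ χ * τ * ‖s.divErr (k + 1)‖ ^ 2 := by positivity
  linarith [s.le_energy hτ hχ₁ hk, sq_nonneg ‖s.incrErr (k + 1)‖]

lemma norm_sq_incrErr_le_energy (hτ : 0 < τ) (hχ₀ : 0 ≤ χ) (hχ₁ : χ ≤ 1) (hk : k < K) :
    ‖s.incrErr (k + 1)‖ ^ 2 ≤ s.energy k := by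
  have hcurl := mul_nonneg (half_pos hτ).le (curlSq_nonneg (s.grad (k + 1) - s.grad k))
  have hdiv : 0 ≤ χ * τ * ‖s.divErr (k + 1)‖ ^ 2 := by positivity
  have herr : 0 ≤ ∑ i, ‖s.errIncr k i‖ ^ 2 := Finset.sum_nonneg fun _ _ => sq_nonneg _
  linarith [s.le_energy hτ hχ₁ hk]

lemma norm_incrErr_le (hτ : 0 < τ) (hχ₀ : 0 ≤ χ) (hχ₁ : χ ≤ 1) (hS : 0 ≤ S)
    (hzero : ‖s.incrErr 0‖ ≤ S) (henergy : ∀ k < K, s.energy k ≤ S ^ 2) :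
    ∀ k ≤ K, ‖s.incrErr k‖ ≤ S
  | 0, _ => hzero
  | k + 1, hk => (sq_le_sq₀ (norm_nonneg _) hS).1
      ((s.norm_sq_incrErr_le_energy hτ hχ₀ hχ₁ hk).trans (henergy k hk))

lemma sum_norm_sq_errIncr_sub_le (hτ : 0 < τ) (hχ₀ : 0 ≤ χ) (hχ₁ : χ ≤ 1)
    (henergy : ∀ k < K, s.energy k ≤ S ^ 2) (hk : k + 1 < K) :
    ∑ i, ‖s.errIncr (k + 1) i - s.errIncr k i‖ ^ 2 ≤ (2 * S) ^ 2 := by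
  have hincr : ∀ j < K, ∑ i, ‖s.errIncr j i‖ ^ 2 ≤ S ^ 2 := fun j hj =>
    (s.sum_norm_sq_errIncr_le_energy hτ hχ₀ hχ₁ hj).trans (henergy j hj)
  have hsum := Finset.sum_le_sum fun i (_ : i ∈ Finset.univ) =>
    norm_sub_sq_le_two_mul (s.errIncr (k + 1) i) (s.errIncr k i)
  rw [Finset.sum_add_distrib, ← Finset.mul_sum, ← Finset.mul_sum] at hsum
  linarith [hincr (k + 1) hk, hincr k (by lia)]

lemma sum_inner_residual_sub_le (hS : 0 ≤ S) (hk : k + 1 < K)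
    (hincr : ∑ i, ‖s.errIncr (k + 1) i‖ ^ 2 ≤ S ^ 2) :
    ∑ i, inner ℝ (s.residual (k + 1) i - s.residual k i) (s.errIncr (k + 1) i) ≤
      d * ((2 * (C * τ ^ 2) + if k = 0 then C * τ else 0) * S) := by
  have hresidual (i : Fin d) : ‖s.residual (k + 1) i - s.residual k i‖ ≤
      2 * (C * τ ^ 2) + if k = 0 then C * τ else 0 := by
    have hsucc := s.norm_residual_le (k + 1) hk i
    rw [if_neg k.succ_ne_zero] at hsucc
    linarith [norm_sub_le (s.residual (k + 1) i) (s.residual k i),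
      s.norm_residual_le k (by lia) i]
  simpa only [Fintype.card_fin] using sum_inner_le_card_mul hS hresidual hincr

lemma two_mul_inner_discreteIncr_sub_le (hτ : 0 < τ) (hχ₀ : 0 ≤ χ) (hχ₁ : χ ≤ 1) (hS : 0 ≤ S)
    (hzero : ‖s.incrErr 0‖ ≤ S) (henergy : ∀ k < K, s.energy k ≤ S ^ 2) (hk : k + 1 < K) :
    2 * inner ℝ (s.midpointIncr k - (2 : ℝ) • s.discreteIncr (k + 1) + s.discreteIncr k)
        (s.discreteIncr (k + 2) - s.discreteIncr (k + 1)) ≤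
      ‖s.incrErr (k + 1)‖ ^ 2 - ‖s.incrErr (k + 2)‖ ^ 2 +
        ∑ i, ‖s.errIncr (k + 1) i - s.errIncr k i‖ ^ 2 + 18 * C * τ ^ 3 * S +
        6 * C ^ 2 * τ ^ 6 := by
  set A := √(∑ i, ‖s.errIncr (k + 1) i - s.errIncr k i‖ ^ 2)
  have hAsq : A ^ 2 = ∑ i, ‖s.errIncr (k + 1) i - s.errIncr k i‖ ^ 2 :=
    Real.sq_sqrt (Finset.sum_nonneg fun _ _ => sq_nonneg _)
  have hAS : A ≤ 2 * S :=
    Real.sqrt_le_left (by positivity) |>.mpr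
      (s.sum_norm_sq_errIncr_sub_le hτ hχ₀ hχ₁ henergy hk)
  have hX : ‖s.discreteIncr (k + 2) - (2 : ℝ) • s.discreteIncr (k + 1) + s.discreteIncr k‖ ≤ A :=
    Real.le_sqrt_of_sq_le (s.norm_sq_discreteIncr_second_difference_le hk)
  have hincrErr := s.norm_incrErr_le hτ hχ₀ hχ₁ hS hzero henergy
  have hP := s.norm_exactIncr_sub_le k (by lia)
  have hle := two_mul_inner_second_difference_le hP (s.norm_exactIncr_sub_le (k + 1) hk)
    (s.norm_midpointIncr_sub_le k hk) (hincrErr k (by lia)) (hincrErr (k + 1) hk.le)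
    (hincrErr (k + 2) hk) hX
  have hεA := mul_le_mul_of_nonneg_left hAS ((norm_nonneg _).trans hP)
  rw [hAsq] at hle
  unfold incrErr
  linarith

lemma energy_step_le (hτ : 0 < τ) (hχ₀ : 0 ≤ χ) (hχ₁ : χ ≤ 1) (hS : 0 ≤ S)
    (hzero : ‖s.incrErr 0‖ ≤ S) (henergy : ∀ k < K, s.energy k ≤ S ^ 2) (hk : k + 1 < K) :
    s.energy (k + 1) + τ / 2 * curlSq (s.grad (k + 2) - s.grad k) ≤
      s.energy k + (((4 * d + 18) * C * τ ^ 3 * S + 6 * C ^ 2 * τ ^ 6) +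
        if k = 0 then 2 * d * C * τ ^ 2 * S else 0) := by
  have hresidual := mul_le_mul_of_nonneg_left (s.sum_inner_residual_sub_le hS hk
    ((s.sum_norm_sq_errIncr_le_energy hτ hχ₀ hχ₁ hk).trans (henergy _ hk)))
    (by positivity : 0 ≤ 2 * τ)
  have hconst : 2 * τ * (d * ((2 * (C * τ ^ 2) + if k = 0 then C * τ else 0) * S)) =
      4 * d * C * τ ^ 3 * S + if k = 0 then 2 * d * C * τ ^ 2 * S else 0 := by
    split_ifs <;> ring
  have hpressure := s.two_mul_inner_discreteIncr_sub_le hτ hχ₀ hχ₁ hS hzero henergy hk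
  have hpenalty := congrArg (χ * τ / 2 * ·)
    (two_mul_inner_add_sub_eq (s.divErr k) (s.divErr (k + 1)) (s.divErr (k + 2)))
  have hdiv : χ * τ / 2 * ‖s.divErr (k + 2) - s.divErr k‖ ^ 2 ≤
      τ / 2 * ‖s.divErr (k + 2) - s.divErr k‖ ^ 2 := by
    gcongr
    exact mul_le_of_le_one_left hτ.le hχ₁
  rw [hconst] at hresidual
  simp only [energy, add_assoc k 1 1, one_add_one_eq_two]
  linarith [s.sum_splitEnergy_step_le hτ hk]

lemma splitEnergy_errIncr_zero_le (hτ : 0 < τ) (hτT : τ ≤ T) (hC : 0 ≤ C) (hK : 0 < K)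
    (i : Fin d) : splitEnergy (τ / 2) (s.errIncr 0 i) ≤ (2 * C + C * T) ^ 2 * τ ^ 4 := by
  have hrhs : ‖s.residual 0 i - s.pressureGrad 0 i‖ ≤ (2 * C + C * T) * τ := by
    have hresidual := s.norm_residual_le 0 hK i
    rw [if_pos rfl] at hresidual
    have hCT : C * τ ^ 2 ≤ C * T * τ := by
      rw [sq, ← mul_assoc]
      gcongr
    linarith [norm_sub_le (s.residual 0 i) (s.pressureGrad 0 i), s.norm_pressureGrad_zero_le i]
  have hcoeff : ∀ n, sinCoeff n (τ • (s.residual 0 i - s.pressureGrad 0 i)) =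
      splitSymbol (τ / 2) n * sinCoeff n (s.errIncr 0 i) := fun n => by
    have hmomentum := s.momentum 0 hK i n
    simp only [errIncr, s.err_zero, Pi.sub_apply, Pi.zero_apply, map_zero, map_sub, map_smul,
      smul_eq_mul, mul_zero, neg_zero, zero_sub, zero_add] at hmomentum ⊢
    linarith
  calc splitEnergy (τ / 2) (s.errIncr 0 i)
      ≤ ‖τ • (s.residual 0 i - s.pressureGrad 0 i)‖ ^ 2 :=
        splitEnergy_le_norm_sq (half_pos hτ) (s.memDirichletDomain_sub hK (Nat.zero_le K) i)
          hcoeff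
    _ ≤ (τ * ((2 * C + C * T) * τ)) ^ 2 := by
        rw [norm_smul, Real.norm_of_nonneg hτ.le]
        gcongr
    _ = (2 * C + C * T) ^ 2 * τ ^ 4 := by ring

lemma energy_zero_le (hτ : 0 < τ) (hτT : τ ≤ T) (hC : 0 ≤ C) (hχ : χ ≤ 1) (hK : 0 < K) :
    s.energy 0 ≤ (3 * d * (2 * C + C * T) ^ 2 + 2 * C ^ 2) * τ ^ 4 := by
  have hsplit : ∑ i, splitEnergy (τ / 2) (s.errIncr 0 i) ≤
      d * ((2 * C + C * T) ^ 2 * τ ^ 4) := by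
    simpa only [Finset.card_univ, Fintype.card_fin, nsmul_eq_mul] using
      Finset.sum_le_card_nsmul Finset.univ (fun i => splitEnergy (τ / 2) (s.errIncr 0 i)) _
        fun i _ => s.splitEnergy_errIncr_zero_le hτ hτT hC hK i
  have hexact := pow_le_pow_left₀ (norm_nonneg _) (s.norm_exactIncr_le 1 hK) 2
  have hdiscrete : ‖s.discreteIncr 1‖ ^ 2 ≤ ∑ i, ‖s.errIncr 0 i‖ ^ 2 := by
    simpa only [errIncr, s.err_zero, sub_zero] using s.norm_sq_discreteIncr_le hK
  have hincrErr := norm_sub_sq_le_two_mul (s.exactIncr 1) (s.discreteIncr 1)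
  have hlower := s.sum_norm_sq_errIncr_add_le hτ hK
  have hcurl := mul_nonneg (half_pos hτ).le (curlSq_nonneg (s.grad (0 + 1) - s.grad 0))
  have hdiv : χ * τ / 2 * ‖s.divErr 1‖ ^ 2 ≤ τ / 2 * ‖s.divErr 1‖ ^ 2 := by
    gcongr
    exact mul_le_of_le_one_left hτ.le hχ
  have hdivErr : 0 ≤ τ / 2 * ‖s.divErr 1‖ ^ 2 := by positivity
  simp only [energy, incrErr, zero_add, s.divErr_zero, sub_zero] at hlower hcurl ⊢
  linarith

end ErrorSystem

section Recursion

variable {K k : ℕ} {E F r : ℕ → ℝ}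

lemma add_sum_range_le_of_step (hstep : ∀ k, k + 1 < K → E (k + 1) + F k ≤ E k + r k)
    (hk : k < K) :
    E k + ∑ j ∈ Finset.range k, F j ≤ E 0 + ∑ j ∈ Finset.range k, r j := by
  induction k with
  | zero => simp only [Finset.range_zero, Finset.sum_empty, le_refl]
  | succ k ih =>
    rw [Finset.sum_range_succ, Finset.sum_range_succ]
    linarith [hstep k hk, ih (by lia)]

lemma sum_range_add_ite_zero_le {α γ : ℝ} (hγ : 0 ≤ γ) (k : ℕ) :
    ∑ j ∈ Finset.range k, (α + if j = 0 then γ else 0) ≤ k * α + γ := by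
  rw [Finset.sum_add_distrib, Finset.sum_const, Finset.card_range, nsmul_eq_mul,
    Finset.sum_ite_eq']
  split_ifs <;> linarith

lemma le_two_mul_add_sq_of_forall_le_sq {G : ℕ → ℝ} {a b c : ℝ} (hb : 0 ≤ b) (hc : c ^ 2 ≤ a)
    (hEG : ∀ k < K, E k ≤ G k)
    (hG : ∀ S, 0 ≤ S → c ≤ S → (∀ k < K, E k ≤ S ^ 2) → ∀ k < K, G k ≤ a + b * S)
    (hk : k < K) : G k ≤ 2 * a + b ^ 2 := by
  obtain ⟨m, hm, hmax⟩ := Finset.exists_max_image (Finset.range K) E ⟨k, Finset.mem_range.2 hk⟩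
  rw [Finset.mem_range] at hm
  set S := √(max (E m) (c ^ 2))
  have hS : 0 ≤ S := Real.sqrt_nonneg _
  have hSsq : S ^ 2 = max (E m) (c ^ 2) := Real.sq_sqrt (le_max_of_le_right (sq_nonneg c))
  have hbound := hG S hS (Real.le_sqrt_of_sq_le (le_max_right _ _)) fun j hj =>
    hSsq ▸ (hmax j (Finset.mem_range.2 hj)).trans (le_max_left _ _)
  have hSle : S ^ 2 ≤ a + b * S := hSsq ▸ max_le ((hEG m hm).trans (hbound m hm))
    (hc.trans (le_add_of_nonneg_right (mul_nonneg hb hS)))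
  linarith [hbound k hk, sq_nonneg (b - S)]

end Recursion

/-- The constant of the energy estimate. -/
def energyConst (d : ℕ) (C T : ℝ) : ℝ :=
  2 * (3 * d * (2 * C + C * T) ^ 2 + 2 * C ^ 2 + 6 * C ^ 2 * T ^ 2) +
    ((4 * d + 18) * C * T + 2 * d * C) ^ 2

namespace ErrorSystem

variable {d K k : ℕ} {τ χ C S T : ℝ} (s : ErrorSystem d K τ χ C)

/-- The energy together with the accumulated dissipation of the curl. -/
def dissipatedEnergy (k : ℕ) : ℝ :=
  s.energy k + ∑ j ∈ Finset.range k, τ / 2 * curlSq (s.grad (j + 2) - s.grad j)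

lemma energy_le_dissipatedEnergy (hτ : 0 < τ) (k : ℕ) : s.energy k ≤ s.dissipatedEnergy k :=
  le_add_of_nonneg_right
    (Finset.sum_nonneg fun _ _ => mul_nonneg (half_pos hτ).le (curlSq_nonneg _))

lemma norm_incrErr_zero_le : ‖s.incrErr 0‖ ≤ C * τ ^ 2 := by
  rw [incrErr, s.discreteIncr_zero, sub_zero]
  exact s.norm_exactIncr_le 0 (Nat.zero_le K)

lemma dissipatedEnergy_le_add_mul (hτ : 0 < τ) (hτT : τ ≤ T) (hKT : K * τ ≤ T) (hC : 0 ≤ C)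
    (hχ₀ : 0 ≤ χ) (hχ₁ : χ ≤ 1) (hS : 0 ≤ S) (hzero : ‖s.incrErr 0‖ ≤ S)
    (henergy : ∀ k < K, s.energy k ≤ S ^ 2) (hk : k < K) :
    s.dissipatedEnergy k ≤
      (3 * d * (2 * C + C * T) ^ 2 + 2 * C ^ 2 + 6 * C ^ 2 * T ^ 2) * τ ^ 4 +
        ((4 * d + 18) * C * T + 2 * d * C) * τ ^ 2 * S := by
  have hkT : k * τ ≤ T := by
    refine le_trans ?_ hKT
    gcongr
  have hfirst : k * ((4 * d + 18) * C * τ ^ 3 * S) ≤ (4 * d + 18) * C * T * τ ^ 2 * S := by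
    have := mul_le_mul_of_nonneg_left hkT
      (by positivity : 0 ≤ (4 * d + 18) * C * τ ^ 2 * S)
    linarith
  have hsecond : k * (6 * C ^ 2 * τ ^ 6) ≤ 6 * C ^ 2 * T ^ 2 * τ ^ 4 := by
    have := mul_le_mul_of_nonneg_left (mul_le_mul hkT hτT hτ.le (hτ.le.trans hτT))
      (by positivity : 0 ≤ 6 * C ^ 2 * τ ^ 4)
    linarith
  have hsum := add_sum_range_le_of_step
    (fun k hk => s.energy_step_le hτ hχ₀ hχ₁ hS hzero henergy hk) hk
  have hconst := sum_range_add_ite_zero_le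
    (α := (4 * d + 18) * C * τ ^ 3 * S + 6 * C ^ 2 * τ ^ 6)
    (by positivity : 0 ≤ 2 * d * C * τ ^ 2 * S) k
  rw [dissipatedEnergy]
  linarith [s.energy_zero_le hτ hτT hC hχ₁ (by lia)]

theorem dissipatedEnergy_le (hτ : 0 < τ) (hτT : τ ≤ T) (hKT : K * τ ≤ T) (hC : 0 ≤ C)
    (hχ₀ : 0 ≤ χ) (hχ₁ : χ ≤ 1) (hk : k < K) :
    s.dissipatedEnergy k ≤ energyConst d C T * τ ^ 4 := by
  have hT : 0 ≤ T := hτ.le.trans hτT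
  refine (le_two_mul_add_sq_of_forall_le_sq (c := C * τ ^ 2)
    (by positivity : 0 ≤ ((4 * d + 18) * C * T + 2 * d * C) * τ ^ 2) ?_
    (fun j _ => s.energy_le_dissipatedEnergy hτ j) (fun S hS hCS henergy j hj =>
      s.dissipatedEnergy_le_add_mul hτ hτT hKT hC hχ₀ hχ₁ hS
        (s.norm_incrErr_zero_le.trans hCS) henergy hj) hk).trans_eq ?_
  · have : 0 ≤ (3 * d * (2 * C + C * T) ^ 2 + C ^ 2 + 6 * C ^ 2 * T ^ 2) * τ ^ 4 := by positivity
    linarith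
  · rw [energyConst]
    ring

end ErrorSystem

/-! ### The error equations of the scheme -/

section DivergenceAndGradient

variable {d : ℕ} {v w : Field d} {g g' q : L2 d}

lemma HasWeakDeriv.eq_zero {l : List (Fin d)} (h : HasWeakDeriv l 0 g) : g = 0 :=
  h.unique (by simpa only [zero_smul] using h.smul 0)

lemma HasDiv.unique (h : HasDiv v g) (h' : HasDiv v g') : g = g' := by
  obtain ⟨D, hD, rfl⟩ := h
  obtain ⟨D', hD', rfl⟩ := h'
  exact Finset.sum_congr rfl fun i _ => (hD i).unique (hD' i)

lemma HasDiv.add (h : HasDiv v g) (h' : HasDiv w g') : HasDiv (v + w) (g + g') := by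
  obtain ⟨D, hD, rfl⟩ := h
  obtain ⟨D', hD', rfl⟩ := h'
  exact ⟨D + D', fun i => (hD i).add (hD' i), Finset.sum_add_distrib.symm⟩

lemma HasDiv.smul (h : HasDiv v g) (c : ℝ) : HasDiv (c • v) (c • g) := by
  obtain ⟨D, hD, rfl⟩ := h
  exact ⟨c • D, fun i => (hD i).smul c, Finset.smul_sum⟩

lemma HasDiv.sub (h : HasDiv v g) (h' : HasDiv w g') : HasDiv (v - w) (g - g') := by
  simpa only [sub_eq_add_neg, neg_one_smul] using h.add (h'.smul (-1))

lemma norm_le_l2Norm (v : Field d) (i : Fin d) : ‖v i‖ ≤ l2Norm v :=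
  Real.le_sqrt_of_sq_le (Finset.single_le_sum (f := fun i => ‖v i‖ ^ 2)
    (fun _ _ => sq_nonneg _) (Finset.mem_univ i))

lemma H1NormLE.norm_grad_le {r : ℝ} (h : H1NormLE q r) {G : Field d} (hG : HasGrad q G)
    (i : Fin d) : ‖G i‖ ≤ r := by
  obtain ⟨G', hG', hr⟩ := h
  rw [(hG i).unique (hG' i)]
  exact (norm_le_l2Norm G' i).trans
    ((Real.le_sqrt_of_sq_le (le_add_of_nonneg_left (sq_nonneg _))).trans hr)

end DivergenceAndGradient

section GridIncrements

open Set
open scoped NNReal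

variable {E : Type*} [NormedAddCommGroup E] {T τ : ℝ} {M : ℝ≥0} {J : ℝ → E} {k : ℕ}

/-- The increment of `J` from time `(k - 1) τ` to time `k τ`, for `k ≥ 1`. The truncated
subtraction makes the value at `k = 0` equal to the value at `k = 1`. -/
def gridIncr (τ : ℝ) (J : ℝ → E) (k : ℕ) : E :=
  J ((k - 1 : ℕ) * τ + τ) - J ((k - 1 : ℕ) * τ)

lemma norm_gridIncr_le (hJ : LipschitzOnWith M J (Icc 0 T)) (hτ : 0 ≤ τ)
    (hk : (k - 1 : ℕ) * τ + τ ≤ T) : ‖gridIncr τ J k‖ ≤ M * τ := by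
  have hk₀ : 0 ≤ (k - 1 : ℕ) * τ := by positivity
  have hle := hJ.norm_sub_le (x := (k - 1 : ℕ) * τ + τ) (y := (k - 1 : ℕ) * τ)
    ⟨by positivity, hk⟩ ⟨hk₀, by linarith⟩
  rwa [add_sub_cancel_left, Real.norm_of_nonneg hτ] at hle

lemma norm_gridIncr_succ_sub_le (hJ : LipschitzIncrements T M J) (hτ : 0 ≤ τ)
    (hk : k * τ + τ ≤ T) : ‖gridIncr τ J (k + 1) - gridIncr τ J k‖ ≤ M * τ ^ 2 := by
  cases k with
  | zero =>
    rw [gridIncr, gridIncr, zero_add, Nat.sub_self, sub_self, norm_zero]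
    positivity
  | succ k =>
    have hkτ : ((k + 1 : ℕ) : ℝ) * τ = k * τ + τ := by push_cast; ring
    have hk₀ : 0 ≤ k * τ := by positivity
    have hle := hJ.norm_sub_le (a := (k + 1 : ℕ) * τ) (b := k * τ) hτ (by positivity) hk hk₀
      (by linarith)
    rw [hkτ, add_sub_cancel_left, abs_of_nonneg hτ, mul_assoc, ← pow_two] at hle
    simpa only [gridIncr, Nat.add_sub_cancel, hkτ] using hle

lemma norm_midpoint_sub_gridIncr_le (hJ : LipschitzIncrements T M J) (hτ : 0 ≤ τ)
    (hk : (k + 1 / 2) * τ + τ ≤ T) :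
    ‖J ((k + 1 / 2) * τ + τ) - J ((k + 1 / 2) * τ) - gridIncr τ J (k + 1)‖ ≤ M * τ ^ 2 := by
  have hle := hJ.norm_sub_le (a := (k + 1 / 2) * τ) (b := k * τ) hτ (by positivity) hk
    (by positivity) (by linarith)
  rw [show (k + 1 / 2) * τ - k * τ = τ / 2 by ring, abs_of_nonneg (by positivity)] at hle
  refine hle.trans ?_
  rw [mul_assoc, pow_two]
  gcongr
  exact half_le_self hτ

lemma norm_midpoint_sub_extrapolation_le [NormedSpace ℝ E] (hJ : LipschitzIncrements T M J)
    (hτ : 0 ≤ τ) (hk : (k + 1 / 2) * τ + τ ≤ T) :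
    ‖J ((k + 1 / 2) * τ + τ) - J ((k + 1 / 2) * τ) -
      ((2 : ℝ) • gridIncr τ J (k + 1) - gridIncr τ J k)‖ ≤ 2 * M * τ ^ 2 := by
  have hmid := norm_midpoint_sub_gridIncr_le hJ hτ hk
  have hgrid := norm_gridIncr_succ_sub_le (k := k) hJ hτ (by linarith)
  rw [two_smul, show ∀ x y z : E, x - (y + y - z) = x - y - (y - z) by intros; abel]
  exact (norm_sub_le _ _).trans (by linarith)

lemma norm_smul_le_mul_pow_succ [NormedSpace ℝ E] {x : E} {C : ℝ} {n : ℕ} (hτ : 0 ≤ τ)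
    (hx : ‖x‖ ≤ C * τ ^ n) : ‖τ • x‖ ≤ C * τ ^ (n + 1) := by
  rw [norm_smul, Real.norm_of_nonneg hτ, pow_succ', mul_left_comm]
  exact mul_le_mul_of_nonneg_left hx hτ

end GridIncrements

section Scheme

open Set
open scoped NNReal

variable {d : ℕ} {T τ χ : ℝ} {f uE : ℝ → Field d} {pE : ℝ → L2 d} {u₀ : Field d} {p₀ φs : L2 d}
  {u : ℕ → Field d} {φ p : ℕ → L2 d} {K k : ℕ}

lemma VelocityStep.memDirichletDomain (hd : d = 2 ∨ d = 3) (hτ : 0 < τ) {F v w : Field d}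
    {q : L2 d} (hv : ∀ i, MemDirichletDomain (v i)) (h : VelocityStep d τ F q v w) (i : Fin d) :
    MemDirichletDomain (w i) := by
  obtain ⟨G, -, hG⟩ := h.exists_hasGrad_sinCoeff hd hτ hv
  obtain ⟨z, hz⟩ := (hv i).exists_sinCoeff_eq_laplaceSymbol_mul
  have hsub : MemDirichletDomain (w i - v i) :=
    .of_sinCoeff_eq_splitSymbol_mul (z := τ • (-z - G i + F i)) (half_pos hτ) fun n => by
      simp only [map_smul, map_add, map_sub, map_neg, hz, hG, smul_eq_mul]
  simpa only [sub_add_cancel] using hsub.add (hv i)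

namespace IsSchemeSolution

lemma memDirichletDomain (hd : d = 2 ∨ d = 3) (hτ : 0 < τ)
    (hs : IsSchemeSolution K τ χ f u₀ p₀ φs u φ p) (h₀ : ∀ i, MemDirichletDomain (u₀ i)) :
    ∀ k ≤ K, ∀ i, MemDirichletDomain (u k i) := by
  intro k
  induction k with
  | zero => exact fun _ => hs.init_u ▸ h₀
  | succ k ih =>
    exact fun hk => (hs.velocity k hk).memDirichletDomain hd hτ (ih (Nat.le_of_succ_le hk))

lemma exists_hasSqrtA (hd : d = 2 ∨ d = 3) (hτ : 0 < τ)
    (hs : IsSchemeSolution K τ χ f u₀ p₀ φs u φ p) (hk : k < K) {D : L2 d}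
    (hD : HasDiv (u (k + 1)) (-D)) :
    ∃ x, HasSqrtA (τ • φ (k + 1)) x ∧ HasSqrtA x D := by
  obtain ⟨D', hD', hA⟩ := hs.penalty k hk
  refine DirectionSplitting.exists_hasSqrtA fun n => ?_
  have hcoeff := hA.cosCoeff_eq hd n
  rw [hD'.unique hD, smul_neg, neg_neg, map_smul, smul_eq_mul, inv_mul_eq_iff_eq_mul₀ hτ.ne']
    at hcoeff
  rw [hcoeff, map_smul, smul_eq_mul, mul_left_comm]

lemma pressure_succ (hs : IsSchemeSolution K τ χ f u₀ p₀ φs u φ p) (hk : k < K) {D D' : L2 d}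
    (hD : HasDiv (u k) D) (hD' : HasDiv (u (k + 1)) D') :
    p (k + 1) = p k + φ (k + 1) - (χ / 2) • (D' + D) := by
  obtain ⟨D'', hD'', hp⟩ := hs.pressure k hk
  rw [hp, hD''.unique ((hD'.add hD).smul (1 / 2)), smul_smul, mul_one_div]

end IsSchemeSolution

lemma nat_mul_mem_Icc (hτ : 0 ≤ τ) (hKT : K * τ ≤ T) (hk : k ≤ K) : (k : ℝ) * τ ∈ Icc 0 T :=
  ⟨by positivity, (mul_le_mul_of_nonneg_right (Nat.cast_le.2 hk) hτ).trans hKT⟩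

lemma nat_mul_add_le (hτ : 0 ≤ τ) (hKT : K * τ ≤ T) (hk : k < K) : k * τ + τ ≤ T := by
  simpa only [Nat.cast_add_one, add_one_mul] using (nat_mul_mem_Icc hτ hKT (Nat.succ_le_of_lt hk)).2

lemma midpoint_add_le (hτ : 0 ≤ τ) (hKT : K * τ ≤ T) (hk : k + 1 < K) :
    (k + 1 / 2) * τ + τ ≤ T := by
  have hle := nat_mul_add_le hτ hKT hk
  push_cast at hle
  linarith

lemma pred_mul_add_le (hτ : 0 ≤ τ) (hτT : τ ≤ T) (hKT : K * τ ≤ T) (hk : k ≤ K) :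
    (k - 1 : ℕ) * τ + τ ≤ T := by
  cases k with
  | zero => simpa using hτT
  | succ k => exact nat_mul_add_le hτ hKT hk

lemma IsSchemeSolution.velErr_zero (hs : IsSchemeSolution K τ χ f (uE 0) p₀ φs u φ p) :
    velErr τ uE u 0 = 0 := by
  rw [velErr, hs.init_u, Nat.cast_zero, zero_mul, sub_self]

lemma hasDiv_of_velErr {g : Fin d → L2 d} (h : HasDiv (uE (k * τ)) 0)
    (hg : ∀ i, HasWeakDeriv [i] (velErr τ uE u k i) (g i)) : HasDiv (u k) (-∑ i, g i) := by
  simpa only [velErr, sub_sub_cancel, zero_sub] using h.sub ⟨g, hg, rfl⟩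

/-- The error of the pressure predictor `p^{k-1/2} + φ^{k-1/2}` in step `k`, as an approximation of
the pressure at time `(k + 1/2) τ`. -/
def predictorErr (τ : ℝ) (pE : ℝ → L2 d) (p φ : ℕ → L2 d) (k : ℕ) : L2 d :=
  pE ((k + 1 / 2) * τ) - (p k + φ k)

lemma exists_momentum_residual (hd : d = 2 ∨ d = 3) (hT : 0 ≤ T)
    (hf : ∀ i, MemWInf T 2 (fun t => f t i)) (hsol : IsStokesSolution T f uE pE)
    (hu : VelocityRegular T uE) (hp : PressureRegular T pE) :
    ∃ C, 0 ≤ C ∧ ∀ (K : ℕ) (τ χ : ℝ), 0 < τ → K * τ ≤ T →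
      ∀ (φs : L2 d) (u : ℕ → Field d) (φ p : ℕ → L2 d),
        IsSchemeSolution K τ χ f (uE 0) (pE 0) φs u φ p → ∀ k < K,
          ∃ Γ R : Field d, HasGrad (predictorErr τ pE p φ k) Γ ∧ (∀ i, ‖R i‖ ≤ C * τ ^ 2) ∧
            ∀ i n, splitSymbol (τ / 2) n *
                (sinCoeff n (velErr τ uE u (k + 1) i) - sinCoeff n (velErr τ uE u k i)) =
              τ * (-(laplaceSymbol n * sinCoeff n (velErr τ uE u k i)) - sinCoeff n (Γ i) +
                sinCoeff n (R i)) := by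
  choose C hC hres using fun i => hsol.exists_residual hT hf hu hp i
  obtain ⟨G, _, hG, -⟩ := hp.exists_hasGrad
  refine ⟨∑ i, C i, Finset.sum_nonneg fun i _ => hC i,
    fun K τ χ hτ hKT φs u φ p hs k hk => ?_⟩
  have hkτ : ((k + 1 : ℕ) : ℝ) * τ = (k + 1 / 2) * τ + τ / 2 := by push_cast; ring
  have hkT : (k + 1 / 2) * τ + τ / 2 ≤ T := hkτ ▸ (nat_mul_mem_Icc hτ.le hKT hk).2
  have hmid : (k + 1 / 2) * τ ∈ Icc 0 T := ⟨by positivity, by linarith⟩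
  have hhalf : τ / 2 ≤ (k + 1 / 2) * τ := by linarith [mul_nonneg k.cast_nonneg hτ.le]
  choose R hR hexact using fun i =>
    hres i ((k + 1 / 2) * τ) (τ / 2) (half_pos hτ) hhalf hkT _ (hG _ hmid i)
  obtain ⟨G', hG', hscheme⟩ := (hs.velocity k hk).exists_hasGrad_sinCoeff hd hτ
    (hs.memDirichletDomain hd hτ (hu.memDirichletDomain ⟨le_rfl, hT⟩) k hk.le)
  refine ⟨G _ - G', R, fun i => (hG _ hmid i).sub (hG' i), fun i => (hR i).trans ?_,
    fun i n => ?_⟩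
  · exact mul_le_mul (Finset.single_le_sum (fun j _ => hC j) (Finset.mem_univ i))
      (pow_le_pow_left₀ (half_pos hτ).le (half_le_self hτ.le) 2) (sq_nonneg _)
      (Finset.sum_nonneg fun j _ => hC j)
  · have hdiff := hexact i n
    rw [← hkτ, show (k + 1 / 2) * τ - τ / 2 = k * τ by ring] at hdiff
    simp only [velErr, Pi.sub_apply, map_sub]
    linear_combination hdiff - hscheme i n

lemma norm_grad_predictorErr_zero_le {c₀ : ℝ}
    (hs : IsSchemeSolution K τ χ f u₀ (pE 0) φs u φ p) (hτ : 0 ≤ τ)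
    (hinit : H1NormLE (pE (τ / 2) - (pE 0 + φs)) (c₀ * τ)) {Γ : Field d}
    (hΓ : HasGrad (predictorErr τ pE p φ 0) Γ) (i : Fin d) : ‖Γ i‖ ≤ |c₀| * τ := by
  rw [predictorErr, hs.init_p, hs.init_φ, Nat.cast_zero, zero_add, one_div_mul_eq_div] at hΓ
  exact (hinit.norm_grad_le hΓ i).trans (mul_le_mul_of_nonneg_right (le_abs_self c₀) hτ)

/- Only the first step sees the initial guess `φ^{-1/2}`. Replacing it by `0` moves the gradient of
`φ^{-1/2}`, which is of size `τ`, from the predictor error to the residual. -/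
lemma exists_momentum_residual_update (hd : d = 2 ∨ d = 3) (hT : 0 ≤ T)
    (hf : ∀ i, MemWInf T 2 (fun t => f t i)) (hsol : IsStokesSolution T f uE pE)
    (hu : VelocityRegular T uE) (hp : PressureRegular T pE) (c₀ : ℝ) :
    ∃ C, 0 ≤ C ∧ ∀ (K : ℕ) (τ χ : ℝ), 0 < τ → τ ≤ T → K * τ ≤ T →
      ∀ (φs : L2 d) (u : ℕ → Field d) (φ p : ℕ → L2 d),
        IsSchemeSolution K τ χ f (uE 0) (pE 0) φs u φ p →
        H1NormLE (pE (τ / 2) - (pE 0 + φs)) (c₀ * τ) →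
        ∃ Γ R : ℕ → Field d,
          (∀ k < K, HasGrad (predictorErr τ pE p (Function.update φ 0 0) k) (Γ k)) ∧
          (∀ i, ‖Γ 0 i‖ ≤ C * τ) ∧
          (∀ k < K, ∀ i, ‖R k i‖ ≤ C * τ ^ 2 + if k = 0 then C * τ else 0) ∧
          ∀ k < K, ∀ i n, splitSymbol (τ / 2) n *
              (sinCoeff n (velErr τ uE u (k + 1) i) - sinCoeff n (velErr τ uE u k i)) =
            τ * (-(laplaceSymbol n * sinCoeff n (velErr τ uE u k i)) - sinCoeff n (Γ k i) +
              sinCoeff n (R k i)) := by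
  obtain ⟨C, hC, hres⟩ := exists_momentum_residual hd hT hf hsol hu hp
  obtain ⟨G, M, hG, hM⟩ := hp.exists_hasGrad
  refine ⟨C + M + |c₀|, by positivity, fun K τ χ hτ hτT hKT φs u φ p hs hinit => ?_⟩
  choose! Γ R hΓ hR hmom using hres K τ χ hτ hKT φs u φ p hs
  have hhalf : τ / 2 ∈ Icc 0 T := ⟨by positivity, by linarith⟩
  have hzero : (0 : ℝ) ∈ Icc 0 T := ⟨le_rfl, hT⟩
  have hG₀ : ∀ i, ‖G (τ / 2) i - G 0 i‖ ≤ M * τ := fun i => by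
    refine ((hM i).norm_sub_le hhalf hzero).trans ?_
    rw [sub_zero, Real.norm_of_nonneg hhalf.1]
    gcongr
    exact half_le_self hτ.le
  have hpred' : predictorErr τ pE p (Function.update φ 0 0) 0 = pE (τ / 2) - pE 0 := by
    rw [predictorErr, hs.init_p, Function.update_self, add_zero, Nat.cast_zero, zero_add,
      one_div_mul_eq_div]
  refine ⟨Function.update Γ 0 (G (τ / 2) - G 0),
    Function.update R 0 (R 0 + (G (τ / 2) - G 0 - Γ 0)), ?_, ?_, ?_, ?_⟩
  · rintro (_ | k) hk
    · rw [hpred', Function.update_self]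
      exact fun i => (hG _ hhalf i).sub (hG _ hzero i)
    · simpa [predictorErr] using hΓ (k + 1) hk
  · intro i
    rw [Function.update_self]
    exact (hG₀ i).trans (by gcongr; linarith [abs_nonneg c₀])
  · rintro (_ | k) hk i
    · rw [Function.update_self, if_pos rfl]
      refine (norm_add_le_of_le (hR 0 hk i) (norm_sub_le_of_le (hG₀ i)
        (norm_grad_predictorErr_zero_le hs hτ.le hinit (hΓ 0 hk) i))).trans ?_
      have hrest : 0 ≤ (M + |c₀|) * τ ^ 2 + C * τ := by positivity
      linarith
    · rw [Function.update_of_ne k.succ_ne_zero, if_neg k.succ_ne_zero, add_zero]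
      exact (hR (k + 1) hk i).trans (by gcongr; linarith [abs_nonneg c₀, M.coe_nonneg])
  · rintro (_ | k) hk i n
    · simp only [Function.update_self, Pi.add_apply, Pi.sub_apply, map_add, map_sub]
      linear_combination hmom 0 hk i n
    · simpa only [Function.update_of_ne k.succ_ne_zero] using hmom (k + 1) hk i n

lemma IsSchemeSolution.exists_hasSqrtA_update (hd : d = 2 ∨ d = 3) (hτ : 0 < τ)
    (hs : IsSchemeSolution K τ χ f u₀ p₀ φs u φ p) {D : ℕ → L2 d} (hD₀ : D 0 = 0)
    (hD : ∀ k ≤ K, HasDiv (u k) (-D k)) :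
    ∃ X : ℕ → L2 d, ∀ k ≤ K,
      HasSqrtA (τ • Function.update φ 0 0 k) (X k) ∧ HasSqrtA (X k) (D k) := by
  have hX : ∀ k ≤ K, ∃ x, HasSqrtA (τ • Function.update φ 0 0 k) x ∧ HasSqrtA x (D k) := by
    rintro (_ | k) hk
    · rw [Function.update_self, smul_zero, hD₀]
      exact ⟨0, .zero, .zero⟩
    · rw [Function.update_of_ne k.succ_ne_zero]
      exact hs.exists_hasSqrtA hd hτ hk (hD (k + 1) hk)
  choose! X hX using hX
  exact ⟨X, hX⟩

lemma IsSchemeSolution.hasSqrtA_predictorErr_sub (hτ : 0 < τ) (hKT : K * τ ≤ T)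
    (hs : IsSchemeSolution K τ χ f u₀ p₀ φs u φ p) {J : ℝ → L2 d}
    (hJ : ∀ t ∈ Icc 0 T, HasSqrtA (pE t) (J t)) {D X : ℕ → L2 d}
    (hD : ∀ k ≤ K, HasDiv (u k) (-D k))
    (hX : ∀ k ≤ K, HasSqrtA (τ • Function.update φ 0 0 k) (X k)) (hk : k + 1 < K) :
    HasSqrtA (τ • (predictorErr τ pE p (Function.update φ 0 0) (k + 1) -
        predictorErr τ pE p (Function.update φ 0 0) k + (χ / 2) • (D (k + 1) + D k)))
      (τ • (J ((k + 1 / 2) * τ + τ) - J ((k + 1 / 2) * τ)) - (2 : ℝ) • X (k + 1) + X k) := by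
  have hkT := midpoint_add_le hτ.le hKT hk
  have hsqrt := ((((hJ ((k + 1 / 2) * τ + τ) ⟨by positivity, by linarith⟩).sub
    (hJ ((k + 1 / 2) * τ) ⟨by positivity, by linarith⟩)).smul τ).sub
    ((hX (k + 1) hk.le).smul 2)).add (hX k (by lia))
  convert hsqrt using 1
  rw [predictorErr, predictorErr, hs.pressure_succ (Nat.lt_of_succ_lt hk) (hD k (by lia))
    (hD (k + 1) hk.le), Function.update_of_ne k.succ_ne_zero,
    show ((k + 1 : ℕ) + 1 / 2 : ℝ) * τ = (k + 1 / 2) * τ + τ by push_cast; ring]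
  module

lemma IsSchemeSolution.exists_grad_velErr (hd : d = 2 ∨ d = 3) (hτ : 0 < τ) (hKT : K * τ ≤ T)
    (hs : IsSchemeSolution K τ χ f (uE 0) p₀ φs u φ p)
    (hu : ∀ t ∈ Icc 0 T, ∀ i, MemDirichletDomain (uE t i)) :
    (∀ k ≤ K, ∀ i, MemDirichletDomain (velErr τ uE u k i)) ∧ ∃ g : ℕ → Fin d → Field d,
      ∀ k ≤ K, ∀ i j, HasWeakDerivZeroTrace i (velErr τ uE u k j) (g k i j) := by
  have hT : 0 ≤ T := le_trans (by positivity) hKT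
  have hdom : ∀ k ≤ K, ∀ i, MemDirichletDomain (velErr τ uE u k i) := fun k hk i =>
    (hu _ (nat_mul_mem_Icc hτ.le hKT hk) i).sub
      (hs.memDirichletDomain hd hτ (hu 0 ⟨le_rfl, hT⟩) k hk i)
  choose! g hg using fun k hk i j => (hdom k hk j).exists_hasWeakDerivZeroTrace i
  exact ⟨hdom, g, hg⟩

lemma IsSchemeSolution.exists_errorSystem (hd : d = 2 ∨ d = 3) (hτ : 0 < τ) (hτT : τ ≤ T)
    (hKT : K * τ ≤ T) (hs : IsSchemeSolution K τ χ f (uE 0) p₀ φs u φ p)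
    (hu : ∀ t ∈ Icc 0 T, ∀ i, MemDirichletDomain (uE t i))
    (hdiv : ∀ t ∈ Icc 0 T, HasDiv (uE t) 0) {J : ℝ → L2 d} {M : ℝ≥0} {C : ℝ}
    (hJ : ∀ t ∈ Icc 0 T, HasSqrtA (pE t) (J t)) (hJ₁ : LipschitzOnWith M J (Icc 0 T))
    (hJ₂ : LipschitzIncrements T M J) (hM : 2 * M ≤ C) {Γ R : ℕ → Field d}
    (hΓ : ∀ k < K, HasGrad (predictorErr τ pE p (Function.update φ 0 0) k) (Γ k))
    (hΓ₀ : ∀ i, ‖Γ 0 i‖ ≤ C * τ)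
    (hR : ∀ k < K, ∀ i, ‖R k i‖ ≤ C * τ ^ 2 + if k = 0 then C * τ else 0)
    (hmom : ∀ k < K, ∀ i n, splitSymbol (τ / 2) n *
        (sinCoeff n (velErr τ uE u (k + 1) i) - sinCoeff n (velErr τ uE u k i)) =
      τ * (-(laplaceSymbol n * sinCoeff n (velErr τ uE u k i)) - sinCoeff n (Γ k i) +
        sinCoeff n (R k i))) :
    ∃ s : ErrorSystem d K τ χ C, s.err = velErr τ uE u := by
  obtain ⟨hdom, g, hg⟩ := hs.exists_grad_velErr hd hτ hKT hu
  have hMC : (M : ℝ) ≤ C := by linarith [M.coe_nonneg]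
  have hD : ∀ k ≤ K, HasDiv (u k) (-∑ i, g k i i) := fun k hk =>
    hasDiv_of_velErr (hdiv _ (nat_mul_mem_Icc hτ.le hKT hk)) fun i => (hg k hk i i).hasWeakDeriv
  have hD₀ : ∑ i, g 0 i i = 0 := Finset.sum_eq_zero fun i _ =>
    (hs.velErr_zero ▸ hg 0 K.zero_le i i).hasWeakDeriv.eq_zero
  obtain ⟨X, hX⟩ := hs.exists_hasSqrtA_update hd hτ (D := fun k => ∑ i, g k i i) hD₀ hD
  have hupdate := fun k (hk : k + 1 < K) =>
    hs.hasSqrtA_predictorErr_sub hτ hKT hJ hD (fun k hk => (hX k hk).1) hk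
  exact ⟨{
    err := velErr τ uE u
    grad := g
    discreteIncr := X
    exactIncr := fun k => τ • gridIncr τ J k
    midpointIncr := fun k => τ • (J ((k + 1 / 2) * τ + τ) - J ((k + 1 / 2) * τ))
    pressureErr := predictorErr τ pE p (Function.update φ 0 0)
    pressureGrad := Γ
    residual := R
    err_zero := hs.velErr_zero
    memDirichletDomain := hdom
    zeroTrace := hg
    hasGrad := hΓ
    momentum := hmom
    penalty := fun k hk => (hX k hk).2
    pressure_update := hupdate
    norm_residual_le := hR
    norm_pressureGrad_zero_le := hΓ₀
    norm_exactIncr_le := fun k hk => norm_smul_le_mul_pow_succ hτ.le (n := 1) <|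
      (norm_gridIncr_le hJ₁ hτ.le (pred_mul_add_le hτ.le hτT hKT hk)).trans <| by
        rw [pow_one]
        gcongr
    norm_exactIncr_sub_le := fun k hk => by
      rw [← smul_sub]
      exact norm_smul_le_mul_pow_succ hτ.le <|
        (norm_gridIncr_succ_sub_le hJ₂ hτ.le (nat_mul_add_le hτ.le hKT hk)).trans (by gcongr)
    norm_midpointIncr_sub_le := fun k hk => by
      rw [smul_comm, ← smul_sub, ← smul_sub]
      exact norm_smul_le_mul_pow_succ hτ.le <|
        (norm_midpoint_sub_extrapolation_le hJ₂ hτ.le (midpoint_add_le hτ.le hKT hk)).trans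
          (by gcongr) }, rfl⟩

lemma exists_errorSystem (hd : d = 2 ∨ d = 3) (hT : 0 ≤ T)
    (hf : ∀ i, MemWInf T 2 (fun t => f t i)) (hsol : IsStokesSolution T f uE pE)
    (hu : VelocityRegular T uE) (hp : PressureRegular T pE) (c₀ : ℝ) :
    ∃ C, 0 ≤ C ∧ ∀ (K : ℕ) (τ χ : ℝ), 0 < τ → τ ≤ T → K * τ ≤ T →
      ∀ (φs : L2 d) (u : ℕ → Field d) (φ p : ℕ → L2 d),
        IsSchemeSolution K τ χ f (uE 0) (pE 0) φs u φ p →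
        H1NormLE (pE (τ / 2) - (pE 0 + φs)) (c₀ * τ) →
        ∃ s : ErrorSystem d K τ χ C, s.err = velErr τ uE u := by
  obtain ⟨C, hC, hres⟩ := exists_momentum_residual_update hd hT hf hsol hu hp c₀
  obtain ⟨J, M, hJ, hJ₁, hJ₂⟩ := hp.exists_hasSqrtA
  refine ⟨C + 2 * M, by positivity, fun K τ χ hτ hτT hKT φs u φ p hs hinit => ?_⟩
  obtain ⟨Γ, R, hΓ, hΓ₀, hR, hmom⟩ := hres K τ χ hτ hτT hKT φs u φ p hs hinit
  have hCM : C ≤ C + 2 * M := le_add_of_nonneg_right (by positivity)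
  refine hs.exists_errorSystem hd hτ hτT hKT (fun t ht => hu.memDirichletDomain ht) hsol.divFree
    hJ hJ₁ hJ₂ (le_add_of_nonneg_left hC) hΓ (fun i => (hΓ₀ i).trans (by gcongr))
    (fun k hk i => (hR k hk i).trans ?_) hmom
  split_ifs <;> gcongr

end Scheme

/-! ### The error bound in the discrete norms -/

section Norms

variable {d : ℕ} {i : Fin d} {q g : L2 d} {v : Field d} {s : Finset ℕ} {a : ℕ → ℝ} {τ B : ℝ}

lemma wd_eq (h : HasWeakDeriv [i] q g) : wd i q = g := by
  have hex : ∃ g, HasWeakDeriv [i] q g := ⟨g, h⟩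
  rw [wd, dif_pos hex]
  exact hex.choose_spec.unique h

lemma l2Norm_sq (v : Field d) : l2Norm v ^ 2 = ∑ i, ‖v i‖ ^ 2 :=
  Real.sq_sqrt (Finset.sum_nonneg fun _ _ => sq_nonneg _)

lemma curlNorm_sq {g : Fin d → Field d} (h : ∀ i j, HasWeakDeriv [i] (v j) (g i j)) :
    curlNorm v ^ 2 = curlSq g := by
  simp only [curlNorm, fun i j => wd_eq (h i j)]
  exact Real.sq_sqrt (curlSq_nonneg g)

lemma divNorm_eq {g : Fin d → L2 d} (h : ∀ i, HasWeakDeriv [i] (v i) (g i)) :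
    divNorm v = ‖∑ i, g i‖ := by
  simp only [divNorm, fun i => wd_eq (h i)]

lemma lInfSeq_sq_le (hB : 0 ≤ B) (h : ∀ k ∈ s, a k ^ 2 ≤ B) : lInfSeq s a ^ 2 ≤ B := by
  refine (Real.le_sqrt (NNReal.coe_nonneg _) hB).1 (NNReal.coe_le_coe.2 ?_ |>.trans_eq
    (Real.coe_toNNReal _ B.sqrt_nonneg))
  exact Finset.sup_le fun k hk => Real.toNNReal_le_toNNReal (Real.le_sqrt_of_sq_le (h k hk))

lemma mul_lInfSeq_sq_le (hτ : 0 < τ) (hB : 0 ≤ B) (h : ∀ k ∈ s, τ * a k ^ 2 ≤ B) :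
    τ * lInfSeq s a ^ 2 ≤ B :=
  (le_div_iff₀' hτ).1 <| lInfSeq_sq_le (by positivity) fun k hk => (le_div_iff₀' hτ).2 (h k hk)

lemma lTwoSeq_sq (hτ : 0 ≤ τ) : lTwoSeq τ s a ^ 2 = τ * ∑ k ∈ s, a k ^ 2 :=
  Real.sq_sqrt (mul_nonneg hτ (Finset.sum_nonneg fun _ _ => sq_nonneg _))

end Norms

namespace ErrorSystem

variable {d K k : ℕ} {τ χ C B : ℝ} (s : ErrorSystem d K τ χ C)

lemma divNorm_err_eq (hk : k ≤ K) : divNorm (s.err k) = ‖s.divErr k‖ :=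
  divNorm_eq fun i => (s.zeroTrace k hk i i).hasWeakDeriv

lemma curlNorm_incr_err_succ_sq (hk : k < K) :
    curlNorm (incr s.err (k + 1)) ^ 2 = curlSq (s.grad (k + 1) - s.grad k) :=
  curlNorm_sq fun i j => (s.zeroTrace_sub hk hk.le i j).hasWeakDeriv

lemma incr_avg_succ (ψ : ℕ → Field d) (k : ℕ) :
    incr (avg ψ) (k + 1) = (1 / 2 : ℝ) • (ψ (k + 2) - ψ k) := by
  simp only [incr, avg, Nat.add_sub_cancel]
  module

lemma curlNorm_incr_avg_err_succ_sq (hk : k + 2 ≤ K) :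
    curlNorm (incr (avg s.err) (k + 1)) ^ 2 = 1 / 4 * curlSq (s.grad (k + 2) - s.grad k) := by
  rw [incr_avg_succ, curlNorm_sq (v := (1 / 2 : ℝ) • (s.err (k + 2) - s.err k))
    (g := (1 / 2 : ℝ) • (s.grad (k + 2) - s.grad k))
    fun i j => (s.zeroTrace_sub hk (by lia) i j).hasWeakDeriv.smul _, curlSq_smul]
  norm_num

lemma lInfSeq_l2Norm_incr_sq_le (hτ : 0 < τ) (hχ₀ : 0 ≤ χ) (hχ₁ : χ ≤ 1) (hB : 0 ≤ B)
    (hE : ∀ k < K, s.energy k ≤ B) :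
    lInfSeq (Finset.Icc 1 K) (fun k => l2Norm (incr s.err k)) ^ 2 ≤ B := by
  refine lInfSeq_sq_le hB fun k hk => ?_
  obtain ⟨hk₁, hk⟩ := Finset.mem_Icc.1 hk
  obtain ⟨k, rfl⟩ := Nat.exists_eq_add_of_le' hk₁
  rw [l2Norm_sq]
  exact (s.sum_norm_sq_errIncr_le_energy hτ hχ₀ hχ₁ hk).trans (hE k hk)

lemma mul_lInfSeq_curlNorm_incr_sq_le (hτ : 0 < τ) (hχ₀ : 0 ≤ χ) (hχ₁ : χ ≤ 1) (hB : 0 ≤ B)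
    (hE : ∀ k < K, s.energy k ≤ B) :
    τ * lInfSeq (Finset.Icc 1 K) (fun k => curlNorm (incr s.err k)) ^ 2 ≤ 2 * B := by
  refine mul_lInfSeq_sq_le hτ (by positivity) fun k hk => ?_
  obtain ⟨hk₁, hk⟩ := Finset.mem_Icc.1 hk
  obtain ⟨k, rfl⟩ := Nat.exists_eq_add_of_le' hk₁
  rw [s.curlNorm_incr_err_succ_sq hk]
  have herr : 0 ≤ ∑ i, ‖s.errIncr k i‖ ^ 2 := by positivity
  have hdiv : 0 ≤ χ * τ * ‖s.divErr (k + 1)‖ ^ 2 := by positivity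
  linarith [s.le_energy hτ hχ₁ hk, hE k hk, sq_nonneg ‖s.incrErr (k + 1)‖]

lemma mul_lInfSeq_divNorm_sq_le (hτ : 0 < τ) (hχ₀ : 0 < χ) (hχ₁ : χ ≤ 1) (hB : 0 ≤ B)
    (hE : ∀ k < K, s.energy k ≤ B) :
    τ * lInfSeq (Finset.range (K + 1)) (fun k => divNorm (s.err k)) ^ 2 ≤ χ⁻¹ * B := by
  refine mul_lInfSeq_sq_le hτ (by positivity) fun k hk => ?_
  rw [Finset.mem_range_succ_iff] at hk
  rw [s.divNorm_err_eq hk, le_inv_mul_iff₀ hχ₀, ← mul_assoc]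
  cases k with
  | zero => simpa [s.divErr_zero] using hB
  | succ k =>
    have hcurl := mul_nonneg (half_pos hτ).le (curlSq_nonneg (s.grad (k + 1) - s.grad k))
    have herr : 0 ≤ ∑ i, ‖s.errIncr k i‖ ^ 2 := by positivity
    linarith [s.le_energy hτ hχ₁ hk, hE k hk, sq_nonneg ‖s.incrErr (k + 1)‖]

lemma energy_nonneg (hτ : 0 < τ) (hχ₀ : 0 ≤ χ) (hχ₁ : χ ≤ 1) (hk : k < K) : 0 ≤ s.energy k :=
  le_trans (by positivity) (s.sum_norm_sq_errIncr_le_energy hτ hχ₀ hχ₁ hk)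

lemma lTwoSeq_curlNorm_incr_avg_sq_le (hτ : 0 < τ) (hχ₀ : 0 ≤ χ) (hχ₁ : χ ≤ 1) (hK : 0 < K)
    (hE : s.dissipatedEnergy (K - 1) ≤ B) :
    lTwoSeq τ (Finset.Icc 1 (K - 1)) (fun k => curlNorm (incr (avg s.err) k)) ^ 2 ≤ B := by
  have hsum : ∑ k ∈ Finset.Icc 1 (K - 1), curlNorm (incr (avg s.err) k) ^ 2 =
      ∑ j ∈ Finset.range (K - 1), 1 / 4 * curlSq (s.grad (j + 2) - s.grad j) := by
    rw [← Finset.Ico_add_one_right_eq_Icc, Finset.range_eq_Ico, ← zero_add 1,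
      ← Finset.sum_Ico_add']
    refine Finset.sum_congr rfl fun j hj => s.curlNorm_incr_avg_err_succ_sq ?_
    grind
  rw [lTwoSeq_sq hτ.le, hsum, Finset.mul_sum]
  refine le_trans (Finset.sum_le_sum fun j _ => ?_) ((le_add_of_nonneg_left
    (s.energy_nonneg hτ hχ₀ hχ₁ (Nat.sub_lt hK one_pos))).trans hE)
  linarith [mul_nonneg hτ.le (curlSq_nonneg (s.grad (j + 2) - s.grad j))]

end ErrorSystem

end DirectionSplitting

end

open DirectionSplitting in
theorem mainTheorem4 (d : ℕ) (hd : d = 2 ∨ d = 3) (T : ℝ) (hT : 0 < T)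
    (χ : ℝ) (hχ₀ : 0 < χ) (hχ₁ : χ ≤ 1)
    (f uE : ℝ → Field d) (pE : ℝ → L2 d)
    (hf : ∀ i, MemWInf T 2 (fun t => f t i))
    (hsol : IsStokesSolution T f uE pE)
    (hu : VelocityRegular T uE) (hp : PressureRegular T pE)
    (c₀ : ℝ) :
    ∃ c : ℝ, ∀ τ : ℝ, 0 < τ → τ ≤ T →
      ∀ (φs : L2 d) (u : ℕ → Field d) (φ p : ℕ → L2 d),
        IsSchemeSolution ⌊T / τ⌋₊ τ χ f (uE 0) (pE 0) φs u φ p →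
        H1NormLE (pE (τ / 2) - (pE 0 + φs)) (c₀ * τ) →
        (∀ k ≤ ⌊T / τ⌋₊, ∀ i, MemH1 (velErr τ uE u k i)) ∧
        lInfSeq (Finset.Icc 1 ⌊T / τ⌋₊) (fun k => l2Norm (incr (velErr τ uE u) k)) ^ 2
          + τ * lInfSeq (Finset.Icc 1 ⌊T / τ⌋₊)
              (fun k => curlNorm (incr (velErr τ uE u) k)) ^ 2
          + lTwoSeq τ (Finset.Icc 1 (⌊T / τ⌋₊ - 1))
              (fun k => curlNorm (incr (avg (velErr τ uE u)) k)) ^ 2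
          + τ * lInfSeq (Finset.range (⌊T / τ⌋₊ + 1))
              (fun k => divNorm (velErr τ uE u k)) ^ 2
        ≤ c * τ ^ 4 := by
  obtain ⟨C, hC, hsys⟩ := exists_errorSystem hd hT.le hf hsol hu hp c₀
  refine ⟨(4 + χ⁻¹) * energyConst d C T, fun τ hτ hτT φs u φ p hs hinit => ?_⟩
  have hK : 0 < ⌊T / τ⌋₊ := Nat.floor_pos.2 ((one_le_div hτ).2 hτT)
  have hKT : ⌊T / τ⌋₊ * τ ≤ T := (le_div_iff₀ hτ).1 (Nat.floor_le (by positivity))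
  obtain ⟨s, hse⟩ := hsys _ τ χ hτ hτT hKT φs u φ p hs hinit
  rw [← hse]
  refine ⟨fun k hk i j => ⟨_, (s.zeroTrace k hk j i).hasWeakDeriv⟩, ?_⟩
  have hdissipated : ∀ k < ⌊T / τ⌋₊, s.dissipatedEnergy k ≤ energyConst d C T * τ ^ 4 :=
    fun k hk => s.dissipatedEnergy_le hτ hτT hKT hC hχ₀.le hχ₁ hk
  have henergy : ∀ k < ⌊T / τ⌋₊, s.energy k ≤ energyConst d C T * τ ^ 4 := fun k hk =>
    (s.energy_le_dissipatedEnergy hτ k).trans (hdissipated k hk)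
  have hnonneg := (s.energy_nonneg hτ hχ₀.le hχ₁ hK).trans (henergy 0 hK)
  linarith [s.lInfSeq_l2Norm_incr_sq_le hτ hχ₀.le hχ₁ hnonneg henergy,
    s.mul_lInfSeq_curlNorm_incr_sq_le hτ hχ₀.le hχ₁ hnonneg henergy,
    s.lTwoSeq_curlNorm_incr_avg_sq_le hτ hχ₀.le hχ₁ hK (hdissipated _ (Nat.sub_lt hK one_pos)),
    s.mul_lInfSeq_divNorm_sq_le hτ hχ₀ hχ₁ hnonneg henergy]
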